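/- Let $n_1,n_2\in\mathbb N$, $1<\alpha<2$, $\sigma>0$, and let $L=(L_t)_{t\in\mathbb R}$ be a two-sided, strictly $\alpha$-stable, $\mathbb R^{n_2}$-valued Lévy process with càdlàg paths and $L_0=0$ on a probability space $(\Omega,\mathcal F,\mathbb P)$. Let $S\in\mathbb R^{n_1\times n_1}$, $F\in\mathbb R^{n_2\times n_2}$, $g_i:\mathbb R^{n_1}\times\mathbb R^{n_2}\to\mathbb R^{n_i}$ with $g_i(0,0)=0$ ($i=1,2$), and assume: (A1) there are $\gamma_s>0>\gamma_f$ with $|e^{St}x|\le e^{\gamma_s t}|x|$ for $t\le0$ and $|e^{Ft}y|\le e^{\gamma_f t}|y|$ for $t\ge0$; (A2) there is $K>0$ with $|g_i(x,y)-g_i(x',y')|\le K(|x-x'|+|y-y'|)$ for $i=1,2$; (A3) $K<-\gamma_f$; moreover $g_1$ is bounded, and $g_2$ is differentiable with globally Lipschitz derivative. Fix $\gamma>0$ with $K<-(\gamma+\gamma_f)$. For $\beta\in\mathbb R$ let $C_\beta^-$ be the space of continuous functions $\phi$ on $(-\infty,0]$ with $\sup_{t\le0}e^{-\beta t}|\phi(t)|<\infty$.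 Let $\xi(\theta_t\omega)=\int_{-\infty}^te^{F(t-s)}dL_s(\omega)$ and $\eta^{1/\varepsilon}(\theta_t\omega)=\varepsilon^{-1/\alpha}\int_{-\infty}^te^{F(t-s)/\varepsilon}dL_s(\omega)$; these improper pathwise integrals converge almost surely (for all $t$ and $\varepsilon$ simultaneously). For $\varepsilon>0$ let the slow manifold $\mathcal M^\varepsilon(\omega)$ be the set of all $(x_0,y_0)$ for which the solution on $(-\infty,0]$ of $$dx=Sx\,dt+g_1(x,y+\sigma\eta^{1/\varepsilon}(\theta_t\omega))\,dt,\qquad dy=\tfrac1\varepsilon Fy\,dt+\tfrac1\varepsilon g_2(x,y+\sigma\eta^{1/\varepsilon}(\theta_t\omega))\,dt,\qquad (x(0),y(0))=(x_0,y_0),$$ belongs to $C^-_{-\gamma/\varepsilon}$. Then almost surely, for every $x_0\in\mathbb R^{n_1}$, there is a unique $y^0\in C^-_{-\gamma}$ with $y^0(t)=\int_{-\infty}^te^{F(t-s)}g_2(x_0,y^0(s)+\sigma\xi(\theta_s\omega))\,ds$ for $t\le0$; put $$h^0(\omega,x_0)=\int_{-\infty}^0e^{-Fs}g_2(x_0,y^0(s)+\sigma\xi(\theta_s\omega))\,ds,\qquad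 x^1(t)=Sx_0t+\int_0^tg_1(x_0,y^0(s)+\sigma\xi(\theta_s\omega))\,ds.$$ With the partial derivatives $g_{2,x},g_{2,y}$ evaluated at $(x_0,y^0(t)+\sigma\xi(\theta_t\omega))$, there is also a unique $y^1\in C^-_{-\gamma}$ solving, on $(-\infty,0]$, the linearized problem $$dy^1=g_{2,x}\,x^1(t)\,dt+[F+g_{2,y}]\,y^1(t)\,dt,\qquad y^1(0)=h^1(\omega,x_0):=\int_{-\infty}^0e^{-Fs}\big[g_{2,x}\,x^1(s)+g_{2,y}\,y^1(s)\big]ds .$$ If $F$ and all matrices $g_{2,y}(x_0,y)$, $y\in\mathbb R^{n_2}$, commute with each other (for instance if $n_2=1$), then for $t\le 0$ $$y^1(t)=e^{Ft+\int_0^tg_{2,y}\,du}\,h^1(\omega,x_0)+\int_0^te^{F(t-s)+\int_s^tg_{2,y}\,du}\,g_{2,x}\,x^1(s)\,ds .$$ Moreover, there is $\delta>0$ such that for $\varepsilon\in(0,\delta)$ the slow manifold is almost surely a graph, $\mathcal M^\varepsilon(\omega)=\{(x_0,\hat h^\varepsilon(\omega,x_0)):x_0\in\mathbb R^{n_1}\}$,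 and has in distribution the expansion $$\mathcal M^\varepsilon(\omega)\stackrel{d}{=}\{(x_0,\;h^0(\omega,x_0)+\varepsilon h^1(\omega,x_0)+R^\varepsilon(\omega,x_0)):x_0\in\mathbb R^{n_1}\},\qquad R^\varepsilon=\mathcal O(\varepsilon^2).$$ That is, the random fields $x_0\mapsto\hat h^\varepsilon(\cdot,x_0)$ and $x_0\mapsto h^0(\cdot,x_0)+\varepsilon h^1(\cdot,x_0)+R^\varepsilon(\cdot,x_0)$ have the same law, and for every $r$ there is a constant $C$ such that almost surely $|R^\varepsilon(\omega,x_0)|\le C\varepsilon^2$ for all $\varepsilon\in(0,\delta)$ and $|x_0|\le r$. -/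

import Mathlib

open MeasureTheory ProbabilityTheory Set Filter Topology

noncomputable section

/-- Euclidean space `ℝⁿ`. -/
abbrev Euc (n : ℕ) : Type := EuclideanSpace ℝ (Fin n)

/-- The linear flow `e^{tA}`. -/
def linFlow {n : ℕ} (A : Euc n →L[ℝ] Euc n) (t : ℝ) : Euc n →L[ℝ] Euc n :=
  NormedSpace.exp (t • A)

/-! ### The noise -/

/-- Right-continuous paths with left limits. -/
def IsCadlagPath {n : ℕ} (ℓ : ℝ → Euc n) : Prop :=
  ∀ t, ContinuousWithinAt ℓ (Ici t) t ∧ ∃ l, Tendsto ℓ (𝓝[<] t) (𝓝 l)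

/-- A two-sided (strictly) `α`-stable Lévy process in `ℝⁿ` with càdlàg paths: it starts at zero, has
independent and stationary increments, and `L_c` has the law of `c^{1/α} L_1` for every `c > 0`. -/
structure IsTwoSidedStableLevy {Ω : Type*} [MeasurableSpace Ω] {n : ℕ} (α : ℝ)
    (L : ℝ → Ω → Euc n) (P : Measure Ω) : Prop where
  measurable : ∀ t, Measurable (L t)
  zero : ∀ ω, L 0 ω = 0
  cadlag : ∀ ω, IsCadlagPath (fun t => L t ω)
  indep_increments : HasIndepIncrements L P
  stationary_increments : ∀ s t, s ≤ t →
    P.map (fun ω => L t ω - L s ω) = P.map (L (t - s))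
  stable : ∀ c : ℝ, 0 < c → P.map (L c) = P.map (fun ω => c ^ (1 / α) • L 1 ω)

/-- The shift `θ_t ℓ = ℓ(t + ·) - ℓ(t)` on paths. -/
def pathShift {n : ℕ} (t : ℝ) (ℓ : ℝ → Euc n) : ℝ → Euc n := fun s => ℓ (t + s) - ℓ t

/-- The integral `∫_a^b Φ(s) dℓ(s)` of a deterministic continuously differentiable operator-valued
integrand against a càdlàg path, i.e. (integration by parts)
`Φ(b) ℓ(b) - Φ(a) ℓ(a) - ∫_a^b Φ'(s) ℓ(s) ds`. -/
def pathIntegral {n : ℕ} (Φ : ℝ → Euc n →L[ℝ] Euc n) (ℓ : ℝ → Euc n) (a b : ℝ) : Euc n :=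
  Φ b (ℓ b) - Φ a (ℓ a) - ∫ s in a..b, (deriv Φ s) (ℓ s)

/-- The random variable `∫_{-∞}^0 e^{-As} dℓ(s)`, an improper integral at `-∞`. -/
def ouVariable {n : ℕ} (A : Euc n →L[ℝ] Euc n) (ℓ : ℝ → Euc n) : Euc n :=
  limUnder atBot (fun a => pathIntegral (fun s => linFlow A (-s)) ℓ a 0)

/-! ### The slow-fast system -/

/-- The data of the slow-fast system
`dx = S x dt + g₁(x,y) dt`, `dy = ε⁻¹ F y dt + ε⁻¹ g₂(x,y) dt + σ ε^{-1/α} dL^α`. -/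
structure SlowFastSystem (n₁ n₂ : ℕ) where
  S : Euc n₁ →L[ℝ] Euc n₁
  F : Euc n₂ →L[ℝ] Euc n₂
  g₁ : Euc n₁ × Euc n₂ → Euc n₁
  g₂ : Euc n₁ × Euc n₂ → Euc n₂
  σ : ℝ
  α : ℝ

namespace SlowFastSystem

variable {n₁ n₂ : ℕ} (sys : SlowFastSystem n₁ n₂)

/-- `ξ(θ_t ω)` with `ξ = ∫_{-∞}^0 e^{-Fs} dL_s`, as a function of the driving path `ℓ = L(ω)`. -/
def xi (ℓ : ℝ → Euc n₂) (t : ℝ) : Euc n₂ := ouVariable sys.F (pathShift t ℓ)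

/-- `η^{1/ε}(θ_t ω)` with `η^{1/ε} = ε^{-1/α} ∫_{-∞}^0 e^{-Fs/ε} dL_s`, as a function of the driving
path `ℓ = L(ω)`. -/
def eta (ε : ℝ) (ℓ : ℝ → Euc n₂) (t : ℝ) : Euc n₂ :=
  ε ^ (-(1 / sys.α)) • ouVariable (ε⁻¹ • sys.F) (pathShift t ℓ)

/-- The weighted space of continuous `φ : (-∞,0] → ℝⁿ` with `sup_{t ≤ 0} e^{-βt} |φ(t)| < ∞`. -/
def InWeighted {n : ℕ} (β : ℝ) (φ : ℝ → Euc n) : Prop :=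
  ContinuousOn φ (Iic 0) ∧ ∃ C : ℝ, ∀ t ≤ 0, Real.exp (-β * t) * ‖φ t‖ ≤ C

/-- `(x, y)` solves on `(-∞,0]`, with value `(x₀, y₀)` at time `0`, the random differential equation
`dx = S x dt + g₁(x, y + z(t)) dt`, `dy = ε⁻¹ F y dt + ε⁻¹ g₂(x, y + z(t)) dt`
(the path `z` is only càdlàg, so the equation is read in integrated form). -/
def IsBackwardOrbit (ε : ℝ) (z : ℝ → Euc n₂) (p : Euc n₁ × Euc n₂)
    (x : ℝ → Euc n₁) (y : ℝ → Euc n₂) : Prop :=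
  ∀ t ≤ 0,
    x t = p.1 + ∫ s in (0 : ℝ)..t, (sys.S (x s) + sys.g₁ (x s, y s + z s)) ∧
    y t = p.2 + ∫ s in (0 : ℝ)..t, ε⁻¹ • (sys.F (y s) + sys.g₂ (x s, y s + z s))

/-- The slow manifold `𝓜^ε(ω)` of the random system driven by `σ η^{1/ε}(θ_t ω)`: the initial
points whose backward orbit lies in the weighted space with exponent `β = -γ/ε`. -/
def slowManifold (γ ε : ℝ) (ℓ : ℝ → Euc n₂) : Set (Euc n₁ × Euc n₂) :=
  {p | ∃ (x : ℝ → Euc n₁) (y : ℝ → Euc n₂), InWeighted (-γ / ε) x ∧ InWeighted (-γ / ε) y ∧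
    sys.IsBackwardOrbit ε (fun s => sys.σ • sys.eta ε ℓ s) p x y}

/-! ### The coefficients of the expansion; `z(s)` stands for `σ ξ(θ_s ω)` -/

/-- `y` is a solution in the weighted space with exponent `-γ` of
`y(t) = ∫_{-∞}^t e^{F(t-s)} g₂(x₀, y(s) + z(s)) ds`, `t ≤ 0`. -/
def IsCriticalFast (γ : ℝ) (z : ℝ → Euc n₂) (x₀ : Euc n₁) (y : ℝ → Euc n₂) : Prop :=
  InWeighted (-γ) y ∧ ∀ t ≤ 0,
    IntegrableOn (fun s => linFlow sys.F (t - s) (sys.g₂ (x₀, y s + z s))) (Iic t) ∧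
    y t = ∫ s in Iic t, linFlow sys.F (t - s) (sys.g₂ (x₀, y s + z s))

/-- The solution `y⁰`. -/
def y0 (γ : ℝ) (z : ℝ → Euc n₂) (x₀ : Euc n₁) : ℝ → Euc n₂ :=
  Classical.epsilon (sys.IsCriticalFast γ z x₀)

/-- `h⁰(x₀) = ∫_{-∞}^0 e^{-Fs} g₂(x₀, y⁰(s) + z(s)) ds`. -/
def h0 (γ : ℝ) (z : ℝ → Euc n₂) (x₀ : Euc n₁) : Euc n₂ :=
  ∫ s in Iic (0 : ℝ), linFlow sys.F (-s) (sys.g₂ (x₀, sys.y0 γ z x₀ s + z s))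

/-- The partial derivative `g_{2,x}`. -/
def g2x (p : Euc n₁ × Euc n₂) : Euc n₁ →L[ℝ] Euc n₂ :=
  fderiv ℝ (fun x => sys.g₂ (x, p.2)) p.1

/-- The partial derivative `g_{2,y}`. -/
def g2y (p : Euc n₁ × Euc n₂) : Euc n₂ →L[ℝ] Euc n₂ :=
  fderiv ℝ (fun y => sys.g₂ (p.1, y)) p.2

/-- The point `(x₀, y⁰(s) + z(s))` at which the derivatives are taken. -/
def basePoint (γ : ℝ) (z : ℝ → Euc n₂) (x₀ : Euc n₁) (s : ℝ) : Euc n₁ × Euc n₂ :=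
  (x₀, sys.y0 γ z x₀ s + z s)

/-- `x¹(t) = S x₀ t + ∫_0^t g₁(x₀, y⁰(s) + z(s)) ds`. -/
def x1 (γ : ℝ) (z : ℝ → Euc n₂) (x₀ : Euc n₁) (t : ℝ) : Euc n₁ :=
  t • sys.S x₀ + ∫ s in (0 : ℝ)..t, sys.g₁ (sys.basePoint γ z x₀ s)

/-- `x¹(s) g_{2,x} + y(s) g_{2,y}`, with derivatives at `(x₀, y⁰(s) + z(s))`. -/
def linTerm (γ : ℝ) (z : ℝ → Euc n₂) (x₀ : Euc n₁) (y : ℝ → Euc n₂) (s : ℝ) : Euc n₂ :=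
  sys.g2x (sys.basePoint γ z x₀ s) (sys.x1 γ z x₀ s) + sys.g2y (sys.basePoint γ z x₀ s) (y s)

/-- `∫_{-∞}^0 e^{-Fs} [x¹(s) g_{2,x} + y(s) g_{2,y}] ds`. -/
def h1Integral (γ : ℝ) (z : ℝ → Euc n₂) (x₀ : Euc n₁) (y : ℝ → Euc n₂) : Euc n₂ :=
  ∫ s in Iic (0 : ℝ), linFlow sys.F (-s) (sys.linTerm γ z x₀ y s)

/-- `y` is a solution in the weighted space with exponent `-γ` of the linearized equation
`dy = x¹(t) g_{2,x} dt + [F + g_{2,y}] y(t) dt`, `t ≤ 0`, whose value at time `0` is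
`∫_{-∞}^0 e^{-Fs} [x¹(s) g_{2,x} + y(s) g_{2,y}] ds`. -/
def IsFastCorrection (γ : ℝ) (z : ℝ → Euc n₂) (x₀ : Euc n₁) (y : ℝ → Euc n₂) : Prop :=
  InWeighted (-γ) y ∧
  IntegrableOn (fun s => linFlow sys.F (-s) (sys.linTerm γ z x₀ y s)) (Iic 0) ∧
  ∀ t ≤ 0, y t = sys.h1Integral γ z x₀ y +
    ∫ s in (0 : ℝ)..t, (sys.F (y s) + sys.linTerm γ z x₀ y s)

/-- The solution `y¹`. -/
def y1 (γ : ℝ) (z : ℝ → Euc n₂) (x₀ : Euc n₁) : ℝ → Euc n₂ :=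
  Classical.epsilon (sys.IsFastCorrection γ z x₀)

/-- `h¹(x₀) = ∫_{-∞}^0 e^{-Fs} [x¹(s) g_{2,x} + y¹(s) g_{2,y}] ds`. -/
def h1 (γ : ℝ) (z : ℝ → Euc n₂) (x₀ : Euc n₁) : Euc n₂ :=
  sys.h1Integral γ z x₀ (sys.y1 γ z x₀)

end SlowFastSystem

end

/-! Idea of the proof. In the fast time `t/ε` the system becomes `x' = ε (S x + g₁)`, `y' = F y +
g₂`, the weight exponent `-γ/ε` becomes `-γ`, and the noise `η^{1/ε}` becomes `ξ` computed along the
rescaled path `ε^{-1/α} L(ε ·)` (`eta_mul`). Thus the slow manifold is the graph of one measurable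
functional `graphMap ε` evaluated at the rescaled path (`slowManifold_eq`, `measurable_graphMap`).
By self-similarity the rescaled path has the law of `L` (`map_scaledPath`), so the height function
has the law of `graphMap ε` at `L` itself, where the noise `σ ξ` no longer depends on `ε`. The
expansion is proved there, path by path.

For a fixed noise path, orbits on `(-∞,0]` in the weighted space are exactly the fixed points of the
Lyapunov–Perron operator `lpOperator` (`exists_orbit_iff`): the growth bound excludes every solution
of the fast equation except the convolution with `e^{tF}` from `-∞`. The operator contracts with
ratio `ε (‖S‖ + K)/γ + K/(-(γ + γf))`, which is below one for small `ε`. At `ε = 0` its fixed point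
is `(x₀, y⁰)`, and `y¹` is the fixed point of a linear problem of the same type.

The curve `(x₀ + ε x¹, y⁰ + ε y¹)` is a fixed point up to a defect of order `ε²`
(`sumNorm_lpOperator_approx_le`), and a contraction turns a small defect into a small distance
(`IsLPSystem.stability`). The defect is quadratic in `(x¹, y¹)`, so these are estimated in the
weight `γ/2`, whose square is the weight `γ`. Since `g₁` is bounded and `g₂` is Lipschitz, these
estimates do not depend on the noise, which makes the remainder constant deterministic.

The noise enters only through right-continuity, measurability and exponential bounds with a small
rate. These follow from almost sure quadratic growth of the stable paths (`ae_growth`), obtained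
from Ottaviani's inequality, a tail bound for `L 1` and Borel–Cantelli. -/

noncomputable section

/-! ### The linear flow -/

section ExpFlow

variable {V : Type*} [NormedAddCommGroup V] [NormedSpace ℝ V] [CompleteSpace V] (A : V →L[ℝ] V)

theorem expFlow_add (s t : ℝ) :
    NormedSpace.exp ((s + t) • A) = NormedSpace.exp (s • A) * NormedSpace.exp (t • A) := by
  let _ : NormedAlgebra ℚ (V →L[ℝ] V) := NormedAlgebra.restrictScalars ℚ ℝ _
  rw [add_smul, NormedSpace.exp_add_of_commute]
  exact ((Commute.refl A).smul_left s).smul_right t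

omit [CompleteSpace V] in
theorem expFlow_comm (t : ℝ) (x : V) :
    NormedSpace.exp (t • A) (A x) = A (NormedSpace.exp (t • A) x) := by
  let _ : NormedAlgebra ℚ (V →L[ℝ] V) := NormedAlgebra.restrictScalars ℚ ℝ _
  have h : Commute (NormedSpace.exp (t • A)) A := ((Commute.refl A).smul_left t).exp_left
  exact congrArg (fun B : V →L[ℝ] V => B x) h.eq

omit [CompleteSpace V] in
theorem expFlow_zero : NormedSpace.exp ((0 : ℝ) • A) = 1 := by
  rw [zero_smul, NormedSpace.exp_zero]

omit [CompleteSpace V] in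
theorem expFlow_smul (c t : ℝ) :
    NormedSpace.exp (t • (c • A)) = NormedSpace.exp ((t * c) • A) := by
  rw [smul_smul]

end ExpFlow

section LinFlow

variable {n : ℕ} (A : Euc n →L[ℝ] Euc n)

theorem hasDerivAt_linFlow (t : ℝ) : HasDerivAt (linFlow A) (A * linFlow A t) t :=
  hasDerivAt_exp_smul_const' (𝕂 := ℝ) A t

theorem continuous_linFlow : Continuous (linFlow A) :=
  continuous_iff_continuousAt.2 fun t => (hasDerivAt_linFlow A t).continuousAt

@[simp] theorem linFlow_zero : linFlow A 0 = 1 :=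
  expFlow_zero A

theorem linFlow_add (s t : ℝ) : linFlow A (s + t) = linFlow A s * linFlow A t :=
  expFlow_add A s t

theorem linFlow_add_apply (s t : ℝ) (x : Euc n) :
    linFlow A (s + t) x = linFlow A s (linFlow A t x) := by
  rw [linFlow_add]; rfl

@[simp] theorem linFlow_neg_apply_linFlow (t : ℝ) (x : Euc n) :
    linFlow A (-t) (linFlow A t x) = x := by
  rw [← linFlow_add_apply]; simp

@[simp] theorem linFlow_apply_linFlow_neg (t : ℝ) (x : Euc n) :
    linFlow A t (linFlow A (-t) x) = x := by
  rw [← linFlow_add_apply]; simp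

theorem linFlow_comm (t : ℝ) (x : Euc n) : linFlow A t (A x) = A (linFlow A t x) :=
  expFlow_comm A t x

theorem hasDerivAt_linFlow_neg (t : ℝ) :
    HasDerivAt (fun s => linFlow A (-s)) (-(A * linFlow A (-t))) t := by
  have := (hasDerivAt_linFlow A (-t)).scomp t (hasDerivAt_neg t)
  simpa using! this

theorem linFlow_smul (c t : ℝ) : linFlow (c • A) t = linFlow A (t * c) :=
  expFlow_smul A c t

end LinFlow

/-! ### Integrals of exponentially bounded functions on the half-line -/

section HalfLine

variable {E : Type*} [NormedAddCommGroup E] [NormedSpace ℝ E] {φ ψ : ℝ → E} {β C : ℝ}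

/-- `φ` is bounded by `C e^{-βs}` on `(-∞,0]`. -/
def ExpBounded (β C : ℝ) (φ : ℝ → E) : Prop := ∀ s ≤ 0, ‖φ s‖ ≤ C * Real.exp (-β * s)

omit [NormedSpace ℝ E] in
theorem ExpBounded.nonneg (h : ExpBounded β C φ) : 0 ≤ C := by
  simpa using (norm_nonneg _).trans (h 0 le_rfl)

omit [NormedSpace ℝ E] in
theorem ExpBounded.mono {β' C' : ℝ} (h : ExpBounded β C φ) (hβ : β ≤ β') (hC : C ≤ C') :
    ExpBounded β' C' φ := fun s hs => by
  have h0 := h.nonneg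
  refine (h s hs).trans (mul_le_mul hC (Real.exp_le_exp.2 ?_) (Real.exp_pos _).le (h0.trans hC))
  nlinarith

omit [NormedSpace ℝ E] in
theorem ExpBounded.intervalIntegrable (h : ExpBounded β C φ)
    (hm : AEStronglyMeasurable φ (volume.restrict (Iic 0))) {a b : ℝ} (ha : a ≤ 0) (hb : b ≤ 0) :
    IntervalIntegrable φ volume a b := by
  have hsub : uIoc a b ⊆ Iic 0 := fun x hx => hx.2.trans (max_le ha hb)
  have hc : IntervalIntegrable (fun s => C * Real.exp (-β * s)) volume a b :=
    Continuous.intervalIntegrable (by fun_prop) _ _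
  refine hc.mono_fun' (hm.mono_measure (Measure.restrict_mono hsub le_rfl)) ?_
  filter_upwards [ae_restrict_mem measurableSet_uIoc] with s hs using h s (hsub hs)

theorem continuousOn_primitive_Iic
    (h : ∀ a ≤ (0 : ℝ), IntervalIntegrable φ volume a 0) :
    ContinuousOn (fun t => ∫ s in (0 : ℝ)..t, φ s) (Iic 0) := by
  intro t ht
  have h1 : ContinuousOn (fun t => ∫ s in (0 : ℝ)..t, φ s) (uIcc (t - 1) 0) :=
    intervalIntegral.continuousOn_primitive_interval' (h (t - 1) (by simp at ht; linarith))
      right_mem_uIcc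
  rw [uIcc_of_le (by simp at ht; linarith)] at h1
  refine (h1 t ⟨by linarith, ht⟩).mono_of_mem_nhdsWithin ?_
  filter_upwards [self_mem_nhdsWithin, mem_nhdsWithin_of_mem_nhds (Ioi_mem_nhds (sub_one_lt t))]
    with s hs hs' using ⟨le_of_lt hs', hs⟩

/-- Integrands built from the noise are only right-continuous. Differential equations are therefore
used with right derivatives, here and below. -/
theorem hasDerivWithinAt_primitive [CompleteSpace E]
    (h : ∀ a ≤ (0 : ℝ), IntervalIntegrable φ volume a 0)
    {t : ℝ} (ht : t < 0) (hr : ContinuousWithinAt φ (Ici t) t) :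
    HasDerivWithinAt (fun u => ∫ s in (0 : ℝ)..u, φ s) (φ t) (Ici t) t := by
  refine intervalIntegral.integral_hasDerivWithinAt_right (t := Ioi t) (h t ht.le).symm ?_
    (hr.mono Ioi_subset_Ici_self)
  refine ⟨Ioc t 0, Ioc_mem_nhdsGT ht, ?_⟩
  exact ((intervalIntegrable_iff_integrableOn_Ioc_of_le ht.le).1 (h t ht.le)).aestronglyMeasurable

theorem ExpBounded.norm_integral_le (h : ExpBounded β C φ) (hβ : 0 < β) {t : ℝ} (ht : t ≤ 0) :
    ‖∫ s in (0 : ℝ)..t, φ s‖ ≤ C / β * Real.exp (-β * t) := by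
  have hC := h.nonneg
  rw [intervalIntegral.integral_symm, norm_neg]
  have h1 : ‖∫ s in t..(0 : ℝ), φ s‖ ≤ ∫ s in t..(0 : ℝ), C * Real.exp (-β * s) := by
    refine intervalIntegral.norm_integral_le_of_norm_le ht ?_
      (Continuous.intervalIntegrable (by fun_prop) _ _)
    exact Eventually.of_forall fun s hs => h s hs.2
  refine h1.trans ?_
  rw [intervalIntegral.integral_const_mul, intervalIntegral.integral_comp_mul_left (fun s => Real.exp s) (by linarith),
    integral_exp, smul_eq_mul, mul_zero, Real.exp_zero, div_mul_eq_mul_div, le_div_iff₀ hβ]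
  -- The weight integrates to `(e^{-βt} - 1)/β`. The factor `1/β` becomes the slow part of the
  -- contraction ratio.
  have : C * ((-β)⁻¹ * (1 - Real.exp (-β * t))) * β = C * (Real.exp (-β * t) - 1) := by
    field_simp; ring
  rw [this]
  nlinarith

end HalfLine

/-! ### Bounded solutions of linear equations -/

section FastInt

variable {n : ℕ} {F : Euc n →L[ℝ] Euc n} {γf β C : ℝ} {φ ψ : ℝ → Euc n}

/-- The convolution `∫_{-∞}^t e^{(t-s)F} φ(s) ds`. -/
def fastInt (F : Euc n →L[ℝ] Euc n) (φ : ℝ → Euc n) (t : ℝ) : Euc n :=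
  ∫ s in Iic t, linFlow F (t - s) (φ s)

/-- The flow `e^{tF}` decays at the exponential rate `γf` for `t ≥ 0`. -/
def DecaysAtRate (F : Euc n →L[ℝ] Euc n) (γf : ℝ) : Prop :=
  ∀ t ≥ 0, ∀ y, ‖linFlow F t y‖ ≤ Real.exp (γf * t) * ‖y‖

theorem ExpBounded.norm_linFlow_le (h : ExpBounded β C φ) (hF : DecaysAtRate F γf) {s t : ℝ}
    (hst : s ≤ t) (hs : s ≤ 0) :
    ‖linFlow F (t - s) (φ s)‖ ≤ C * Real.exp (γf * t) * Real.exp (-(β + γf) * s) := by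
  refine (hF _ (sub_nonneg.2 hst) _).trans ?_
  refine (mul_le_mul_of_nonneg_left (h s hs) (Real.exp_pos _).le).trans_eq ?_
  rw [mul_left_comm, mul_assoc, ← Real.exp_add, ← Real.exp_add]
  ring_nf

theorem aestronglyMeasurable_linFlow (hm : AEStronglyMeasurable φ (volume.restrict (Iic 0)))
    (t : ℝ) :
    AEStronglyMeasurable (fun s => linFlow F (t - s) (φ s)) (volume.restrict (Iic 0)) := by
  have h1 : AEStronglyMeasurable (fun s => linFlow F (t - s)) (volume.restrict (Iic (0 : ℝ))) :=
    ((continuous_linFlow F).comp (by fun_prop)).aestronglyMeasurable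
  exact (isBoundedBilinearMap_apply (𝕜 := ℝ)).continuous.comp_aestronglyMeasurable (h1.prodMk hm)

theorem ExpBounded.integrableOn_fast (h : ExpBounded β C φ) (hF : DecaysAtRate F γf)
    (hβ : β + γf < 0) (hm : AEStronglyMeasurable φ (volume.restrict (Iic 0)))
    {t : ℝ} (ht : t ≤ 0) : IntegrableOn (fun s => linFlow F (t - s) (φ s)) (Iic t) := by
  refine Integrable.mono' ((integrableOn_exp_mul_Iic (a := -(β + γf)) (by linarith) t).const_mul
    (C * Real.exp (γf * t))) ?_ ?_
  · exact (aestronglyMeasurable_linFlow hm t).mono_measure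
      (Measure.restrict_mono (Iic_subset_Iic.2 ht) le_rfl)
  · filter_upwards [ae_restrict_mem measurableSet_Iic] with s hs
    exact h.norm_linFlow_le hF hs (le_trans hs ht)

/-- The convolution preserves the weight at the cost `1/(-(β + γf))`, the fast part of the
contraction ratio. -/
theorem ExpBounded.norm_fastInt_le (h : ExpBounded β C φ) (hF : DecaysAtRate F γf)
    (hβ : β + γf < 0) {t : ℝ} (ht : t ≤ 0) :
    ‖fastInt F φ t‖ ≤ C / (-(β + γf)) * Real.exp (-β * t) := by
  have hβ' : 0 < -(β + γf) := by linarith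
  have h1 : ‖fastInt F φ t‖ ≤
      ∫ s in Iic t, C * Real.exp (γf * t) * Real.exp (-(β + γf) * s) := by
    refine norm_integral_le_of_norm_le ((integrableOn_exp_mul_Iic hβ' t).const_mul _) ?_
    filter_upwards [ae_restrict_mem measurableSet_Iic] with s hs
    exact h.norm_linFlow_le hF hs (le_trans hs ht)
  refine h1.trans_eq ?_
  rw [integral_const_mul, integral_exp_mul_Iic hβ', mul_div_assoc', mul_assoc, ← Real.exp_add,
    mul_div_right_comm]
  ring_nf

theorem ExpBounded.fastInt_bounded (h : ExpBounded β C φ) (hF : DecaysAtRate F γf)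
    (hβ : β + γf < 0) : ExpBounded β (C / (-(β + γf))) (fastInt F φ) :=
  fun _ ht => h.norm_fastInt_le hF hβ ht

theorem fastInt_sub {C' : ℝ} (h : ExpBounded β C φ) (h' : ExpBounded β C' ψ)
    (hF : DecaysAtRate F γf) (hβ : β + γf < 0)
    (hm : AEStronglyMeasurable φ (volume.restrict (Iic 0)))
    (hm' : AEStronglyMeasurable ψ (volume.restrict (Iic 0))) {t : ℝ} (ht : t ≤ 0) :
    fastInt F φ t - fastInt F ψ t = fastInt F (fun s => φ s - ψ s) t := by
  simp only [fastInt, map_sub]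
  exact (integral_sub (h.integrableOn_fast hF hβ hm ht) (h'.integrableOn_fast hF hβ hm' ht)).symm

theorem fastInt_congr (h : EqOn φ ψ (Iic 0)) {t : ℝ} (ht : t ≤ 0) :
    fastInt F φ t = fastInt F ψ t := by
  refine setIntegral_congr_fun measurableSet_Iic fun s hs => ?_
  rw [h (le_trans hs ht)]

/-- Pulling `e^{tF}` out of the convolution leaves an ordinary primitive, from which continuity and
right differentiability are read off. -/
theorem ExpBounded.fastInt_eq (h : ExpBounded β C φ) (hF : DecaysAtRate F γf)
    (hβ : β + γf < 0) (hm : AEStronglyMeasurable φ (volume.restrict (Iic 0)))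
    {t : ℝ} (ht : t ≤ 0) :
    fastInt F φ t = linFlow F t (fastInt F φ 0 + ∫ s in (0 : ℝ)..t, linFlow F (-s) (φ s)) := by
  have h0 := h.integrableOn_fast hF hβ hm le_rfl
  simp only [zero_sub] at h0
  have h1 := h0.mono_set (Iic_subset_Iic.2 ht)
  have e : fastInt F φ 0 + ∫ s in (0 : ℝ)..t, linFlow F (-s) (φ s)
      = ∫ s in Iic t, linFlow F (-s) (φ s) := by
    rw [← intervalIntegral.integral_Iic_sub_Iic h0 h1, fastInt]
    simp
  rw [e, ← ContinuousLinearMap.integral_comp_comm _ h1, fastInt]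
  simp_rw [sub_eq_add_neg, linFlow_add_apply]

theorem ExpBounded.intervalIntegrable_linFlow (h : ExpBounded β C φ)
    (hm : AEStronglyMeasurable φ (volume.restrict (Iic 0))) (a : ℝ) (ha : a ≤ 0) :
    IntervalIntegrable (fun s => linFlow F (-s) (φ s)) volume a 0 := by
  have h1 := h.intervalIntegrable hm ha le_rfl
  have hc : ContinuousOn (fun s => linFlow F (-s)) (uIcc a 0) :=
    ((continuous_linFlow F).comp continuous_neg).continuousOn
  rw [intervalIntegrable_iff_integrableOn_Ioc_of_le ha] at h1 ⊢
  obtain ⟨M, hM⟩ := isCompact_uIcc.exists_bound_of_continuousOn hc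
  refine Integrable.mono' (h1.norm.const_mul M) ?_ ?_
  · have := aestronglyMeasurable_linFlow (F := F) hm 0
    simp only [zero_sub] at this
    exact this.mono_measure (Measure.restrict_mono Ioc_subset_Iic_self le_rfl)
  · filter_upwards [ae_restrict_mem measurableSet_Ioc] with s hs
    rw [uIcc_of_le ha] at hM
    exact (ContinuousLinearMap.le_opNorm _ _).trans
      (mul_le_mul_of_nonneg_right (hM s (Ioc_subset_Icc_self hs)) (norm_nonneg _))

theorem ExpBounded.continuousOn_fastInt (h : ExpBounded β C φ) (hF : DecaysAtRate F γf)
    (hβ : β + γf < 0) (hm : AEStronglyMeasurable φ (volume.restrict (Iic 0))) :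
    ContinuousOn (fastInt F φ) (Iic 0) := by
  have h1 := continuousOn_primitive_Iic (h.intervalIntegrable_linFlow (F := F) hm)
  refine ContinuousOn.congr ?_ fun t ht => h.fastInt_eq hF hβ hm ht
  exact (continuous_linFlow F).continuousOn.clm_apply (continuousOn_const.add h1)

theorem continuousWithinAt_linFlow_apply {t : ℝ} (hr : ContinuousWithinAt φ (Ici t) t) :
    ContinuousWithinAt (fun s => linFlow F (-s) (φ s)) (Ici t) t :=
  ((continuous_linFlow F).comp continuous_neg).continuousWithinAt.clm_apply hr

theorem ExpBounded.hasDerivWithinAt_fastInt (h : ExpBounded β C φ) (hF : DecaysAtRate F γf)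
    (hβ : β + γf < 0) (hm : AEStronglyMeasurable φ (volume.restrict (Iic 0)))
    {t : ℝ} (ht : t < 0) (hr : ContinuousWithinAt φ (Ici t) t) :
    HasDerivWithinAt (fastInt F φ) (F (fastInt F φ t) + φ t) (Ici t) t := by
  have h1 := (hasDerivWithinAt_primitive (h.intervalIntegrable_linFlow (F := F) hm) ht
    (continuousWithinAt_linFlow_apply hr)).const_add (fastInt F φ 0)
  have h2 := ((hasDerivAt_linFlow F t).hasDerivWithinAt (s := Ici t)).clm_apply h1
  have e : F (fastInt F φ t) + φ t = (F * linFlow F t)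
      (fastInt F φ 0 + ∫ s in (0 : ℝ)..t, linFlow F (-s) (φ s)) +
      linFlow F t (linFlow F (-t) (φ t)) := by
    rw [h.fastInt_eq hF hβ hm ht.le, linFlow_apply_linFlow_neg]; rfl
  rw [e]
  have h3 : ∀ᶠ s in 𝓝[Ici t] t, s ≤ 0 :=
    mem_nhdsWithin_of_mem_nhds (Iic_mem_nhds ht)
  exact h2.congr_of_eventuallyEq (h3.mono fun s hs => h.fastInt_eq hF hβ hm hs)
    (h.fastInt_eq hF hβ hm ht.le)

theorem ExpBounded.fastInt_eq_integral (h : ExpBounded β C φ) (hF : DecaysAtRate F γf)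
    (hβ : β + γf < 0) (hm : AEStronglyMeasurable φ (volume.restrict (Iic 0)))
    (hr : ∀ t < 0, ContinuousWithinAt φ (Ici t) t) {t : ℝ} (ht : t ≤ 0) :
    fastInt F φ t = fastInt F φ 0 +
      ∫ s in (0 : ℝ)..t, (F (fastInt F φ s) + φ s) := by
  have hc := h.continuousOn_fastInt hF hβ hm
  have hcs : ContinuousOn (fastInt F φ) (uIcc 0 t) :=
    hc.mono fun s hs => by rw [uIcc_of_ge ht] at hs; exact hs.2
  rw [intervalIntegral.integral_eq_sub_of_hasDeriv_right (f := fastInt F φ) hcs]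
  · abel
  · intro s hs
    rw [min_eq_right ht, max_eq_left ht] at hs
    exact (h.hasDerivWithinAt_fastInt hF hβ hm hs.2 (hr s hs.2)).mono Ioi_subset_Ici_self
  · exact (F.continuous.comp_continuousOn hcs).intervalIntegrable.add
      (h.intervalIntegrable hm le_rfl ht)

/-- The function `e^{-sF} d(s)` has zero right derivative, hence is constant. -/
theorem eq_linFlow_of_eq_integral {d : ℝ → Euc n} (hd : ContinuousOn d (Iic 0))
    (h : ∀ t ≤ 0, d t = d 0 + ∫ s in (0 : ℝ)..t, F (d s)) {t : ℝ} (ht : t ≤ 0) :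
    d t = linFlow F t (d 0) := by
  have hc : ContinuousOn (fun s => F (d s)) (Iic 0) := F.continuous.comp_continuousOn hd
  have hi : ∀ a ≤ (0 : ℝ), IntervalIntegrable (fun s => F (d s)) volume a 0 := fun a ha =>
    (hc.mono fun s hs => by rw [uIcc_of_le ha] at hs; exact hs.2).intervalIntegrable
  have hder : ∀ s < 0, HasDerivWithinAt d (F (d s)) (Ici s) s := fun s hs => by
    have h1 := (hasDerivWithinAt_primitive hi hs
      ((hc.continuousAt (Iic_mem_nhds hs)).continuousWithinAt)).const_add (d 0)
    have h3 : ∀ᶠ r in 𝓝[Ici s] s, r ≤ 0 := mem_nhdsWithin_of_mem_nhds (Iic_mem_nhds hs)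
    exact h1.congr_of_eventuallyEq (h3.mono fun r hr => h r hr) (h s hs.le)
  have hcon : ∀ s ∈ Icc t 0, linFlow F (-s) (d s) = linFlow F (-t) (d t) := by
    refine constant_of_has_deriv_right_zero ?_ fun s hs => ?_
    · exact (((continuous_linFlow F).comp continuous_neg).continuousOn).clm_apply
        (hd.mono fun s hs => hs.2)
    · have := ((hasDerivAt_linFlow_neg F s).hasDerivWithinAt (s := Ici s)).clm_apply (hder s hs.2)
      convert! this using 1
      simp [linFlow_comm]
  have h0 := hcon 0 ⟨ht, le_rfl⟩
  simp only [neg_zero, linFlow_zero, one_apply_eq_self] at h0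
  rw [h0, linFlow_apply_linFlow_neg]

/-- The difference `d` from the convolution solves the homogeneous equation, so `d 0 = e^{-tF} d(t)`
is bounded by a multiple of `e^{-(β + γf) t}`, which tends to zero as `t → -∞`. Growth alone thus
determines the solution, and `y₀` is not free. -/
theorem ExpBounded.eq_fastInt {y : ℝ → Euc n} {y₀ : Euc n} {C' : ℝ}
    (h : ExpBounded β C φ) (hF : DecaysAtRate F γf)
    (hβ : β + γf < 0) (hm : AEStronglyMeasurable φ (volume.restrict (Iic 0)))
    (hr : ∀ t < 0, ContinuousWithinAt φ (Ici t) t)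
    (hy : ContinuousOn y (Iic 0)) (hyb : ExpBounded β C' y)
    (hyi : ∀ t ≤ 0, y t = y₀ + ∫ s in (0 : ℝ)..t, (F (y s) + φ s)) {t : ℝ} (ht : t ≤ 0) :
    y t = fastInt F φ t := by
  set G := fastInt F φ with hG
  have hGc : ContinuousOn G (Iic 0) := h.continuousOn_fastInt hF hβ hm
  have hGb := h.fastInt_bounded hF hβ
  rw [← hG] at hGb
  set d : ℝ → Euc n := fun t => y t - G t with hd_def
  have hdc : ContinuousOn d (Iic 0) := hy.sub hGc
  have hint : ∀ {w : ℝ → Euc n}, ContinuousOn w (Iic 0) → ∀ t ≤ 0,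
      IntervalIntegrable (fun s => F (w s) + φ s) volume 0 t := fun {w} hw t ht =>
    ((F.continuous.comp_continuousOn hw).mono fun s hs => by
      rw [uIcc_of_ge ht] at hs; exact hs.2).intervalIntegrable.add
      (h.intervalIntegrable hm le_rfl ht)
  have hde : ∀ t ≤ 0, d t = d 0 + ∫ s in (0 : ℝ)..t, F (d s) := fun t ht => by
    have e0 : y 0 = y₀ := by simpa using hyi 0 le_rfl
    have e1 := h.fastInt_eq_integral hF hβ hm hr ht
    rw [← hG] at e1
    have e2 : ∫ s in (0 : ℝ)..t, F (d s) =
        (∫ s in (0 : ℝ)..t, (F (y s) + φ s)) - ∫ s in (0 : ℝ)..t, (F (G s) + φ s) := by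
      rw [← intervalIntegral.integral_sub (hint hy t ht) (hint hGc t ht)]
      simp [hd_def]
    simp only [hd_def] at e2 ⊢
    rw [e2, e0]
    nth_rewrite 1 [hyi t ht, e1]
    abel
  have hd0 : d 0 = 0 := by
    have hb : ∀ t ≤ 0, ‖d 0‖ ≤ (C' + C / (-(β + γf))) * Real.exp (-(β + γf) * t) := fun t ht => by
      have e : d 0 = linFlow F (-t) (d t) := by
        rw [eq_linFlow_of_eq_integral hdc hde ht, linFlow_neg_apply_linFlow]
      rw [e]
      refine (hF _ (by linarith) _).trans ?_
      have h4 : ‖d t‖ ≤ (C' + C / (-(β + γf))) * Real.exp (-β * t) := by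
        rw [add_mul]
        exact (norm_sub_le _ _).trans (add_le_add (hyb t ht) (hGb t ht))
      refine (mul_le_mul_of_nonneg_left h4 (Real.exp_pos _).le).trans_eq ?_
      rw [mul_left_comm, ← Real.exp_add]
      ring_nf
    have hlim : Tendsto (fun t => (C' + C / (-(β + γf))) * Real.exp (-(β + γf) * t)) atBot
        (𝓝 0) := by
      have := (Real.tendsto_exp_atBot.comp
        (tendsto_id.const_mul_atBot (r := -(β + γf)) (by linarith))).const_mul
          (C' + C / (-(β + γf)))
      simpa using! this
    have := ge_of_tendsto hlim ((eventually_le_atBot 0).mono hb)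
    exact norm_le_zero_iff.1 this
  have := eq_linFlow_of_eq_integral hdc hde ht
  rw [hd0, map_zero] at this
  exact sub_eq_zero.1 this

end FastInt

/-! ### The Lyapunov–Perron operator -/

section SumNorm

variable {n₁ n₂ : ℕ}

/-- The norm `|x| + |y|`. -/
def sumNorm (u : Euc n₁ × Euc n₂) : ℝ := ‖u.1‖ + ‖u.2‖

theorem sumNorm_nonneg (u : Euc n₁ × Euc n₂) : 0 ≤ sumNorm u := by
  unfold sumNorm; positivity

@[simp] theorem sumNorm_zero : sumNorm (0 : Euc n₁ × Euc n₂) = 0 := by simp [sumNorm]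

theorem sumNorm_add_le (u v : Euc n₁ × Euc n₂) : sumNorm (u + v) ≤ sumNorm u + sumNorm v := by
  have h1 := norm_add_le u.1 v.1
  have h2 := norm_add_le u.2 v.2
  simp only [sumNorm, Prod.fst_add, Prod.snd_add]
  linarith

theorem sumNorm_sub_comm (u v : Euc n₁ × Euc n₂) : sumNorm (u - v) = sumNorm (v - u) := by
  simp only [sumNorm, Prod.fst_sub, Prod.snd_sub]
  rw [norm_sub_rev, norm_sub_rev u.2]

theorem sumNorm_sub_le (u v w : Euc n₁ × Euc n₂) :
    sumNorm (u - w) ≤ sumNorm (u - v) + sumNorm (v - w) := by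
  simpa using sumNorm_add_le (u - v) (v - w)

theorem norm_le_sumNorm (u : Euc n₁ × Euc n₂) : ‖u‖ ≤ sumNorm u := by
  rw [Prod.norm_def, sumNorm]
  exact max_le (by linarith [norm_nonneg u.2]) (by linarith [norm_nonneg u.1])

theorem sumNorm_le_two_mul (u : Euc n₁ × Euc n₂) : sumNorm u ≤ 2 * ‖u‖ := by
  have := norm_fst_le u
  have := norm_snd_le u
  rw [sumNorm]; linarith

theorem eq_of_sumNorm_sub_le_zero {u v : Euc n₁ × Euc n₂} (h : sumNorm (u - v) ≤ 0) : u = v :=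
  sub_eq_zero.1 (norm_le_zero_iff.1 ((norm_le_sumNorm _).trans h))

/-- Measurable functions with `sup_{t ≤ 0} e^{βt} (|x(t)| + |y(t)|) < ∞`. -/
def MemWeighted (β : ℝ) (u : ℝ → Euc n₁ × Euc n₂) : Prop :=
  AEStronglyMeasurable u (volume.restrict (Iic 0)) ∧
    ∃ C : ℝ, ∀ t ≤ 0, sumNorm (u t) ≤ C * Real.exp (-β * t)

theorem MemWeighted.exists_sub {β : ℝ} {u v : ℝ → Euc n₁ × Euc n₂} (hu : MemWeighted β u)
    (hv : MemWeighted β v) :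
    ∃ B, 0 ≤ B ∧ ∀ t ≤ 0, sumNorm (u t - v t) ≤ B * Real.exp (-β * t) := by
  obtain ⟨-, B₁, hB₁⟩ := hu
  obtain ⟨-, B₂, hB₂⟩ := hv
  have h1 : ∀ t ≤ 0, sumNorm (u t - v t) ≤ (B₁ + B₂) * Real.exp (-β * t) := fun t ht => by
    have := sumNorm_sub_le (u t) 0 (v t)
    rw [sumNorm_sub_comm 0, sub_zero, sub_zero] at this
    linarith [hB₁ t ht, hB₂ t ht]
  exact ⟨_, by simpa using (sumNorm_nonneg _).trans (h1 0 le_rfl), h1⟩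

end SumNorm

variable {n₁ n₂ : ℕ} {F : Euc n₂ →L[ℝ] Euc n₂} {β γf κ₁ κ₂ : ℝ}
  {f₁ : ℝ → Euc n₁ × Euc n₂ → Euc n₁} {f₂ : ℝ → Euc n₁ × Euc n₂ → Euc n₂}

/-- The operator `u ↦ (x₀ + ∫_0^t f₁(s,u(s)) ds, ∫_{-∞}^t e^{(t-s)F} f₂(s,u(s)) ds)`. -/
def lpOperator (F : Euc n₂ →L[ℝ] Euc n₂) (f₁ : ℝ → Euc n₁ × Euc n₂ → Euc n₁)
    (f₂ : ℝ → Euc n₁ × Euc n₂ → Euc n₂) (x₀ : Euc n₁) (u : ℝ → Euc n₁ × Euc n₂) (t : ℝ) :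
    Euc n₁ × Euc n₂ :=
  (x₀ + ∫ s in (0 : ℝ)..t, f₁ s (u s), fastInt F (fun s => f₂ s (u s)) t)

/-- The hypotheses making `lpOperator` a contraction in the space with weight `e^{βt}`. -/
structure IsLPSystem (F : Euc n₂ →L[ℝ] Euc n₂) (β γf κ₁ κ₂ : ℝ)
    (f₁ : ℝ → Euc n₁ × Euc n₂ → Euc n₁) (f₂ : ℝ → Euc n₁ × Euc n₂ → Euc n₂) : Prop where
  decay : DecaysAtRate F γf
  pos : 0 < β
  gap : β + γf < 0
  meas₁ : ∀ u, AEStronglyMeasurable u (volume.restrict (Iic 0)) →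
    AEStronglyMeasurable (fun s => f₁ s (u s)) (volume.restrict (Iic 0))
  meas₂ : ∀ u, AEStronglyMeasurable u (volume.restrict (Iic 0)) →
    AEStronglyMeasurable (fun s => f₂ s (u s)) (volume.restrict (Iic 0))
  nonneg₁ : 0 ≤ κ₁
  nonneg₂ : 0 ≤ κ₂
  lip₁ : ∀ s ≤ 0, ∀ u v, ‖f₁ s u - f₁ s v‖ ≤ κ₁ * sumNorm (u - v)
  lip₂ : ∀ s ≤ 0, ∀ u v, ‖f₂ s u - f₂ s v‖ ≤ κ₂ * sumNorm (u - v)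
  zero₁ : ∃ C, ExpBounded β C (fun s => f₁ s 0)
  zero₂ : ∃ C, ExpBounded β C (fun s => f₂ s 0)
  contr : κ₁ / β + κ₂ / (-(β + γf)) < 1

namespace IsLPSystem

variable {x₀ : Euc n₁} {u v : ℝ → Euc n₁ × Euc n₂}

theorem ratio_nonneg (h : IsLPSystem F β γf κ₁ κ₂ f₁ f₂) :
    0 ≤ κ₁ / β + κ₂ / (-(β + γf)) := by
  have := h.pos
  have := h.gap
  have h1 : 0 < -(β + γf) := by linarith
  have := h.nonneg₁
  have := h.nonneg₂
  positivity

theorem bounded₁ (h : IsLPSystem F β γf κ₁ κ₂ f₁ f₂) (hu : MemWeighted β u) :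
    ∃ C, ExpBounded β C (fun s => f₁ s (u s)) := by
  obtain ⟨-, B, hB⟩ := hu
  obtain ⟨C, hC⟩ := h.zero₁
  refine ⟨κ₁ * B + C, fun s hs => ?_⟩
  have h1 := h.lip₁ s hs (u s) 0
  rw [sub_zero] at h1
  have h2 := norm_add_le (f₁ s (u s) - f₁ s 0) (f₁ s 0)
  rw [sub_add_cancel] at h2
  have h3 := mul_le_mul_of_nonneg_left (hB s hs) h.nonneg₁
  have h4 := hC s hs
  simp only at h4
  linarith

theorem bounded₂ (h : IsLPSystem F β γf κ₁ κ₂ f₁ f₂) (hu : MemWeighted β u) :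
    ∃ C, ExpBounded β C (fun s => f₂ s (u s)) := by
  obtain ⟨-, B, hB⟩ := hu
  obtain ⟨C, hC⟩ := h.zero₂
  refine ⟨κ₂ * B + C, fun s hs => ?_⟩
  have h1 := h.lip₂ s hs (u s) 0
  rw [sub_zero] at h1
  have h2 := norm_add_le (f₂ s (u s) - f₂ s 0) (f₂ s 0)
  rw [sub_add_cancel] at h2
  have h3 := mul_le_mul_of_nonneg_left (hB s hs) h.nonneg₂
  have h4 := hC s hs
  simp only at h4
  linarith

theorem continuousOn (h : IsLPSystem F β γf κ₁ κ₂ f₁ f₂) (hu : MemWeighted β u) :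
    ContinuousOn (lpOperator F f₁ f₂ x₀ u) (Iic 0) := by
  obtain ⟨C₁, h₁⟩ := h.bounded₁ hu
  obtain ⟨C₂, h₂⟩ := h.bounded₂ hu
  refine ContinuousOn.prodMk (continuousOn_const.add ?_) ?_
  · exact continuousOn_primitive_Iic fun a ha =>
      h₁.intervalIntegrable (h.meas₁ u hu.1) ha le_rfl
  · exact h₂.continuousOn_fastInt h.decay h.gap (h.meas₂ u hu.1)

theorem memWeighted (h : IsLPSystem F β γf κ₁ κ₂ f₁ f₂) (hu : MemWeighted β u) :
    MemWeighted β (lpOperator F f₁ f₂ x₀ u) := by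
  refine ⟨(h.continuousOn hu).aestronglyMeasurable measurableSet_Iic, ?_⟩
  obtain ⟨C₁, h₁⟩ := h.bounded₁ hu
  obtain ⟨C₂, h₂⟩ := h.bounded₂ hu
  refine ⟨‖x₀‖ + C₁ / β + C₂ / (-(β + γf)), fun t ht => ?_⟩
  have e1 := h₁.norm_integral_le h.pos ht
  have e2 := h₂.norm_fastInt_le h.decay h.gap ht
  have e3 := norm_add_le x₀ (∫ s in (0 : ℝ)..t, f₁ s (u s))
  have e4 : 1 ≤ Real.exp (-β * t) := Real.one_le_exp (by nlinarith [h.pos])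
  have e5 := mul_le_mul_of_nonneg_left e4 (norm_nonneg x₀)
  simp only [sumNorm, lpOperator]
  linarith

/-- The two kernel costs add because distances are measured by `|x| + |y|`. -/
theorem contraction (h : IsLPSystem F β γf κ₁ κ₂ f₁ f₂) (hu : MemWeighted β u)
    (hv : MemWeighted β v) {M : ℝ}
    (hM : ∀ t ≤ 0, sumNorm (u t - v t) ≤ M * Real.exp (-β * t)) {t : ℝ} (ht : t ≤ 0) :
    sumNorm (lpOperator F f₁ f₂ x₀ u t - lpOperator F f₁ f₂ x₀ v t) ≤
      (κ₁ / β + κ₂ / (-(β + γf))) * M * Real.exp (-β * t) := by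
  obtain ⟨C₁, h₁⟩ := h.bounded₁ hu
  obtain ⟨C₂, h₂⟩ := h.bounded₂ hu
  obtain ⟨C₁', h₁'⟩ := h.bounded₁ hv
  obtain ⟨C₂', h₂'⟩ := h.bounded₂ hv
  have b1 : ExpBounded β (κ₁ * M) (fun s => f₁ s (u s) - f₁ s (v s)) := fun s hs => by
    rw [mul_assoc]
    exact (h.lip₁ s hs _ _).trans (mul_le_mul_of_nonneg_left (hM s hs) h.nonneg₁)
  have b2 : ExpBounded β (κ₂ * M) (fun s => f₂ s (u s) - f₂ s (v s)) := fun s hs => by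
    rw [mul_assoc]
    exact (h.lip₂ s hs _ _).trans (mul_le_mul_of_nonneg_left (hM s hs) h.nonneg₂)
  have e1 := b1.norm_integral_le h.pos ht
  have e2 := b2.norm_fastInt_le h.decay h.gap ht
  rw [intervalIntegral.integral_sub (h₁.intervalIntegrable (h.meas₁ u hu.1) le_rfl ht)
    (h₁'.intervalIntegrable (h.meas₁ v hv.1) le_rfl ht)] at e1
  rw [← fastInt_sub h₂ h₂' h.decay h.gap (h.meas₂ u hu.1) (h.meas₂ v hv.1) ht] at e2
  simp only [sumNorm, lpOperator, Prod.mk_sub_mk, add_sub_add_left_eq_sub]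
  refine (add_le_add e1 e2).trans_eq ?_
  ring

/-- An approximate fixed point of the operator is close to the fixed point. -/
theorem stability (h : IsLPSystem F β γf κ₁ κ₂ f₁ f₂) (hu : MemWeighted β u)
    (hv : MemWeighted β v) (hfix : EqOn u (lpOperator F f₁ f₂ x₀ u) (Iic 0)) {M : ℝ}
    (hM : ∀ t ≤ 0, sumNorm (lpOperator F f₁ f₂ x₀ v t - v t) ≤ M * Real.exp (-β * t))
    {t : ℝ} (ht : t ≤ 0) :
    sumNorm (u t - v t) ≤ M / (1 - (κ₁ / β + κ₂ / (-(β + γf)))) * Real.exp (-β * t) := by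
  set q := κ₁ / β + κ₂ / (-(β + γf)) with hq
  have hq0 : 0 ≤ q := h.ratio_nonneg
  have hq1 : q < 1 := h.contr
  obtain ⟨B, -, hB⟩ := hu.exists_sub hv
  -- A bound `a` improves to `q a + M`. Starting from the crude bound `B`, the `k`-th improvement
  -- has this closed form, with limit `M / (1 - q)`.
  have hiter : ∀ k : ℕ, ∀ t ≤ 0, sumNorm (u t - v t) ≤
      (q ^ k * (B - M / (1 - q)) + M / (1 - q)) * Real.exp (-β * t) := by
    intro k
    induction k with
    | zero => intro t ht; simpa using hB t ht
    | succ k ih =>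
      intro t ht
      have h1 := h.contraction (x₀ := x₀) hu hv ih ht
      rw [← hfix ht, ← hq] at h1
      have h2 := sumNorm_sub_le (u t) (lpOperator F f₁ f₂ x₀ v t) (v t)
      have h3 := hM t ht
      refine h2.trans ((add_le_add h1 h3).trans_eq ?_)
      rw [← add_mul]
      congr 1
      have : 1 - q ≠ 0 := by linarith
      field_simp
      ring
  have hlim : Tendsto (fun k : ℕ => (q ^ k * (B - M / (1 - q)) + M / (1 - q)) *
      Real.exp (-β * t)) atTop (𝓝 ((0 * (B - M / (1 - q)) + M / (1 - q)) * Real.exp (-β * t))) :=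
    (((tendsto_pow_atTop_nhds_zero_of_lt_one hq0 hq1).mul_const _).add_const _).mul_const _
  rw [zero_mul, zero_add] at hlim
  exact ge_of_tendsto' hlim fun k => hiter k t ht

theorem unique (h : IsLPSystem F β γf κ₁ κ₂ f₁ f₂) (hu : MemWeighted β u)
    (hv : MemWeighted β v) (hfu : EqOn u (lpOperator F f₁ f₂ x₀ u) (Iic 0))
    (hfv : EqOn v (lpOperator F f₁ f₂ x₀ v) (Iic 0)) : EqOn u v (Iic 0) := by
  intro t ht
  have := h.stability hu hv hfu (M := 0) (fun t ht => by rw [← hfv ht]; simp) ht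
  rw [zero_div, zero_mul] at this
  exact eq_of_sumNorm_sub_le_zero this

end IsLPSystem

/-! ### Fixed points of the Lyapunov–Perron operator by Picard iteration. -/

/-- Picard iterates of `lpOperator`. -/
def lpIterate (F : Euc n₂ →L[ℝ] Euc n₂) (f₁ : ℝ → Euc n₁ × Euc n₂ → Euc n₁)
    (f₂ : ℝ → Euc n₁ × Euc n₂ → Euc n₂) (x₀ : Euc n₁) : ℕ → ℝ → Euc n₁ × Euc n₂
  | 0 => fun _ => 0
  | k + 1 => lpOperator F f₁ f₂ x₀ (lpIterate F f₁ f₂ x₀ k)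

/-- The fixed point of `lpOperator`, as the limit of the Picard iterates. -/
def lpSolution (F : Euc n₂ →L[ℝ] Euc n₂) (f₁ : ℝ → Euc n₁ × Euc n₂ → Euc n₁)
    (f₂ : ℝ → Euc n₁ × Euc n₂ → Euc n₂) (x₀ : Euc n₁) (t : ℝ) : Euc n₁ × Euc n₂ :=
  limUnder atTop (fun k => lpIterate F f₁ f₂ x₀ k t)

namespace IsLPSystem

theorem memWeighted_iterate (h : IsLPSystem F β γf κ₁ κ₂ f₁ f₂) (x₀ : Euc n₁) (k : ℕ) :
    MemWeighted β (lpIterate F f₁ f₂ x₀ k) := by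
  induction k with
  | zero => exact ⟨aestronglyMeasurable_const, 0, fun t _ => by simp [lpIterate]⟩
  | succ k ih => exact h.memWeighted ih

theorem exists_iterate_bound (h : IsLPSystem F β γf κ₁ κ₂ f₁ f₂) (x₀ : Euc n₁) :
    ∃ M, 0 ≤ M ∧ ∀ k, ∀ t ≤ 0,
      sumNorm (lpIterate F f₁ f₂ x₀ (k + 1) t - lpIterate F f₁ f₂ x₀ k t) ≤
        M * (κ₁ / β + κ₂ / (-(β + γf))) ^ k * Real.exp (-β * t) := by
  obtain ⟨M, hM0, hM⟩ := (h.memWeighted_iterate x₀ 1).exists_sub (h.memWeighted_iterate x₀ 0)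
  refine ⟨M, hM0, fun k => ?_⟩
  induction k with
  | zero => simpa using hM
  | succ k ih =>
    intro t ht
    refine (h.contraction (x₀ := x₀) (h.memWeighted_iterate x₀ (k + 1))
      (h.memWeighted_iterate x₀ k) ih ht).trans_eq ?_
    ring

/-- The increments are dominated by a geometric series, pointwise in `t`. Taking an explicit
pointwise limit keeps the solution measurable in the noise path, and the same function serves for
every admissible weight `β`. -/
theorem exists_solution_bound (h : IsLPSystem F β γf κ₁ κ₂ f₁ f₂) (x₀ : Euc n₁) :
    ∃ M, 0 ≤ M ∧ ∀ t ≤ 0,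
      Tendsto (fun k => lpIterate F f₁ f₂ x₀ k t) atTop (𝓝 (lpSolution F f₁ f₂ x₀ t)) ∧
      ∀ k, sumNorm (lpSolution F f₁ f₂ x₀ t - lpIterate F f₁ f₂ x₀ k t) ≤
        M * (κ₁ / β + κ₂ / (-(β + γf))) ^ k * Real.exp (-β * t) := by
  obtain ⟨M, hM0, hM⟩ := h.exists_iterate_bound x₀
  set q := κ₁ / β + κ₂ / (-(β + γf)) with hq
  have hq1 : q < 1 := h.contr
  -- The factor 2 is the price of passing from the product norm, in which completeness is used, back
  -- to `sumNorm`.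
  refine ⟨2 * (M / (1 - q)), mul_nonneg zero_le_two (div_nonneg hM0 (by linarith)),
    fun t ht => ?_⟩
  have hd : ∀ k, dist (lpIterate F f₁ f₂ x₀ k t) (lpIterate F f₁ f₂ x₀ (k + 1) t) ≤
      (M * Real.exp (-β * t)) * q ^ k := fun k => by
    rw [dist_comm, dist_eq_norm]
    refine (norm_le_sumNorm _).trans ((hM k t ht).trans_eq ?_)
    ring
  have hlim : Tendsto (fun k => lpIterate F f₁ f₂ x₀ k t) atTop
      (𝓝 (lpSolution F f₁ f₂ x₀ t)) :=
    (cauchySeq_of_le_geometric q _ hq1 hd).tendsto_limUnder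
  refine ⟨hlim, fun k => ?_⟩
  have h1 := dist_le_of_le_geometric_of_tendsto q _ hq1 hd hlim k
  rw [dist_comm, dist_eq_norm] at h1
  refine (sumNorm_le_two_mul _).trans ((mul_le_mul_of_nonneg_left h1 zero_le_two).trans_eq ?_)
  ring

theorem memWeighted_solution (h : IsLPSystem F β γf κ₁ κ₂ f₁ f₂) (x₀ : Euc n₁) :
    MemWeighted β (lpSolution F f₁ f₂ x₀) := by
  obtain ⟨M, -, hM⟩ := h.exists_solution_bound x₀
  refine ⟨aestronglyMeasurable_of_tendsto_ae atTop (fun k => (h.memWeighted_iterate x₀ k).1) ?_,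
    M, fun t ht => ?_⟩
  · filter_upwards [ae_restrict_mem measurableSet_Iic] with t ht using (hM t ht).1
  · simpa [lpIterate] using (hM t ht).2 0

/-- By the contraction estimate, the operator at the iterates converges to the operator at their
limit, so both sides are limits of the same shifted sequence. -/
theorem solution_eq (h : IsLPSystem F β γf κ₁ κ₂ f₁ f₂) (x₀ : Euc n₁) :
    EqOn (lpSolution F f₁ f₂ x₀) (lpOperator F f₁ f₂ x₀ (lpSolution F f₁ f₂ x₀)) (Iic 0) := by
  intro t ht
  obtain ⟨M, -, hM⟩ := h.exists_solution_bound x₀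
  set q := κ₁ / β + κ₂ / (-(β + γf)) with hq
  have h1 := (tendsto_add_atTop_iff_nat 1).2 (hM t ht).1
  refine tendsto_nhds_unique h1 ?_
  have h2 : ∀ k, ‖lpIterate F f₁ f₂ x₀ (k + 1) t -
      lpOperator F f₁ f₂ x₀ (lpSolution F f₁ f₂ x₀) t‖ ≤ q * (M * q ^ k) * Real.exp (-β * t) :=
    fun k => by
      refine (norm_le_sumNorm _).trans ?_
      rw [sumNorm_sub_comm]
      exact h.contraction (h.memWeighted_solution x₀) (h.memWeighted_iterate x₀ k)
        (fun s hs => (hM s hs).2 k) ht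
  rw [tendsto_iff_norm_sub_tendsto_zero]
  refine squeeze_zero (fun _ => norm_nonneg _) h2 ?_
  have := (((tendsto_pow_atTop_nhds_zero_of_lt_one h.ratio_nonneg h.contr).const_mul M).const_mul
    q).mul_const (Real.exp (-β * t))
  rw [mul_zero, mul_zero, zero_mul] at this
  exact this

theorem continuousOn_solution (h : IsLPSystem F β γf κ₁ κ₂ f₁ f₂) (x₀ : Euc n₁) :
    ContinuousOn (lpSolution F f₁ f₂ x₀) (Iic 0) :=
  (h.continuousOn (h.memWeighted_solution x₀)).congr (h.solution_eq x₀)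

end IsLPSystem

namespace SlowFastSystem

variable {n₁ n₂ : ℕ} {sys : SlowFastSystem n₁ n₂}

/-! ### The random system for a fixed noise path -/

/-- Hypotheses on the coefficients of the system. -/
structure IsRegular (sys : SlowFastSystem n₁ n₂) (γ γf K K' C₁ : ℝ) : Prop where
  decay : DecaysAtRate sys.F γf
  K_pos : 0 < K
  K'_nonneg : 0 ≤ K'
  γ_pos : 0 < γ
  gap : K < -(γ + γf)
  zero₂ : sys.g₂ (0, 0) = 0
  lip₁ : ∀ x y x' y', ‖sys.g₁ (x, y) - sys.g₁ (x', y')‖ ≤ K * (‖x - x'‖ + ‖y - y'‖)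
  lip₂ : ∀ x y x' y', ‖sys.g₂ (x, y) - sys.g₂ (x', y')‖ ≤ K * (‖x - x'‖ + ‖y - y'‖)
  bdd₁ : ∀ p, ‖sys.g₁ p‖ ≤ C₁
  diff₂ : Differentiable ℝ sys.g₂
  deriv_lip : ∀ p q, ‖fderiv ℝ sys.g₂ p - fderiv ℝ sys.g₂ q‖ ≤ K' * ‖p - q‖

/-- Right-continuous noise paths of controlled exponential growth at `-∞`. -/
structure IsGoodNoise {n : ℕ} (β : ℝ) (z : ℝ → Euc n) : Prop where
  meas : AEStronglyMeasurable z (volume.restrict (Iic 0))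
  right_cont : ∀ t < 0, ContinuousWithinAt z (Ici t) t
  bounded : ∃ C, ExpBounded β C z

theorem inWeighted_neg_iff {n : ℕ} {γ : ℝ} {φ : ℝ → Euc n} :
    InWeighted (-γ) φ ↔ ContinuousOn φ (Iic 0) ∧ ∃ C, ExpBounded γ C φ := by
  have key : ∀ C t, Real.exp (- -γ * t) * ‖φ t‖ ≤ C ↔ ‖φ t‖ ≤ C * Real.exp (-γ * t) := by
    intro C t
    rw [neg_neg, neg_mul, Real.exp_neg, ← div_eq_mul_inv, le_div_iff₀ (Real.exp_pos _), mul_comm]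
  simp only [InWeighted, ExpBounded, key]

theorem memWeighted_prodMk {γ C C' : ℝ} {x : ℝ → Euc n₁} {y : ℝ → Euc n₂}
    (hx : AEStronglyMeasurable x (volume.restrict (Iic 0)))
    (hy : AEStronglyMeasurable y (volume.restrict (Iic 0)))
    (hxb : ExpBounded γ C x) (hyb : ExpBounded γ C' y) :
    MemWeighted γ (fun t => (x t, y t)) :=
  ⟨hx.prodMk hy, C + C', fun t ht => by
    rw [add_mul]
    exact add_le_add (hxb t ht) (hyb t ht)⟩

theorem _root_.MemWeighted.snd {γ : ℝ} {u : ℝ → Euc n₁ × Euc n₂} (hu : MemWeighted γ u) :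
    ∃ C, ExpBounded γ C (fun t => (u t).2) :=
  hu.2.imp fun C hC t ht => le_trans (by simp [sumNorm]) (hC t ht)

theorem _root_.MemWeighted.fst {γ : ℝ} {u : ℝ → Euc n₁ × Euc n₂} (hu : MemWeighted γ u) :
    ∃ C, ExpBounded γ C (fun t => (u t).1) :=
  hu.2.imp fun C hC t ht => le_trans (by simp [sumNorm]) (hC t ht)

/-- The slow vector field in the fast time `t/ε`. -/
def slowField (sys : SlowFastSystem n₁ n₂) (ε : ℝ) (z : ℝ → Euc n₂) (s : ℝ)
    (u : Euc n₁ × Euc n₂) : Euc n₁ := ε • (sys.S u.1 + sys.g₁ (u.1, u.2 + z s))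

/-- The nonlinear part of the fast vector field in the fast time `t/ε`. -/
def fastField (sys : SlowFastSystem n₁ n₂) (z : ℝ → Euc n₂) (s : ℝ)
    (u : Euc n₁ × Euc n₂) : Euc n₂ := sys.g₂ (u.1, u.2 + z s)

/-- The solution, in fast time, of the random system with slow component `x₀` at time zero. -/
def orbit (sys : SlowFastSystem n₁ n₂) (ε : ℝ) (z : ℝ → Euc n₂) (x₀ : Euc n₁) :
    ℝ → Euc n₁ × Euc n₂ :=
  lpSolution sys.F (sys.slowField ε z) (sys.fastField z) x₀

variable {γ γf K K' C₁ ε β : ℝ} {z : ℝ → Euc n₂} {x₀ : Euc n₁}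

namespace IsRegular

theorem C₁_nonneg (h : sys.IsRegular γ γf K K' C₁) : 0 ≤ C₁ :=
  (norm_nonneg _).trans (h.bdd₁ 0)

theorem continuous₁ (h : sys.IsRegular γ γf K K' C₁) : Continuous sys.g₁ := by
  refine continuous_iff_continuousAt.2 fun p => ?_
  rw [ContinuousAt, tendsto_iff_norm_sub_tendsto_zero]
  refine squeeze_zero (fun _ => norm_nonneg _) (fun q => h.lip₁ q.1 q.2 p.1 p.2) ?_
  have : Continuous fun q : Euc n₁ × Euc n₂ => K * (‖q.1 - p.1‖ + ‖q.2 - p.2‖) := by fun_prop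
  simpa using! this.tendsto p

theorem continuous_fderiv (h : sys.IsRegular γ γf K K' C₁) :
    Continuous (fderiv ℝ sys.g₂) := by
  refine continuous_iff_continuousAt.2 fun p => ?_
  rw [ContinuousAt, tendsto_iff_norm_sub_tendsto_zero]
  refine squeeze_zero (fun _ => norm_nonneg _) (fun q => h.deriv_lip q p) ?_
  have : Continuous fun q : Euc n₁ × Euc n₂ => K' * ‖q - p‖ := by fun_prop
  simpa using! this.tendsto p

theorem ratio_lt_one (h : sys.IsRegular γ γf K K' C₁) (hβ : β ≤ γ) : K / (-(β + γf)) < 1 := by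
  have := h.gap
  have := h.K_pos
  rw [div_lt_one (by linarith)]
  linarith

/-- In fast time the whole slow field, including `S`, carries a factor `ε`, so `S` can be treated as
a Lipschitz perturbation. -/
theorem isLPSystem (h : sys.IsRegular γ γf K K' C₁) (hε : 0 ≤ ε)
    (hc : ε * (‖sys.S‖ + K) / γ + K / (-(γ + γf)) < 1) (hz : IsGoodNoise γ z) :
    IsLPSystem sys.F γ γf (ε * (‖sys.S‖ + K)) K (sys.slowField ε z) (sys.fastField z) where
  decay := h.decay
  pos := h.γ_pos
  gap := by linarith [h.gap, h.K_pos]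
  meas₁ u hu := by
    have h1 : AEStronglyMeasurable (fun s => ((u s).1, (u s).2 + z s)) (volume.restrict (Iic 0)) :=
      hu.fst.prodMk (hu.snd.add hz.meas)
    exact ((sys.S.continuous.comp_aestronglyMeasurable hu.fst).add
      (h.continuous₁.comp_aestronglyMeasurable h1)).const_smul ε
  meas₂ u hu := by
    have h1 : AEStronglyMeasurable (fun s => ((u s).1, (u s).2 + z s)) (volume.restrict (Iic 0)) :=
      hu.fst.prodMk (hu.snd.add hz.meas)
    exact h.diff₂.continuous.comp_aestronglyMeasurable h1
  nonneg₁ := by have := h.K_pos; positivity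
  nonneg₂ := h.K_pos.le
  lip₁ s hs u v := by
    have h1 := h.lip₁ u.1 (u.2 + z s) v.1 (v.2 + z s)
    rw [add_sub_add_right_eq_sub] at h1
    have h2 := sys.S.le_opNorm (u.1 - v.1)
    rw [map_sub] at h2
    have h3 := norm_add_le (sys.S u.1 - sys.S v.1)
      (sys.g₁ (u.1, u.2 + z s) - sys.g₁ (v.1, v.2 + z s))
    have h4 : 0 ≤ ‖sys.S‖ * ‖u.2 - v.2‖ := by positivity
    rw [slowField, slowField, ← smul_sub, add_sub_add_comm, norm_smul, Real.norm_of_nonneg hε,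
      mul_assoc]
    refine mul_le_mul_of_nonneg_left ?_ hε
    simp only [sumNorm, Prod.fst_sub, Prod.snd_sub]
    linarith
  lip₂ s hs u v := by
    have h1 := h.lip₂ u.1 (u.2 + z s) v.1 (v.2 + z s)
    rw [add_sub_add_right_eq_sub] at h1
    exact h1
  zero₁ := by
    refine ⟨ε * C₁, fun s hs => ?_⟩
    have h1 : 1 ≤ Real.exp (-γ * s) := Real.one_le_exp (by nlinarith [h.γ_pos])
    simp only [slowField, norm_smul, Real.norm_of_nonneg hε, Prod.fst_zero, map_zero, zero_add]
    have h2 : 0 ≤ ε * C₁ := mul_nonneg hε h.C₁_nonneg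
    nlinarith [mul_le_mul_of_nonneg_left (h.bdd₁ (0, (0 : Euc n₁ × Euc n₂).2 + z s)) hε]
  zero₂ := by
    obtain ⟨C, hC⟩ := hz.bounded
    refine ⟨K * C, fun s hs => ?_⟩
    have h1 := h.lip₂ 0 (z s) 0 0
    rw [h.zero₂, sub_zero, sub_zero, norm_zero, zero_add, sub_zero] at h1
    simp only [fastField, Prod.fst_zero, Prod.snd_zero, zero_add]
    rw [mul_assoc]
    exact h1.trans (mul_le_mul_of_nonneg_left (hC s hs) h.K_pos.le)
  contr := hc

/-- At `ε = 0` the slow variable is frozen at `x₀`, so the equation for `y⁰` is covered by the same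
fixed-point theory. -/
theorem isLPSystem_zero (h : sys.IsRegular γ γf K K' C₁) (hz : IsGoodNoise γ z) :
    IsLPSystem sys.F γ γf (0 * (‖sys.S‖ + K)) K (sys.slowField 0 z) (sys.fastField z) :=
  h.isLPSystem le_rfl (by simpa using! h.ratio_lt_one le_rfl) hz

theorem continuousWithinAt_fastField (h : sys.IsRegular γ γf K K' C₁) (hz : IsGoodNoise γ z)
    {x : ℝ → Euc n₁} {y : ℝ → Euc n₂} (hx : ContinuousOn x (Iic 0)) (hy : ContinuousOn y (Iic 0))
    {t : ℝ} (ht : t < 0) :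
    ContinuousWithinAt (fun s => sys.fastField z s (x s, y s)) (Ici t) t :=
  h.diff₂.continuous.continuousAt.comp_continuousWithinAt
    (((hx.continuousAt (Iic_mem_nhds ht)).continuousWithinAt).prodMk
      (((hy.continuousAt (Iic_mem_nhds ht)).continuousWithinAt).add (hz.right_cont t ht)))

/-- Points on exponentially bounded backward orbits are those on the graph of
`x₀ ↦ (orbit ε z x₀ 0).2`. -/
theorem exists_orbit_iff (h : sys.IsRegular γ γf K K' C₁) (hε : 0 ≤ ε)
    (hc : ε * (‖sys.S‖ + K) / γ + K / (-(γ + γf)) < 1) (hz : IsGoodNoise γ z)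
    (p : Euc n₁ × Euc n₂) :
    (∃ (x : ℝ → Euc n₁) (y : ℝ → Euc n₂), InWeighted (-γ) x ∧ InWeighted (-γ) y ∧
      ∀ t ≤ 0, x t = p.1 + ∫ s in (0 : ℝ)..t, sys.slowField ε z s (x s, y s) ∧
        y t = p.2 + ∫ s in (0 : ℝ)..t, (sys.F (y s) + sys.fastField z s (x s, y s))) ↔
      p.2 = (sys.orbit ε z p.1 0).2 := by
  have hLP := h.isLPSystem hε hc hz
  constructor
  · rintro ⟨x, y, hx, hy, hxy⟩
    rw [inWeighted_neg_iff] at hx hy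
    obtain ⟨hxc, Cx, hxb⟩ := hx
    obtain ⟨hyc, Cy, hyb⟩ := hy
    have hu : MemWeighted γ (fun t => (x t, y t)) :=
      memWeighted_prodMk (hxc.aestronglyMeasurable measurableSet_Iic)
        (hyc.aestronglyMeasurable measurableSet_Iic) hxb hyb
    obtain ⟨C, hC⟩ := hLP.bounded₂ hu
    have hfix : EqOn (fun t => (x t, y t))
        (lpOperator sys.F (sys.slowField ε z) (sys.fastField z) p.1 (fun t => (x t, y t)))
        (Iic 0) := fun t ht => by
      refine Prod.ext (hxy t ht).1 ?_
      -- Membership in the weighted space is what turns the integrated fast equation into the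
      -- convolution from `-∞`.
      exact hC.eq_fastInt h.decay hLP.gap (hLP.meas₂ _ hu.1)
        (fun s hs => h.continuousWithinAt_fastField hz hxc hyc hs) hyc hyb
        (fun s hs => (hxy s hs).2) ht
    have := hLP.unique hu (hLP.memWeighted_solution p.1) hfix (hLP.solution_eq p.1)
      (mem_Iic.2 le_rfl)
    have e0 : y 0 = p.2 := by simpa using (hxy 0 le_rfl).2
    rw [← e0]
    exact congrArg Prod.snd this
  · intro hp
    set u := sys.orbit ε z p.1 with hu_def
    have hu : MemWeighted γ u := hLP.memWeighted_solution p.1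
    have hcont : ContinuousOn u (Iic 0) := hLP.continuousOn_solution p.1
    have hfix := hLP.solution_eq p.1
    obtain ⟨C, hC⟩ := hLP.bounded₂ hu
    refine ⟨fun t => (u t).1, fun t => (u t).2,
      inWeighted_neg_iff.2 ⟨continuous_fst.comp_continuousOn hcont, hu.fst⟩,
      inWeighted_neg_iff.2 ⟨continuous_snd.comp_continuousOn hcont, hu.snd⟩, fun t ht => ⟨?_, ?_⟩⟩
    · exact congrArg Prod.fst (hfix ht)
    · have hF := hC.fastInt_eq_integral h.decay hLP.gap (hLP.meas₂ _ hu.1)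
        (fun s hs => h.continuousWithinAt_fastField hz (continuous_fst.comp_continuousOn hcont)
          (continuous_snd.comp_continuousOn hcont) hs) ht
      have e : ∀ s ≤ 0, (u s).2 = fastInt sys.F (fun s => sys.fastField z s (u s)) s := fun s hs =>
        congrArg Prod.snd (hfix hs)
      rw [hp]
      simp only
      rw [e t ht, hF, e 0 le_rfl]
      congr 1
      refine intervalIntegral.integral_congr fun s hs => ?_
      rw [uIcc_of_ge ht] at hs
      exact congrArg (fun w => sys.F w + sys.fastField z s (u s)) (e s hs.2).symm

/-! ### The zeroth-order coefficient -/

theorem orbit_zero_fst (h : sys.IsRegular γ γf K K' C₁) (hz : IsGoodNoise γ z) (x₀ : Euc n₁)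
    {t : ℝ} (ht : t ≤ 0) : (sys.orbit 0 z x₀ t).1 = x₀ := by
  have := congrArg Prod.fst ((h.isLPSystem_zero hz).solution_eq x₀ (mem_Iic.2 ht))
  refine this.trans ?_
  simp [lpOperator, slowField]

theorem orbit_zero_snd (h : sys.IsRegular γ γf K K' C₁) (hz : IsGoodNoise γ z) (x₀ : Euc n₁)
    {t : ℝ} (ht : t ≤ 0) : (sys.orbit 0 z x₀ t).2 =
      fastInt sys.F (fun s => sys.g₂ (x₀, (sys.orbit 0 z x₀ s).2 + z s)) t := by
  have := congrArg Prod.snd ((h.isLPSystem_zero hz).solution_eq x₀ (mem_Iic.2 ht))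
  refine this.trans (fastInt_congr (fun s hs => ?_) ht)
  have := h.orbit_zero_fst hz x₀ hs
  unfold orbit at this
  simp only [fastField, orbit]
  rw [this]

theorem continuousOn_orbit_zero (h : sys.IsRegular γ γf K K' C₁) (hz : IsGoodNoise γ z)
    (x₀ : Euc n₁) : ContinuousOn (fun t => (sys.orbit 0 z x₀ t).2) (Iic 0) :=
  continuous_snd.comp_continuousOn ((h.isLPSystem_zero hz).continuousOn_solution x₀)

theorem isCriticalFast_orbit (h : sys.IsRegular γ γf K K' C₁) (hz : IsGoodNoise γ z)
    (x₀ : Euc n₁) : sys.IsCriticalFast γ z x₀ (fun t => (sys.orbit 0 z x₀ t).2) := by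
  have hLP := h.isLPSystem_zero hz
  have hu := hLP.memWeighted_solution x₀
  refine ⟨inWeighted_neg_iff.2 ⟨h.continuousOn_orbit_zero hz x₀, hu.snd⟩, fun t ht =>
    ⟨?_, h.orbit_zero_snd hz x₀ ht⟩⟩
  obtain ⟨C, hC⟩ := hLP.bounded₂ hu
  refine (hC.integrableOn_fast h.decay hLP.gap (hLP.meas₂ _ hu.1) ht).congr_fun
    (fun s hs => ?_) measurableSet_Iic
  have := h.orbit_zero_fst hz x₀ (le_trans hs ht)
  unfold orbit at this
  simp only [fastField, orbit]
  rw [this]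

theorem eqOn_of_isCriticalFast (h : sys.IsRegular γ γf K K' C₁) (hz : IsGoodNoise γ z)
    {y : ℝ → Euc n₂} (hy : sys.IsCriticalFast γ z x₀ y) :
    EqOn y (fun t => (sys.orbit 0 z x₀ t).2) (Iic 0) := by
  have hLP := h.isLPSystem_zero hz
  obtain ⟨hyw, hyi⟩ := hy
  obtain ⟨hyc, C, hyb⟩ := inWeighted_neg_iff.1 hyw
  have hx : ExpBounded γ ‖x₀‖ (fun _ : ℝ => x₀) := fun s hs => by
    have h1 : 1 ≤ Real.exp (-γ * s) := Real.one_le_exp (by nlinarith [h.γ_pos])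
    nlinarith [norm_nonneg x₀]
  have hu : MemWeighted γ (fun t => (x₀, y t)) :=
    memWeighted_prodMk aestronglyMeasurable_const
      (hyc.aestronglyMeasurable measurableSet_Iic) hx hyb
  have := hLP.unique (x₀ := x₀) hu (hLP.memWeighted_solution x₀) (fun t ht => ?_)
    (hLP.solution_eq x₀)
  · exact fun t ht => congrArg Prod.snd (this ht)
  · refine Prod.ext ?_ (hyi t ht).2
    simp [lpOperator, slowField]

theorem isCriticalFast_y0 (h : sys.IsRegular γ γf K K' C₁) (hz : IsGoodNoise γ z)
    (x₀ : Euc n₁) : sys.IsCriticalFast γ z x₀ (sys.y0 γ z x₀) :=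
  Classical.epsilon_spec (p := sys.IsCriticalFast γ z x₀) ⟨_, h.isCriticalFast_orbit hz x₀⟩

theorem y0_unique (h : sys.IsRegular γ γf K K' C₁) (hz : IsGoodNoise γ z)
    {y : ℝ → Euc n₂} (hy : sys.IsCriticalFast γ z x₀ y) : EqOn y (sys.y0 γ z x₀) (Iic 0) :=
  (h.eqOn_of_isCriticalFast hz hy).trans
    (h.eqOn_of_isCriticalFast hz (h.isCriticalFast_y0 hz x₀)).symm

theorem continuousOn_y0 (h : sys.IsRegular γ γf K K' C₁) (hz : IsGoodNoise γ z)
    (x₀ : Euc n₁) : ContinuousOn (sys.y0 γ z x₀) (Iic 0) :=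
  (h.isCriticalFast_y0 hz x₀).1.1

theorem bounded_y0 (h : sys.IsRegular γ γf K K' C₁) (hz : IsGoodNoise γ z)
    (x₀ : Euc n₁) : ∃ C, ExpBounded γ C (sys.y0 γ z x₀) :=
  (inWeighted_neg_iff.1 (h.isCriticalFast_y0 hz x₀).1).2

theorem y0_eq_fastInt (h : sys.IsRegular γ γf K K' C₁) (hz : IsGoodNoise γ z)
    (x₀ : Euc n₁) {t : ℝ} (ht : t ≤ 0) :
    sys.y0 γ z x₀ t = fastInt sys.F (fun s => sys.g₂ (sys.basePoint γ z x₀ s)) t :=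
  ((h.isCriticalFast_y0 hz x₀).2 t ht).2

theorem h0_eq (h : sys.IsRegular γ γf K K' C₁) (hz : IsGoodNoise γ z) (x₀ : Euc n₁) :
    sys.h0 γ z x₀ = sys.y0 γ z x₀ 0 := by
  rw [h.y0_eq_fastInt hz x₀ le_rfl, h0, fastInt]
  simp only [zero_sub, basePoint]

theorem aestronglyMeasurable_basePoint (h : sys.IsRegular γ γf K K' C₁) (hz : IsGoodNoise γ z)
    (x₀ : Euc n₁) :
    AEStronglyMeasurable (sys.basePoint γ z x₀) (volume.restrict (Iic 0)) :=
  aestronglyMeasurable_const.prodMk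
    (((h.continuousOn_y0 hz x₀).aestronglyMeasurable measurableSet_Iic).add hz.meas)

theorem continuousWithinAt_basePoint (h : sys.IsRegular γ γf K K' C₁) (hz : IsGoodNoise γ z)
    (x₀ : Euc n₁) {t : ℝ} (ht : t < 0) :
    ContinuousWithinAt (sys.basePoint γ z x₀) (Ici t) t :=
  continuousWithinAt_const.prodMk
    ((((h.continuousOn_y0 hz x₀).continuousAt (Iic_mem_nhds ht)).continuousWithinAt).add
      (hz.right_cont t ht))

end IsRegular

end SlowFastSystem

namespace SlowFastSystem

variable {n₁ n₂ : ℕ} {sys : SlowFastSystem n₁ n₂}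
  {γ γf K K' C₁ ε β : ℝ} {z : ℝ → Euc n₂} {x₀ : Euc n₁}

/-- On the ball of radius `‖h‖` about `p` the derivative differs from its value at `p` by at most `L
‖h‖`, so the mean value inequality applies. The sharper constant `L/2` is not needed. -/
theorem _root_.norm_sub_sub_fderiv_le {E G : Type*} [NormedAddCommGroup E] [NormedSpace ℝ E]
    [NormedAddCommGroup G] [NormedSpace ℝ G] {g : E → G} {L : ℝ} (hg : Differentiable ℝ g)
    (hL : ∀ p q, ‖fderiv ℝ g p - fderiv ℝ g q‖ ≤ L * ‖p - q‖) (hL0 : 0 ≤ L) (p h : E) :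
    ‖g (p + h) - g p - fderiv ℝ g p h‖ ≤ L * ‖h‖ ^ 2 := by
  have h1 := (convex_closedBall p ‖h‖).norm_image_sub_le_of_norm_fderiv_le' (𝕜 := ℝ) (f := g)
    (φ := fderiv ℝ g p) (C := L * ‖h‖) (x := p) (y := p + h) (fun x _ => hg x)
    (fun x hx => (hL x p).trans (mul_le_mul_of_nonneg_left
      (by simpa [dist_eq_norm] using hx) hL0)) (by simp) (by simp)
  rw [add_sub_cancel_left] at h1
  refine h1.trans_eq (by ring)

/-- The inhomogeneous linear vector field of the linearized fast equation. -/
def linField (sys : SlowFastSystem n₁ n₂) (γ : ℝ) (z : ℝ → Euc n₂) (x₀ : Euc n₁) (s : ℝ)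
    (u : Euc n₁ × Euc n₂) : Euc n₂ :=
  fderiv ℝ sys.g₂ (sys.basePoint γ z x₀ s) (sys.x1 γ z x₀ s, u.2)

/-- The solution of the linearized fast equation. -/
def fastCorrection (sys : SlowFastSystem n₁ n₂) (γ : ℝ) (z : ℝ → Euc n₂) (x₀ : Euc n₁) (t : ℝ) :
    Euc n₂ :=
  (lpSolution sys.F (fun _ _ => (0 : Euc n₁)) (sys.linField γ z x₀) 0 t).2

namespace IsRegular

/-! ### The first-order coefficient -/

/-- Difference quotients inherit the Lipschitz bound. Keeping `‖a‖ + ‖b‖` preserves the exact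
constant `K` for the linearized contraction; an operator norm for the product norm could cost a
factor 2. -/
theorem norm_fderiv_le (h : sys.IsRegular γ γf K K' C₁) (p : Euc n₁ × Euc n₂) (a : Euc n₁)
    (b : Euc n₂) : ‖fderiv ℝ sys.g₂ p (a, b)‖ ≤ K * (‖a‖ + ‖b‖) := by
  have h1 := ((h.diff₂ p).hasFDerivAt.hasLineDerivAt (a, b)).tendsto_slope_zero
  refine le_of_tendsto h1.norm ?_
  filter_upwards [self_mem_nhdsWithin] with t ht
  have h2 := h.lip₂ (p + t • (a, b)).1 (p + t • (a, b)).2 p.1 p.2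
  have ht' : 0 < |t| := abs_pos.2 ht
  simp only [Prod.fst_add, Prod.snd_add, Prod.smul_fst, Prod.smul_snd, add_sub_cancel_left,
    norm_smul, Real.norm_eq_abs] at h2
  rw [norm_smul, norm_inv, Real.norm_eq_abs, inv_mul_le_iff₀ ht']
  refine h2.trans_eq (by ring)

theorem g2x_add_g2y (h : sys.IsRegular γ γf K K' C₁) (p : Euc n₁ × Euc n₂) (a : Euc n₁)
    (b : Euc n₂) : sys.g2x p a + sys.g2y p b = fderiv ℝ sys.g₂ p (a, b) := by
  have hp := (h.diff₂ p).hasFDerivAt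
  have h1 : sys.g2x p = (fderiv ℝ sys.g₂ p).comp (ContinuousLinearMap.inl ℝ _ _) :=
    (HasFDerivAt.comp (f := fun x : Euc n₁ => (x, p.2)) p.1 hp
      (hasFDerivAt_prodMk_left p.1 p.2)).fderiv
  have h2 : sys.g2y p = (fderiv ℝ sys.g₂ p).comp (ContinuousLinearMap.inr ℝ _ _) :=
    (HasFDerivAt.comp (f := fun y : Euc n₂ => (p.1, y)) p.2 hp
      (hasFDerivAt_prodMk_right p.1 p.2)).fderiv
  rw [h1, h2, ContinuousLinearMap.comp_apply, ContinuousLinearMap.comp_apply, ← map_add]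
  simp

theorem g2x_apply (h : sys.IsRegular γ γf K K' C₁) (p : Euc n₁ × Euc n₂) (a : Euc n₁) :
    sys.g2x p a = fderiv ℝ sys.g₂ p (a, 0) := by
  simpa using h.g2x_add_g2y p a 0

theorem g2y_eq (h : sys.IsRegular γ γf K K' C₁) (p : Euc n₁ × Euc n₂) :
    sys.g2y p = (fderiv ℝ sys.g₂ p).comp (ContinuousLinearMap.inr ℝ _ _) :=
  ContinuousLinearMap.ext fun b => by simpa using h.g2x_add_g2y p 0 b

theorem linTerm_eq (h : sys.IsRegular γ γf K K' C₁) (y : ℝ → Euc n₂) (s : ℝ) :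
    sys.linTerm γ z x₀ y s = sys.linField γ z x₀ s (0, y s) :=
  h.g2x_add_g2y _ _ _

theorem aestronglyMeasurable_g₁ (h : sys.IsRegular γ γf K K' C₁) (hz : IsGoodNoise γ z)
    (x₀ : Euc n₁) :
    AEStronglyMeasurable (fun s => sys.g₁ (sys.basePoint γ z x₀ s)) (volume.restrict (Iic 0)) :=
  h.continuous₁.comp_aestronglyMeasurable (h.aestronglyMeasurable_basePoint hz x₀)

theorem intervalIntegrable_g₁ (h : sys.IsRegular γ γf K K' C₁) (hz : IsGoodNoise γ z)
    (x₀ : Euc n₁) {a b : ℝ} (ha : a ≤ 0) (hb : b ≤ 0) :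
    IntervalIntegrable (fun s => sys.g₁ (sys.basePoint γ z x₀ s)) volume a b :=
  ExpBounded.intervalIntegrable (β := 0) (C := C₁) (fun s _ => by simpa using h.bdd₁ _)
    (h.aestronglyMeasurable_g₁ hz x₀) ha hb

theorem x1_eq_integral (h : sys.IsRegular γ γf K K' C₁) (hz : IsGoodNoise γ z)
    (x₀ : Euc n₁) {t : ℝ} (ht : t ≤ 0) : sys.x1 γ z x₀ t =
      ∫ s in (0 : ℝ)..t, (sys.S x₀ + sys.g₁ (sys.basePoint γ z x₀ s)) := by
  rw [intervalIntegral.integral_add intervalIntegrable_const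
    (h.intervalIntegrable_g₁ hz x₀ le_rfl ht), intervalIntegral.integral_const, sub_zero, x1]

theorem continuousOn_x1 (h : sys.IsRegular γ γf K K' C₁) (hz : IsGoodNoise γ z)
    (x₀ : Euc n₁) : ContinuousOn (sys.x1 γ z x₀) (Iic 0) :=
  (continuous_id.smul continuous_const).continuousOn.add
    (continuousOn_primitive_Iic fun _ ha => h.intervalIntegrable_g₁ hz x₀ ha le_rfl)

/-- Since `g₁` is bounded, `x¹` grows at most linearly, and `β |t| ≤ e^{-βt}` puts it in every
weight `β > 0`. The constant does not involve `z`. -/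
theorem bounded_x1 (h : sys.IsRegular γ γf K K' C₁) {r : ℝ}
    (hr : ‖x₀‖ ≤ r) (hβ : 0 < β) :
    ExpBounded β ((‖sys.S‖ * r + C₁) / β) (sys.x1 γ z x₀) := by
  intro t ht
  have hr0 : 0 ≤ r := (norm_nonneg _).trans hr
  have h1 : ‖∫ s in (0 : ℝ)..t, sys.g₁ (sys.basePoint γ z x₀ s)‖ ≤ C₁ * |t - 0| :=
    intervalIntegral.norm_integral_le_of_norm_le_const fun s _ => h.bdd₁ _
  have h2 : ‖t • sys.S x₀‖ ≤ |t| * (‖sys.S‖ * r) := by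
    rw [norm_smul, Real.norm_eq_abs]
    exact mul_le_mul_of_nonneg_left ((sys.S.le_opNorm _).trans
      (mul_le_mul_of_nonneg_left hr (norm_nonneg _))) (abs_nonneg _)
  have h3 : β * |t| ≤ Real.exp (-β * t) := by
    rw [abs_of_nonpos ht]
    linarith [Real.add_one_le_exp (-β * t)]
  have h4 : 0 ≤ ‖sys.S‖ * r + C₁ := add_nonneg (by positivity) h.C₁_nonneg
  rw [sub_zero] at h1
  calc ‖sys.x1 γ z x₀ t‖ ≤ |t| * (‖sys.S‖ * r) + C₁ * |t| :=
        (norm_add_le _ _).trans (add_le_add h2 h1)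
    _ = (‖sys.S‖ * r + C₁) / β * (β * |t|) := by field_simp
    _ ≤ _ := mul_le_mul_of_nonneg_left h3 (div_nonneg h4 hβ.le)

theorem aestronglyMeasurable_linField (h : sys.IsRegular γ γf K K' C₁) (hz : IsGoodNoise γ z)
    (x₀ : Euc n₁) {u : ℝ → Euc n₁ × Euc n₂} (hu : AEStronglyMeasurable u (volume.restrict (Iic 0))) :
    AEStronglyMeasurable (fun s => sys.linField γ z x₀ s (u s)) (volume.restrict (Iic 0)) := by
  have h1 := h.continuous_fderiv.comp_aestronglyMeasurable (h.aestronglyMeasurable_basePoint hz x₀)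
  have h2 := ((h.continuousOn_x1 hz x₀).aestronglyMeasurable measurableSet_Iic).prodMk hu.snd
  exact (isBoundedBilinearMap_apply (𝕜 := ℝ)).continuous.comp_aestronglyMeasurable (h1.prodMk h2)

/-- The linearized problem has a trivial slow component: `x¹` is already known and acts as an
inhomogeneity. Any `β` in `(0, γ]` is admissible, in particular `γ/2`. -/
theorem isLPSystem_lin (h : sys.IsRegular γ γf K K' C₁) (hz : IsGoodNoise γ z) (x₀ : Euc n₁)
    (hβ : 0 < β) (hβγ : β ≤ γ) :
    IsLPSystem sys.F β γf 0 K (fun _ _ => (0 : Euc n₁)) (sys.linField γ z x₀) where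
  decay := h.decay
  pos := hβ
  gap := by linarith [h.gap, h.K_pos]
  meas₁ _ _ := aestronglyMeasurable_const
  meas₂ u hu := h.aestronglyMeasurable_linField hz x₀ hu
  nonneg₁ := le_rfl
  nonneg₂ := h.K_pos.le
  lip₁ s hs u v := by simp
  lip₂ s hs u v := by
    rw [linField, linField, ← map_sub, Prod.mk_sub_mk, sub_self]
    refine (h.norm_fderiv_le _ _ _).trans (mul_le_mul_of_nonneg_left ?_ h.K_pos.le)
    simp [sumNorm]
  zero₁ := ⟨0, fun s _ => by simp⟩
  zero₂ := ⟨K * ((‖sys.S‖ * ‖x₀‖ + C₁) / β), fun s hs => by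
    refine (h.norm_fderiv_le _ _ _).trans ?_
    rw [mul_assoc]
    refine mul_le_mul_of_nonneg_left ?_ h.K_pos.le
    simpa using h.bounded_x1 le_rfl hβ s hs⟩
  contr := by simpa using! h.ratio_lt_one hβγ

theorem fastCorrection_eq_fastInt (h : sys.IsRegular γ γf K K' C₁) (hz : IsGoodNoise γ z)
    (x₀ : Euc n₁) {t : ℝ} (ht : t ≤ 0) : sys.fastCorrection γ z x₀ t =
      fastInt sys.F (sys.linTerm γ z x₀ (sys.fastCorrection γ z x₀)) t := by
  have := congrArg Prod.snd
    ((h.isLPSystem_lin hz x₀ h.γ_pos le_rfl).solution_eq 0 (mem_Iic.2 ht))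
  refine this.trans (fastInt_congr (fun s hs => ?_) ht)
  rw [h.linTerm_eq]
  rfl

theorem continuousOn_fastCorrection (h : sys.IsRegular γ γf K K' C₁) (hz : IsGoodNoise γ z)
    (x₀ : Euc n₁) : ContinuousOn (sys.fastCorrection γ z x₀) (Iic 0) :=
  continuous_snd.comp_continuousOn
    ((h.isLPSystem_lin hz x₀ h.γ_pos le_rfl).continuousOn_solution 0)

/-- Stability is applied with the zero function as approximate fixed point: its defect is the
inhomogeneity, bounded through `x¹` uniformly in the noise. -/
theorem bounded_fastCorrection (h : sys.IsRegular γ γf K K' C₁) (hz : IsGoodNoise γ z) {r : ℝ}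
    (hr : ‖x₀‖ ≤ r) (hβ : 0 < β) (hβγ : β ≤ γ) :
    ExpBounded β (K * ((‖sys.S‖ * r + C₁) / β) / (-(β + γf)) / (1 - K / (-(β + γf))))
      (sys.fastCorrection γ z x₀) := by
  have hLP := h.isLPSystem_lin hz x₀ hβ hβγ
  have hx : ExpBounded β (K * ((‖sys.S‖ * r + C₁) / β)) (fun s => sys.linField γ z x₀ s 0) :=
    fun s hs => by
      refine (h.norm_fderiv_le _ _ _).trans ?_
      rw [mul_assoc]
      refine mul_le_mul_of_nonneg_left ?_ h.K_pos.le
      simpa using h.bounded_x1 hr hβ s hs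
  intro t ht
  have h0 : MemWeighted β (fun _ : ℝ => (0 : Euc n₁ × Euc n₂)) :=
    ⟨aestronglyMeasurable_const, 0, fun t _ => by simp⟩
  have h1 := hLP.stability (hLP.memWeighted_solution 0) h0 (hLP.solution_eq 0)
    (M := K * ((‖sys.S‖ * r + C₁) / β) / (-(β + γf))) (fun s hs => ?_) ht
  · rw [zero_div, zero_add, sub_zero] at h1
    exact le_trans (by simp [sumNorm, fastCorrection]) h1
  · have h2 := hx.norm_fastInt_le h.decay hLP.gap hs
    simpa [sumNorm, lpOperator] using h2

theorem aestronglyMeasurable_linTerm (h : sys.IsRegular γ γf K K' C₁) (hz : IsGoodNoise γ z)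
    {y : ℝ → Euc n₂} (hy : ContinuousOn y (Iic 0)) :
    AEStronglyMeasurable (sys.linTerm γ z x₀ y) (volume.restrict (Iic 0)) :=
  (h.aestronglyMeasurable_linField hz x₀ (u := fun s => (0, y s))
    (aestronglyMeasurable_const.prodMk (hy.aestronglyMeasurable measurableSet_Iic))).congr
      (Eventually.of_forall fun s => (h.linTerm_eq y s).symm)

theorem bounded_linTerm (h : sys.IsRegular γ γf K K' C₁) {C : ℝ}
    {y : ℝ → Euc n₂} (hy : ExpBounded γ C y) :
    ∃ C', ExpBounded γ C' (sys.linTerm γ z x₀ y) := by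
  refine ⟨K * ((‖sys.S‖ * ‖x₀‖ + C₁) / γ + C), fun s hs => ?_⟩
  rw [h.linTerm_eq]
  refine (h.norm_fderiv_le _ _ _).trans ?_
  rw [mul_assoc, add_mul]
  exact mul_le_mul_of_nonneg_left (add_le_add (h.bounded_x1 le_rfl h.γ_pos s hs) (hy s hs))
    h.K_pos.le

theorem continuousWithinAt_linTerm (h : sys.IsRegular γ γf K K' C₁) (hz : IsGoodNoise γ z)
    {y : ℝ → Euc n₂} (hy : ContinuousOn y (Iic 0)) {t : ℝ} (ht : t < 0) :
    ContinuousWithinAt (sys.linTerm γ z x₀ y) (Ici t) t := by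
  have h1 := h.continuous_fderiv.continuousAt.comp_continuousWithinAt
    (h.continuousWithinAt_basePoint hz x₀ ht)
  have h2 : ContinuousWithinAt (fun s => (sys.x1 γ z x₀ s, y s)) (Ici t) t :=
    ((h.continuousOn_x1 hz x₀).continuousAt (Iic_mem_nhds ht)).continuousWithinAt.prodMk
      (hy.continuousAt (Iic_mem_nhds ht)).continuousWithinAt
  have h3 := h1.clm_apply h2
  exact h3.congr (fun s _ => h.linTerm_eq y s) (h.linTerm_eq y t)

theorem h1Integral_eq (y : ℝ → Euc n₂) :
    sys.h1Integral γ z x₀ y = fastInt sys.F (sys.linTerm γ z x₀ y) 0 := by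
  simp [h1Integral, fastInt]

theorem gap' (h : sys.IsRegular γ γf K K' C₁) : γ + γf < 0 := by
  linarith [h.gap, h.K_pos]

theorem isFastCorrection_fastCorrection (h : sys.IsRegular γ γf K K' C₁) (hz : IsGoodNoise γ z)
    (x₀ : Euc n₁) : sys.IsFastCorrection γ z x₀ (sys.fastCorrection γ z x₀) := by
  have hc := h.continuousOn_fastCorrection hz x₀
  have hb := h.bounded_fastCorrection hz (x₀ := x₀) le_rfl h.γ_pos le_rfl
  obtain ⟨C, hC⟩ := h.bounded_linTerm (z := z) (x₀ := x₀) hb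
  have hm := h.aestronglyMeasurable_linTerm (x₀ := x₀) hz hc
  refine ⟨inWeighted_neg_iff.2 ⟨hc, _, hb⟩, ?_, fun t ht => ?_⟩
  · simpa using hC.integrableOn_fast h.decay h.gap' hm le_rfl
  · have h1 := hC.fastInt_eq_integral h.decay h.gap' hm
      (fun s hs => h.continuousWithinAt_linTerm hz hc hs) ht
    rw [h1Integral_eq, h.fastCorrection_eq_fastInt hz x₀ ht, h1]
    congr 1
    refine intervalIntegral.integral_congr fun s hs => ?_
    rw [uIcc_of_ge ht] at hs
    exact congrArg (fun w => sys.F w + sys.linTerm γ z x₀ (sys.fastCorrection γ z x₀) s)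
      (h.fastCorrection_eq_fastInt hz x₀ hs.2).symm

theorem eq_fastInt_of_isFastCorrection (h : sys.IsRegular γ γf K K' C₁) (hz : IsGoodNoise γ z)
    {y : ℝ → Euc n₂} (hy : sys.IsFastCorrection γ z x₀ y) {t : ℝ} (ht : t ≤ 0) :
    y t = fastInt sys.F (sys.linTerm γ z x₀ y) t := by
  obtain ⟨hyw, -, hyi⟩ := hy
  obtain ⟨hyc, C, hyb⟩ := inWeighted_neg_iff.1 hyw
  obtain ⟨C', hC'⟩ := h.bounded_linTerm (z := z) (x₀ := x₀) hyb
  exact hC'.eq_fastInt h.decay h.gap' (h.aestronglyMeasurable_linTerm hz hyc)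
    (fun s hs => h.continuousWithinAt_linTerm hz hyc hs) hyc hyb hyi ht

theorem eqOn_of_isFastCorrection (h : sys.IsRegular γ γf K K' C₁) (hz : IsGoodNoise γ z)
    {y : ℝ → Euc n₂} (hy : sys.IsFastCorrection γ z x₀ y) :
    EqOn y (sys.fastCorrection γ z x₀) (Iic 0) := by
  have hLP := h.isLPSystem_lin hz x₀ h.γ_pos le_rfl
  obtain ⟨hyc, C, hyb⟩ := inWeighted_neg_iff.1 hy.1
  have hu : MemWeighted γ (fun t => ((0 : Euc n₁), y t)) :=
    memWeighted_prodMk (C := 0) aestronglyMeasurable_const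
      (hyc.aestronglyMeasurable measurableSet_Iic) (fun s _ => by simp) hyb
  have := hLP.unique (x₀ := 0) hu (hLP.memWeighted_solution 0) (fun t ht => ?_)
    (hLP.solution_eq 0)
  · exact fun t ht => congrArg Prod.snd (this ht)
  · refine Prod.ext (by simp [lpOperator]) ?_
    refine (h.eq_fastInt_of_isFastCorrection hz hy ht).trans (fastInt_congr (fun s _ => ?_) ht)
    exact h.linTerm_eq y s

theorem isFastCorrection_y1 (h : sys.IsRegular γ γf K K' C₁) (hz : IsGoodNoise γ z)
    (x₀ : Euc n₁) : sys.IsFastCorrection γ z x₀ (sys.y1 γ z x₀) :=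
  Classical.epsilon_spec (p := sys.IsFastCorrection γ z x₀)
    ⟨_, h.isFastCorrection_fastCorrection hz x₀⟩

theorem y1_unique (h : sys.IsRegular γ γf K K' C₁) (hz : IsGoodNoise γ z)
    {y : ℝ → Euc n₂} (hy : sys.IsFastCorrection γ z x₀ y) : EqOn y (sys.y1 γ z x₀) (Iic 0) :=
  (h.eqOn_of_isFastCorrection hz hy).trans
    (h.eqOn_of_isFastCorrection hz (h.isFastCorrection_y1 hz x₀)).symm

theorem bounded_y1 (h : sys.IsRegular γ γf K K' C₁) (hz : IsGoodNoise γ z) {r : ℝ}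
    (hr : ‖x₀‖ ≤ r) (hβ : 0 < β) (hβγ : β ≤ γ) :
    ExpBounded β (K * ((‖sys.S‖ * r + C₁) / β) / (-(β + γf)) / (1 - K / (-(β + γf))))
      (sys.y1 γ z x₀) := fun s hs => by
  rw [h.eqOn_of_isFastCorrection hz (h.isFastCorrection_y1 hz x₀) hs]
  exact h.bounded_fastCorrection hz hr hβ hβγ s hs

theorem continuousOn_y1 (h : sys.IsRegular γ γf K K' C₁) (hz : IsGoodNoise γ z)
    (x₀ : Euc n₁) : ContinuousOn (sys.y1 γ z x₀) (Iic 0) :=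
  (h.isFastCorrection_y1 hz x₀).1.1

theorem y1_eq_fastInt (h : sys.IsRegular γ γf K K' C₁) (hz : IsGoodNoise γ z) (x₀ : Euc n₁)
    {t : ℝ} (ht : t ≤ 0) :
    sys.y1 γ z x₀ t = fastInt sys.F (sys.linTerm γ z x₀ (sys.y1 γ z x₀)) t :=
  h.eq_fastInt_of_isFastCorrection hz (h.isFastCorrection_y1 hz x₀) ht

theorem h1_eq (h : sys.IsRegular γ γf K K' C₁) (hz : IsGoodNoise γ z) (x₀ : Euc n₁) :
    sys.h1 γ z x₀ = sys.y1 γ z x₀ 0 := by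
  rw [h.y1_eq_fastInt hz x₀ le_rfl, h1, h1Integral_eq]

end IsRegular

end SlowFastSystem

/-! ### Variation of constants for commuting coefficients -/

section Commuting

variable {V : Type*} [NormedAddCommGroup V] [NormedSpace ℝ V] [CompleteSpace V]

/-- Left and right multiplication by `X` are continuous linear maps, hence pass through the
integral. -/
theorem commute_intervalIntegral {X : V →L[ℝ] V} {A : ℝ → V →L[ℝ] V} {a b : ℝ}
    (hA : IntervalIntegrable A volume a b) (hc : ∀ s ∈ uIcc a b, Commute X (A s)) :
    Commute X (∫ s in a..b, A s) := by
  have h1 := (ContinuousLinearMap.mul ℝ (V →L[ℝ] V) X).intervalIntegral_comp_comm hA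
  have h2 := ((ContinuousLinearMap.mul ℝ (V →L[ℝ] V)).flip X).intervalIntegral_comp_comm hA
  simp only [ContinuousLinearMap.mul_apply', ContinuousLinearMap.flip_apply] at h1 h2
  rw [Commute, SemiconjBy, ← h1, ← h2]
  exact intervalIntegral.integral_congr fun s hs => hc s hs

/-- By commutativity `exp (B r) = exp (B t) exp (B r - B t)`, so only the derivative of `exp` at
zero, the identity, is needed. -/
theorem hasDerivWithinAt_exp_of_commute {B : ℝ → V →L[ℝ] V} {B' : V →L[ℝ] V} {t : ℝ} {s : Set ℝ}
    (hB : HasDerivWithinAt B B' s t) (hc : ∀ᶠ r in 𝓝[s] t, Commute (B t) (B r)) :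
    HasDerivWithinAt (fun r => NormedSpace.exp (B r)) (NormedSpace.exp (B t) * B') s t := by
  let _ : NormedAlgebra ℚ (V →L[ℝ] V) := NormedAlgebra.restrictScalars ℚ ℝ _
  have h0 : HasFDerivAt (NormedSpace.exp : (V →L[ℝ] V) → V →L[ℝ] V)
      (1 : (V →L[ℝ] V) →L[ℝ] V →L[ℝ] V) (B t - B t) := by
    rw [sub_self]
    exact hasFDerivAt_exp_zero (𝕂 := ℝ)
  have h1 := (h0.comp_hasDerivWithinAt t (hB.sub_const (B t))).const_mul (NormedSpace.exp (B t))
  refine HasDerivWithinAt.congr_of_eventuallyEq h1 (hc.mono fun r hr => ?_) ?_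
  · simp only [Function.comp_apply]
    rw [← NormedSpace.exp_add_of_commute (hr.sub_right (Commute.refl _))]
    simp
  · simp

/-- With `B(t) = tF + ∫_0^t A`, all values of `B` commute, so `e^{-B}` is an integrating factor: `w
= e^{-B} y` has right derivative `e^{-B} f`. Integrating and multiplying by `e^{B(t)}` gives the
formula. -/
theorem variation_of_constants_of_commute {F : V →L[ℝ] V} {A : ℝ → V →L[ℝ] V} {f y : ℝ → V}
    (hA : ∀ a ≤ 0, ∀ b ≤ 0, IntervalIntegrable A volume a b)
    (hAr : ∀ t < 0, ContinuousWithinAt A (Ici t) t)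
    (hAA : ∀ s ≤ 0, ∀ t ≤ 0, Commute (A s) (A t)) (hFA : ∀ s ≤ 0, Commute F (A s))
    (hf : ∀ a ≤ 0, IntervalIntegrable f volume 0 a)
    (hy : ContinuousOn y (Iic 0))
    (hy' : ∀ t < 0, HasDerivWithinAt y (F (y t) + (f t + A t (y t))) (Ici t) t)
    {t : ℝ} (ht : t ≤ 0) :
    y t = NormedSpace.exp (t • F + ∫ s in (0 : ℝ)..t, A s) (y 0) +
      ∫ s in (0 : ℝ)..t, NormedSpace.exp ((t - s) • F + ∫ u in s..t, A u) (f s) := by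
  let _ : NormedAlgebra ℚ (V →L[ℝ] V) := NormedAlgebra.restrictScalars ℚ ℝ _
  set B : ℝ → V →L[ℝ] V := fun t => t • F + ∫ s in (0 : ℝ)..t, A s with hB
  have hAI : ∀ r ≤ 0, ∀ s ≤ 0, Commute (A r) (∫ u in (0 : ℝ)..s, A u) := fun r hr s hs =>
    commute_intervalIntegral (hA 0 le_rfl s hs) fun u hu => hAA r hr u (by
      rw [uIcc_of_ge hs] at hu; exact hu.2)
  have hFI : ∀ s ≤ 0, Commute F (∫ u in (0 : ℝ)..s, A u) := fun s hs =>
    commute_intervalIntegral (hA 0 le_rfl s hs) fun u hu => hFA u (by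
      rw [uIcc_of_ge hs] at hu; exact hu.2)
  have hII : ∀ r ≤ 0, ∀ s ≤ 0, Commute (∫ u in (0 : ℝ)..r, A u) (∫ u in (0 : ℝ)..s, A u) :=
    fun r hr s hs => commute_intervalIntegral (hA 0 le_rfl s hs) fun u hu =>
      (hAI u (by rw [uIcc_of_ge hs] at hu; exact hu.2) r hr).symm
  have hBB : ∀ r ≤ 0, ∀ s ≤ 0, Commute (B r) (B s) := fun r hr s hs =>
    ((((Commute.refl F).smul_left r).smul_right s).add_right ((hFI s hs).smul_left r)).add_left
      ((((hFI r hr).symm).smul_right s).add_right (hII r hr s hs))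
  have hBc : ContinuousOn B (Iic 0) := (continuous_id.smul continuous_const).continuousOn.add
    (continuousOn_primitive_Iic fun a ha => hA a ha 0 le_rfl)
  have hB' : ∀ s < 0, HasDerivWithinAt B (F + A s) (Ici s) s := fun s hs => by
    have := ((hasDerivAt_id s).smul_const F).hasDerivWithinAt (s := Ici s)
    rw [one_smul] at this
    exact this.add (hasDerivWithinAt_primitive (fun a ha => hA a ha 0 le_rfl) hs (hAr s hs))
  set w : ℝ → V := fun s => NormedSpace.exp (-B s) (y s) with hw
  have hec : ContinuousOn (fun s => NormedSpace.exp (-B s)) (Iic 0) :=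
    NormedSpace.exp_continuous.comp_continuousOn hBc.neg
  have hwc : ContinuousOn w (Iic 0) := hec.clm_apply hy
  have hw' : ∀ s < 0, HasDerivWithinAt w (NormedSpace.exp (-B s) (f s)) (Ici s) s := fun s hs => by
    have hcm : ∀ᶠ r in 𝓝[Ici s] s, Commute (-B s) (-B r) := by
      filter_upwards [mem_nhdsWithin_of_mem_nhds (Iic_mem_nhds hs)] with r hr
      exact ((hBB s hs.le r hr).neg_left).neg_right
    have h1 := (hasDerivWithinAt_exp_of_commute (hB' s hs).neg hcm).clm_apply (hy' s hs)
    convert! h1 using 1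
    have e : (NormedSpace.exp (-B s) * -(F + A s)) (y s) =
        -(NormedSpace.exp (-B s) (F (y s)) + NormedSpace.exp (-B s) (A s (y s))) := by
      rw [← map_add, ← map_neg]
      rfl
    change _ = (NormedSpace.exp (-B s) * -(F + A s)) (y s) +
      NormedSpace.exp (-B s) (F (y s) + (f s + A s (y s)))
    rw [e, map_add, map_add]
    abel
  have hsub : uIcc 0 t ⊆ Iic 0 := fun s hs => by rw [uIcc_of_ge ht] at hs; exact hs.2
  have hint : IntervalIntegrable (fun s => NormedSpace.exp (-B s) (f s)) volume 0 t := by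
    rw [intervalIntegrable_iff]
    have hfi := intervalIntegrable_iff.1 (hf t ht)
    obtain ⟨M, hM⟩ := isCompact_uIcc.exists_bound_of_continuousOn (hec.mono hsub)
    refine Integrable.mono' (hfi.norm.const_mul M) ?_ ?_
    · exact (isBoundedBilinearMap_apply (𝕜 := ℝ)).continuous.comp_aestronglyMeasurable
        ((((hec.mono (uIoc_subset_uIcc.trans hsub)).aestronglyMeasurable
          measurableSet_uIoc)).prodMk hfi.aestronglyMeasurable)
    · filter_upwards [ae_restrict_mem measurableSet_uIoc] with s hs
      exact (ContinuousLinearMap.le_opNorm _ _).trans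
        (mul_le_mul_of_nonneg_right (hM s (uIoc_subset_uIcc hs)) (norm_nonneg _))
  have hFTC : ∫ s in (0 : ℝ)..t, NormedSpace.exp (-B s) (f s) = w t - w 0 :=
    intervalIntegral.integral_eq_sub_of_hasDeriv_right (hwc.mono hsub) (fun s hs => by
      rw [min_eq_right ht, max_eq_left ht] at hs
      exact (hw' s hs.2).mono Ioi_subset_Ici_self) hint
  have hw0 : w 0 = y 0 := by simp [hw, hB]
  have hyt : y t = NormedSpace.exp (B t) (w t) := by
    have : NormedSpace.exp (B t) * NormedSpace.exp (-B t) = 1 := by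
      rw [← NormedSpace.exp_add_of_commute (Commute.refl (B t)).neg_right, add_neg_cancel,
        NormedSpace.exp_zero]
    exact (congrArg (fun T : V →L[ℝ] V => T (y t)) this).symm
  rw [hyt, ← sub_add_cancel (w t) (w 0), ← hFTC, map_add, hw0, add_comm,
    ← ContinuousLinearMap.intervalIntegral_comp_comm _ hint]
  congr 1
  refine intervalIntegral.integral_congr fun s hs => ?_
  have hs0 := hsub hs
  have e1 : (t - s) • F + ∫ u in s..t, A u = B t + -B s := by
    rw [← intervalIntegral.integral_interval_sub_left (hA 0 le_rfl t ht) (hA 0 le_rfl s hs0), hB]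
    simp only [sub_smul]
    abel
  rw [e1, NormedSpace.exp_add_of_commute (hBB t ht s hs0).neg_right]
  rfl

end Commuting

namespace SlowFastSystem

variable {n₁ n₂ : ℕ} {sys : SlowFastSystem n₁ n₂}
  {γ γf K K' C₁ ε β : ℝ} {z : ℝ → Euc n₂} {x₀ : Euc n₁}

namespace IsRegular

theorem y1_eq_of_commute (h : sys.IsRegular γ γf K K' C₁) (hz : IsGoodNoise γ z) (x₀ : Euc n₁)
    (hAA : ∀ y y', Commute (sys.g2y (x₀, y)) (sys.g2y (x₀, y')))
    (hFA : ∀ y, Commute sys.F (sys.g2y (x₀, y))) {t : ℝ} (ht : t ≤ 0) :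
    sys.y1 γ z x₀ t =
      NormedSpace.exp (t • sys.F +
          ∫ s in (0 : ℝ)..t, sys.g2y (sys.basePoint γ z x₀ s)) (sys.h1 γ z x₀) +
      ∫ s in (0 : ℝ)..t,
        NormedSpace.exp ((t - s) • sys.F +
            ∫ u in s..t, sys.g2y (sys.basePoint γ z x₀ u))
          (sys.g2x (sys.basePoint γ z x₀ s) (sys.x1 γ z x₀ s)) := by
  have hyc := h.continuousOn_y1 hz x₀
  have hyb := h.bounded_y1 hz (x₀ := x₀) le_rfl h.γ_pos le_rfl
  obtain ⟨C, hC⟩ := h.bounded_linTerm (z := z) (x₀ := x₀) hyb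
  have hm := h.aestronglyMeasurable_linTerm (x₀ := x₀) hz hyc
  have hcont : Continuous (fun p => sys.g2y p) := by
    simp_rw [h.g2y_eq]
    exact h.continuous_fderiv.clm_comp continuous_const
  have hAb : ExpBounded 0 K (fun s => sys.g2y (sys.basePoint γ z x₀ s)) := fun s _ => by
    rw [neg_zero, zero_mul, Real.exp_zero, mul_one]
    refine ContinuousLinearMap.opNorm_le_bound _ h.K_pos.le fun b => ?_
    beta_reduce
    rw [h.g2y_eq]
    simpa using h.norm_fderiv_le (sys.basePoint γ z x₀ s) 0 b
  have hfe : ∀ s, sys.g2x (sys.basePoint γ z x₀ s) (sys.x1 γ z x₀ s) =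
      sys.linField γ z x₀ s 0 := fun s => h.g2x_apply _ _
  have hfb : ExpBounded γ (K * ((‖sys.S‖ * ‖x₀‖ + C₁) / γ))
      (fun s => sys.g2x (sys.basePoint γ z x₀ s) (sys.x1 γ z x₀ s)) := fun s hs => by
    beta_reduce
    rw [hfe]
    refine (h.norm_fderiv_le _ _ _).trans ?_
    rw [mul_assoc]
    refine mul_le_mul_of_nonneg_left ?_ h.K_pos.le
    simpa using h.bounded_x1 le_rfl h.γ_pos s hs
  have hfm : AEStronglyMeasurable (fun s => sys.g2x (sys.basePoint γ z x₀ s) (sys.x1 γ z x₀ s))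
      (volume.restrict (Iic 0)) := by
    simp_rw [hfe]
    exact h.aestronglyMeasurable_linField hz x₀ (u := fun _ => 0) aestronglyMeasurable_const
  rw [h.h1_eq hz]
  refine variation_of_constants_of_commute (fun a ha b hb => hAb.intervalIntegrable
    (hcont.comp_aestronglyMeasurable (h.aestronglyMeasurable_basePoint hz x₀)) ha hb)
    (fun s hs => hcont.continuousAt.comp_continuousWithinAt
      (h.continuousWithinAt_basePoint hz x₀ hs)) (fun s _ t _ => hAA _ _) (fun s _ => hFA _)
    (fun a ha => hfb.intervalIntegrable hfm le_rfl ha) hyc (fun s hs => ?_) ht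
  have h1 := hC.hasDerivWithinAt_fastInt h.decay h.gap' hm hs
    (h.continuousWithinAt_linTerm hz hyc hs)
  rw [← h.y1_eq_fastInt hz x₀ hs.le] at h1
  refine h1.congr_of_eventuallyEq ?_ (h.y1_eq_fastInt hz x₀ hs.le)
  filter_upwards [mem_nhdsWithin_of_mem_nhds (Iic_mem_nhds hs)] with r hr
  exact h.y1_eq_fastInt hz x₀ hr

end IsRegular

end SlowFastSystem

namespace SlowFastSystem

variable {n₁ n₂ : ℕ} {sys : SlowFastSystem n₁ n₂}
  {γ γf K K' C₁ ε β : ℝ} {z : ℝ → Euc n₂} {x₀ : Euc n₁}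

namespace IsRegular

/-! ### The first-order expansion -/

/-- The first-order approximation `(x₀ + ε x¹, y⁰ + ε y¹)` of the orbit. -/
def approx (sys : SlowFastSystem n₁ n₂) (γ ε : ℝ) (z : ℝ → Euc n₂) (x₀ : Euc n₁) (s : ℝ) :
    Euc n₁ × Euc n₂ :=
  (x₀ + ε • sys.x1 γ z x₀ s, sys.y0 γ z x₀ s + ε • sys.y1 γ z x₀ s)

theorem memWeighted_approx (h : sys.IsRegular γ γf K K' C₁) (hz : IsGoodNoise γ z) (x₀ : Euc n₁)
    (ε : ℝ) : MemWeighted γ (approx sys γ ε z x₀) := by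
  obtain ⟨C0, hC0⟩ := h.bounded_y0 hz x₀
  have hy1 := h.bounded_y1 hz (x₀ := x₀) le_rfl h.γ_pos le_rfl
  have hx1 := h.bounded_x1 (z := z) (x₀ := x₀) le_rfl h.γ_pos
  have c1 : ContinuousOn (fun s => x₀ + ε • sys.x1 γ z x₀ s) (Iic 0) :=
    continuousOn_const.add ((h.continuousOn_x1 hz x₀).const_smul ε)
  have c2 : ContinuousOn (fun s => sys.y0 γ z x₀ s + ε • sys.y1 γ z x₀ s) (Iic 0) :=
    (h.continuousOn_y0 hz x₀).add ((h.continuousOn_y1 hz x₀).const_smul ε)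
  refine memWeighted_prodMk (C := ‖x₀‖ + |ε| * ((‖sys.S‖ * ‖x₀‖ + C₁) / γ))
    (C' := C0 + |ε| * (K * ((‖sys.S‖ * ‖x₀‖ + C₁) / γ) / (-(γ + γf)) / (1 - K / (-(γ + γf)))))
    (c1.aestronglyMeasurable measurableSet_Iic)
    (c2.aestronglyMeasurable measurableSet_Iic) (fun s hs => ?_) (fun s hs => ?_)
  · have h1 : 1 ≤ Real.exp (-γ * s) := Real.one_le_exp (by nlinarith [h.γ_pos])
    have h2 := mul_le_mul_of_nonneg_left h1 (norm_nonneg x₀)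
    have h3 := mul_le_mul_of_nonneg_left (hx1 s hs) (abs_nonneg ε)
    refine (norm_add_le _ _).trans ?_
    rw [norm_smul, Real.norm_eq_abs, add_mul, mul_assoc |ε|]
    linarith
  · have h3 := mul_le_mul_of_nonneg_left (hy1 s hs) (abs_nonneg ε)
    refine (norm_add_le _ _).trans ?_
    rw [norm_smul, Real.norm_eq_abs, add_mul, mul_assoc |ε|]
    exact add_le_add (hC0 s hs) h3

/-- The constant in the remainder estimate. -/
def remainderConst (sys : SlowFastSystem n₁ n₂) (γ γf K K' X Y : ℝ) : ℝ :=
  (‖sys.S‖ * X + K * (X + Y)) / γ + K' * (X + Y) ^ 2 / (-(γ + γf))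

/-- The equations of `y⁰`, `x¹` and `y¹` cancel the terms of order 0 and 1. In the slow component,
`ε` times a Lipschitz increment of size `ε` remains; in the fast one, the Taylor remainder of `g₂`.
-/
theorem sumNorm_lpOperator_approx_le (h : sys.IsRegular γ γf K K' C₁) (hε : 0 ≤ ε)
    (hc : ε * (‖sys.S‖ + K) / γ + K / (-(γ + γf)) < 1) (hz : IsGoodNoise γ z) {X Y : ℝ}
    (hX : ExpBounded (γ / 2) X (sys.x1 γ z x₀)) (hY : ExpBounded (γ / 2) Y (sys.y1 γ z x₀))
    {t : ℝ} (ht : t ≤ 0) :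
    sumNorm (lpOperator sys.F (sys.slowField ε z) (sys.fastField z) x₀ (approx sys γ ε z x₀) t -
      approx sys γ ε z x₀ t) ≤
      remainderConst sys γ γf K K' X Y * ε ^ 2 * Real.exp (-γ * t) := by
  have hLP := h.isLPSystem hε hc hz
  have hv := h.memWeighted_approx hz x₀ ε
  have hX0 := hX.nonneg
  have hY0 := hY.nonneg
  have hK := h.K_pos
  obtain ⟨C₂, hC₂⟩ := hLP.bounded₁ hv
  obtain ⟨C₃, hC₃⟩ := hLP.bounded₂ hv
  have hi1 := hC₂.intervalIntegrable (hLP.meas₁ _ hv.1) le_rfl ht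
  -- slow component
  have b1 : ExpBounded γ (ε ^ 2 * (‖sys.S‖ * X + K * (X + Y))) (fun s =>
      sys.slowField ε z s (approx sys γ ε z x₀ s) -
        ε • (sys.S x₀ + sys.g₁ (sys.basePoint γ z x₀ s))) := by
    have : ExpBounded (γ / 2) (ε ^ 2 * (‖sys.S‖ * X + K * (X + Y))) (fun s =>
      sys.slowField ε z s (approx sys γ ε z x₀ s) -
        ε • (sys.S x₀ + sys.g₁ (sys.basePoint γ z x₀ s))) := fun s hs => by
      have e1 := h.lip₁ (x₀ + ε • sys.x1 γ z x₀ s)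
        (sys.y0 γ z x₀ s + ε • sys.y1 γ z x₀ s + z s) x₀ (sys.y0 γ z x₀ s + z s)
      rw [add_sub_cancel_left, add_sub_add_right_eq_sub, add_sub_cancel_left, norm_smul, norm_smul,
        Real.norm_of_nonneg hε] at e1
      have e2 : ‖sys.S (x₀ + ε • sys.x1 γ z x₀ s) - sys.S x₀‖ ≤
          ‖sys.S‖ * (ε * ‖sys.x1 γ z x₀ s‖) := by
        rw [← map_sub, add_sub_cancel_left]
        refine (sys.S.le_opNorm _).trans_eq ?_
        rw [norm_smul, Real.norm_of_nonneg hε]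
      beta_reduce
      rw [slowField, ← smul_sub, norm_smul, Real.norm_of_nonneg hε, add_sub_add_comm, pow_two,
        mul_assoc, mul_assoc]
      refine mul_le_mul_of_nonneg_left ?_ hε
      refine ((norm_add_le _ _).trans (add_le_add e2 e1)).trans ?_
      have a1 := mul_le_mul_of_nonneg_left (hX s hs) hε
      have a2 := mul_le_mul_of_nonneg_left (hY s hs) hε
      have a3 := mul_le_mul_of_nonneg_left a1 (norm_nonneg sys.S)
      have a4 := mul_le_mul_of_nonneg_left (add_le_add a1 a2) hK.le
      refine (add_le_add a3 a4).trans_eq ?_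
      ring
    exact this.mono (by linarith [h.γ_pos]) le_rfl
  have hi2 : IntervalIntegrable (fun s => ε • (sys.S x₀ + sys.g₁ (sys.basePoint γ z x₀ s)))
      volume 0 t :=
    (intervalIntegrable_const.add (h.intervalIntegrable_g₁ hz x₀ le_rfl ht)).smul ε
  have s1 : (lpOperator sys.F (sys.slowField ε z) (sys.fastField z) x₀
      (approx sys γ ε z x₀) t - approx sys γ ε z x₀ t).1 = ∫ s in (0 : ℝ)..t,
      (sys.slowField ε z s (approx sys γ ε z x₀ s) -
        ε • (sys.S x₀ + sys.g₁ (sys.basePoint γ z x₀ s))) := by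
    rw [intervalIntegral.integral_sub hi1 hi2, intervalIntegral.integral_smul,
      ← h.x1_eq_integral hz x₀ ht]
    simp [lpOperator, approx]
  have t1 := b1.norm_integral_le h.γ_pos ht
  rw [← s1] at t1
  -- fast component
  have hbase : ∀ s, sys.fastField z s (approx sys γ ε z x₀ s) =
      sys.g₂ (sys.basePoint γ z x₀ s + ε • (sys.x1 γ z x₀ s, sys.y1 γ z x₀ s)) := fun s => by
    simp only [fastField, approx, basePoint, Prod.smul_mk, Prod.mk_add_mk, add_right_comm]
  have b2 : ExpBounded γ (K' * (X + Y) ^ 2 * ε ^ 2) (fun s =>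
      sys.fastField z s (approx sys γ ε z x₀ s) - (sys.g₂ (sys.basePoint γ z x₀ s) +
        ε • sys.linTerm γ z x₀ (sys.y1 γ z x₀) s)) := fun s hs => by
    have e1 := norm_sub_sub_fderiv_le h.diff₂ h.deriv_lip h.K'_nonneg (sys.basePoint γ z x₀ s)
      (ε • (sys.x1 γ z x₀ s, sys.y1 γ z x₀ s))
    beta_reduce
    rw [hbase, linTerm, h.g2x_add_g2y, ← map_smul, ← sub_sub]
    refine e1.trans ?_
    have e2 : ‖ε • (sys.x1 γ z x₀ s, sys.y1 γ z x₀ s)‖ ≤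
        ε * ((X + Y) * Real.exp (-(γ / 2) * s)) := by
      rw [norm_smul, Real.norm_of_nonneg hε]
      refine mul_le_mul_of_nonneg_left ((norm_le_sumNorm _).trans ?_) hε
      rw [add_mul]
      exact add_le_add (hX s hs) (hY s hs)
    -- This is the reason for the weight `γ/2`: the quadratic Taylor remainder lands exactly in the
    -- weight `γ`.
    have e3 : Real.exp (-γ * s) = Real.exp (-(γ / 2) * s) ^ 2 := by
      rw [← Real.exp_nat_mul]; congr 1; push_cast; ring
    rw [e3]
    refine (mul_le_mul_of_nonneg_left (pow_le_pow_left₀ (norm_nonneg _) e2 2)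
      h.K'_nonneg).trans_eq ?_
    ring
  have hy0 := h.isCriticalFast_y0 hz x₀
  have hbm : AEStronglyMeasurable (fun s => sys.g₂ (sys.basePoint γ z x₀ s))
      (volume.restrict (Iic 0)) :=
    h.diff₂.continuous.comp_aestronglyMeasurable (h.aestronglyMeasurable_basePoint hz x₀)
  have hlm := h.aestronglyMeasurable_linTerm (x₀ := x₀) hz (h.continuousOn_y1 hz x₀)
  obtain ⟨C₄, hC₄⟩ := h.bounded_linTerm (z := z) (x₀ := x₀)
    (h.bounded_y1 hz (x₀ := x₀) le_rfl h.γ_pos le_rfl)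
  have hi3 := hC₃.integrableOn_fast h.decay h.gap' (hLP.meas₂ _ hv.1) ht
  have hi4 : IntegrableOn (fun s => linFlow sys.F (t - s) (sys.g₂ (sys.basePoint γ z x₀ s)))
    (Iic t) := (hy0.2 t ht).1
  have hi5 := hC₄.integrableOn_fast h.decay h.gap' hlm ht
  have s2 : (lpOperator sys.F (sys.slowField ε z) (sys.fastField z) x₀
      (approx sys γ ε z x₀) t - approx sys γ ε z x₀ t).2 = fastInt sys.F (fun s =>
      sys.fastField z s (approx sys γ ε z x₀ s) - (sys.g₂ (sys.basePoint γ z x₀ s) +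
        ε • sys.linTerm γ z x₀ (sys.y1 γ z x₀) s)) t := by
    have e : fastInt sys.F (fun s =>
      sys.fastField z s (approx sys γ ε z x₀ s) - (sys.g₂ (sys.basePoint γ z x₀ s) +
        ε • sys.linTerm γ z x₀ (sys.y1 γ z x₀) s)) t =
      fastInt sys.F (fun s => sys.fastField z s (approx sys γ ε z x₀ s)) t -
        (fastInt sys.F (fun s => sys.g₂ (sys.basePoint γ z x₀ s)) t +
          ε • fastInt sys.F (sys.linTerm γ z x₀ (sys.y1 γ z x₀)) t) := by
      simp only [fastInt, map_sub, map_add, map_smul]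
      rw [integral_sub hi3, integral_add hi4, integral_smul]
      · exact hi5.smul ε
      · exact hi4.add (hi5.smul ε)
    rw [e, ← h.y0_eq_fastInt hz x₀ ht, ← h.y1_eq_fastInt hz x₀ ht]
    simp [lpOperator, approx]
  have t2 := b2.norm_fastInt_le h.decay h.gap' ht
  rw [← s2] at t2
  refine (add_le_add t1 t2).trans_eq ?_
  rw [remainderConst]
  ring

theorem norm_orbit_sub_le (h : sys.IsRegular γ γf K K' C₁) (hε : 0 ≤ ε)
    (hc : ε * (‖sys.S‖ + K) / γ + K / (-(γ + γf)) < 1) (hz : IsGoodNoise γ z) {X Y : ℝ}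
    (hX : ExpBounded (γ / 2) X (sys.x1 γ z x₀)) (hY : ExpBounded (γ / 2) Y (sys.y1 γ z x₀)) :
    ‖(sys.orbit ε z x₀ 0).2 - (sys.h0 γ z x₀ + ε • sys.h1 γ z x₀)‖ ≤
      remainderConst sys γ γf K K' X Y * ε ^ 2 /
        (1 - (ε * (‖sys.S‖ + K) / γ + K / (-(γ + γf)))) := by
  have hLP := h.isLPSystem hε hc hz
  have h1 := hLP.stability (hLP.memWeighted_solution x₀) (h.memWeighted_approx hz x₀ ε)
    (hLP.solution_eq x₀) (fun t ht => h.sumNorm_lpOperator_approx_le hε hc hz hX hY ht)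
    (t := 0) le_rfl
  rw [mul_zero, Real.exp_zero, mul_one] at h1
  refine le_trans ?_ h1
  rw [h.h0_eq hz, h.h1_eq hz]
  exact le_add_of_nonneg_left (norm_nonneg _)

/-- The bounds `X`, `Y` depend on `x₀` only through `r` and not on `z`, and `q` keeps `1 - ratio`
away from zero. Hence one constant serves for all `ε`, all noise paths and all `‖x₀‖ ≤ r`. -/
theorem exists_remainder_bound (h : sys.IsRegular γ γf K K' C₁) {q : ℝ} (hq : q < 1) (r : ℝ) :
    ∃ C, ∀ ε, 0 ≤ ε → ε * (‖sys.S‖ + K) / γ + K / (-(γ + γf)) ≤ q →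
      ∀ z : ℝ → Euc n₂, IsGoodNoise γ z → ∀ x₀ : Euc n₁, ‖x₀‖ ≤ r →
        ‖(sys.orbit ε z x₀ 0).2 - (sys.h0 γ z x₀ + ε • sys.h1 γ z x₀)‖ ≤ C * ε ^ 2 := by
  have hβ : 0 < γ / 2 := half_pos h.γ_pos
  have hβγ : γ / 2 ≤ γ := by linarith
  set X := (‖sys.S‖ * r + C₁) / (γ / 2) with hX
  set Y := K * X / (-(γ / 2 + γf)) / (1 - K / (-(γ / 2 + γf))) with hY
  refine ⟨remainderConst sys γ γf K K' X Y / (1 - q), fun ε hε hc z hz x₀ hx => ?_⟩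
  have hX' : ExpBounded (γ / 2) X (sys.x1 γ z x₀) := h.bounded_x1 hx hβ
  have hY' : ExpBounded (γ / 2) Y (sys.y1 γ z x₀) := h.bounded_y1 hz hx hβ hβγ
  refine (h.norm_orbit_sub_le hε (hc.trans_lt hq) hz hX' hY').trans ?_
  have hX0 := hX'.nonneg
  have hY0 := hY'.nonneg
  have hK := h.K_pos
  have hγ := h.γ_pos
  have hK' := h.K'_nonneg
  have hg : 0 < -(γ + γf) := by linarith [h.gap']
  have hR : 0 ≤ remainderConst sys γ γf K K' X Y := by
    unfold remainderConst
    positivity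
  rw [div_mul_eq_mul_div]
  exact div_le_div_of_nonneg_left (by positivity) (by linarith) (by linarith)

end IsRegular

end SlowFastSystem

/-! ### Càdlàg paths of quadratic growth -/

section Paths

variable {n : ℕ} {ℓ : ℝ → Euc n}

/-- The right endpoint of the dyadic-type mesh interval of length `1/(k+1)` containing `t`. -/
def meshPoint (k : ℕ) (t : ℝ) : ℝ := (⌊((k : ℝ) + 1) * t⌋ + 1) / ((k : ℝ) + 1)

theorem lt_meshPoint (k : ℕ) (t : ℝ) : t < meshPoint k t := by
  have hk : (0 : ℝ) < (k : ℝ) + 1 := by positivity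
  rw [meshPoint, lt_div_iff₀ hk, mul_comm]
  exact Int.lt_floor_add_one _

theorem meshPoint_le (k : ℕ) (t : ℝ) : meshPoint k t ≤ t + 1 / ((k : ℝ) + 1) := by
  have hk : (0 : ℝ) < (k : ℝ) + 1 := by positivity
  rw [meshPoint, div_le_iff₀ hk, add_mul t, one_div, inv_mul_cancel₀ hk.ne', mul_comm t]
  have := Int.floor_le (((k : ℝ) + 1) * t)
  linarith

theorem tendsto_meshPoint (t : ℝ) : Tendsto (fun k => meshPoint k t) atTop (𝓝[>] t) := by
  refine tendsto_nhdsWithin_iff.2 ⟨?_, Eventually.of_forall fun k => lt_meshPoint k t⟩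
  refine tendsto_of_tendsto_of_tendsto_of_le_of_le tendsto_const_nhds ?_
    (fun k => (lt_meshPoint k t).le) (fun k => meshPoint_le k t)
  simpa using tendsto_one_div_add_atTop_nhds_zero_nat.const_add t

/-- The right-continuous regularization of a path, a measurable functional of the path. -/
def regularize (p : ℝ → Euc n) (t : ℝ) : Euc n := limUnder atTop (fun k => p (meshPoint k t))

/-- For fixed `k` the evaluation time takes countably many values, so joint measurability reduces to
coordinate projections. Evaluation of an arbitrary path at a varying time has no such property,
whence the regularization. -/
theorem measurable_eval_meshPoint (k : ℕ) :
    Measurable fun q : (ℝ → Euc n) × ℝ => q.1 (meshPoint k q.2) := by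
  have h1 : Measurable fun q : (ℝ → Euc n) × ℤ => q.1 ((q.2 + 1) / ((k : ℝ) + 1)) :=
    measurable_from_prod_countable_left fun m =>
      measurable_pi_apply (((m : ℝ) + 1) / ((k : ℝ) + 1))
  have h2 : Measurable fun q : (ℝ → Euc n) × ℝ => (q.1, ⌊((k : ℝ) + 1) * q.2⌋) :=
    measurable_fst.prodMk (Int.measurable_floor.comp (measurable_snd.const_mul _))
  exact h1.comp h2

theorem stronglyMeasurable_regularize :
    StronglyMeasurable fun q : (ℝ → Euc n) × ℝ => regularize q.1 q.2 :=
  StronglyMeasurable.limUnder fun k => (measurable_eval_meshPoint k).stronglyMeasurable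

theorem IsCadlagPath.regularize_eq (h : IsCadlagPath ℓ) : regularize ℓ = ℓ := by
  ext1 t
  exact (((h t).1.mono Ioi_subset_Ici_self).tendsto.comp (tendsto_meshPoint t)).limUnder_eq

theorem IsCadlagPath.stronglyMeasurable (h : IsCadlagPath ℓ) : StronglyMeasurable ℓ := by
  have h1 : StronglyMeasurable fun t : ℝ => regularize ℓ t :=
    stronglyMeasurable_regularize.comp_measurable
      (f := fun q : (ℝ → Euc n) × ℝ => regularize q.1 q.2) (measurable_const.prodMk measurable_id)
  rwa [h.regularize_eq] at h1

/-- One-sided limits give a bound near each point, and compactness makes it uniform. -/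
theorem IsCadlagPath.exists_bound (h : IsCadlagPath ℓ) (a b : ℝ) :
    ∃ M, ∀ t ∈ Icc a b, ‖ℓ t‖ ≤ M := by
  refine isCompact_Icc.induction_on (p := fun s => ∃ M, ∀ t ∈ s, ‖ℓ t‖ ≤ M) ⟨0, by simp⟩
    (fun s t hst ⟨M, hM⟩ => ⟨M, fun x hx => hM x (hst hx)⟩) ?_ fun t _ => ?_
  · rintro s t ⟨M, hM⟩ ⟨M', hM'⟩
    refine ⟨max M M', fun x hx => hx.elim (fun hx => (hM x hx).trans (le_max_left _ _))
      fun hx => (hM' x hx).trans (le_max_right _ _)⟩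
  · obtain ⟨hr, l, hl⟩ := h t
    have h1 : ∀ᶠ x in 𝓝[≥] t, ‖ℓ x‖ < ‖ℓ t‖ + 1 :=
      hr.norm.tendsto.eventually (gt_mem_nhds (lt_add_one _))
    have h2 : ∀ᶠ x in 𝓝[<] t, ‖ℓ x‖ < ‖l‖ + 1 := hl.norm.eventually (gt_mem_nhds (lt_add_one _))
    have h3 : ∀ᶠ x in 𝓝 t, ‖ℓ x‖ ≤ max (‖ℓ t‖ + 1) (‖l‖ + 1) := by
      rw [← nhdsLT_sup_nhdsGE t]
      exact ⟨h2.mono fun x hx => hx.le.trans (le_max_right _ _),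
        h1.mono fun x hx => hx.le.trans (le_max_left _ _)⟩
    exact ⟨_, mem_nhdsWithin_of_mem_nhds h3, _, fun x hx => hx⟩

/-- Càdlàg paths of at most quadratic growth at `-∞`. -/
structure IsGoodPath (ℓ : ℝ → Euc n) : Prop where
  cadlag : IsCadlagPath ℓ
  growth : ∃ C, ∀ t ≤ 0, ‖ℓ t‖ ≤ C * (1 + t ^ 2)

theorem IsCadlagPath.comp_affine (h : IsCadlagPath ℓ) {b : ℝ} (hb : 0 < b) (a : ℝ) :
    IsCadlagPath fun s => ℓ (a + b * s) := fun t => by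
  obtain ⟨hr, l, hl⟩ := h (a + b * t)
  have hc : Tendsto (fun s => a + b * s) (𝓝 t) (𝓝 (a + b * t)) :=
    Continuous.tendsto (by fun_prop) t
  refine ⟨hr.comp (f := fun s => a + b * s) (hc.mono_left nhdsWithin_le_nhds) fun s hs => ?_, l,
    hl.comp (tendsto_nhdsWithin_iff.2 ⟨hc.mono_left nhdsWithin_le_nhds, ?_⟩)⟩
  · have : t ≤ s := hs
    simp only [mem_Ici]
    gcongr
  · filter_upwards [self_mem_nhdsWithin] with s hs
    have : s < t := hs
    simp only [mem_Iio]
    gcongr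

theorem IsGoodPath.pathShift (h : IsGoodPath ℓ) (t : ℝ) : IsGoodPath (pathShift t ℓ) := by
  refine ⟨fun s => ?_, ?_⟩
  · obtain ⟨hr, l, hl⟩ := h.cadlag.comp_affine one_pos t s
    simp only [one_mul] at hr hl
    exact ⟨hr.sub continuousWithinAt_const, l - ℓ t, hl.sub_const _⟩
  · obtain ⟨C, hC⟩ := h.growth
    -- The growth hypothesis covers only nonpositive times; for `t > 0` the shifted path also visits
    -- `[0, t]`.
    obtain ⟨M, hM⟩ := h.cadlag.exists_bound 0 t
    have hC0 : 0 ≤ C := by simpa using (norm_nonneg _).trans (hC 0 le_rfl)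
    refine ⟨2 * C * (1 + t ^ 2) + |M| + ‖ℓ t‖, fun s hs => ?_⟩
    have h1 : ‖ℓ (t + s)‖ ≤ (2 * C * (1 + t ^ 2) + |M|) * (1 + s ^ 2) := by
      rcases le_total (t + s) 0 with hts | hts
      · have e1 := hC _ hts
        have e2 : C * (1 + (t + s) ^ 2) ≤ C * (2 * (1 + t ^ 2) * (1 + s ^ 2)) :=
          mul_le_mul_of_nonneg_left (by nlinarith [sq_nonneg (t - s), sq_nonneg (t * s)]) hC0
        have e3 : 0 ≤ |M| * (1 + s ^ 2) := by positivity
        linarith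
      · have e1 := hM (t + s) ⟨hts, by linarith⟩
        have e2 := le_abs_self M
        have e3 : 0 ≤ 2 * C * (1 + t ^ 2) * (1 + s ^ 2) := by positivity
        have e4 : 0 ≤ |M| * s ^ 2 := by positivity
        linarith
    have h2 : 0 ≤ ‖ℓ t‖ * s ^ 2 := by positivity
    refine (norm_sub_le _ _).trans ?_
    linarith

theorem IsGoodPath.scale (h : IsGoodPath ℓ) {ε : ℝ} (hε : 0 < ε) (c : ℝ) :
    IsGoodPath fun s => c • ℓ (ε * s) := by
  refine ⟨fun s => ?_, ?_⟩
  · obtain ⟨hr, l, hl⟩ := h.cadlag.comp_affine hε 0 s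
    simp only [zero_add] at hr hl
    exact ⟨hr.const_smul c, c • l, hl.const_smul c⟩
  · obtain ⟨C, hC⟩ := h.growth
    have hC0 : 0 ≤ C := by simpa using (norm_nonneg _).trans (hC 0 le_rfl)
    refine ⟨|c| * (C * (1 + ε ^ 2)), fun s hs => ?_⟩
    have h1 := hC (ε * s) (mul_nonpos_of_nonneg_of_nonpos hε.le hs)
    rw [norm_smul, Real.norm_eq_abs, mul_assoc, mul_assoc]
    refine mul_le_mul_of_nonneg_left (h1.trans (mul_le_mul_of_nonneg_left ?_ hC0)) (abs_nonneg _)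
    nlinarith [sq_nonneg ε, sq_nonneg s]

theorem IsGoodPath.expBounded (h : IsGoodPath ℓ) {β : ℝ} (hβ : 0 < β) :
    ∃ C, ExpBounded β C ℓ := by
  obtain ⟨C, hC⟩ := h.growth
  have hC0 : 0 ≤ C := by simpa using (norm_nonneg _).trans (hC 0 le_rfl)
  refine ⟨C * (1 + 2 / β ^ 2), fun t ht => (hC t ht).trans ?_⟩
  rw [mul_assoc]
  refine mul_le_mul_of_nonneg_left ?_ hC0
  have h1 := Real.quadratic_le_exp_of_nonneg (x := -β * t) (by nlinarith)
  have h2 : 0 ≤ -β * t := by nlinarith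
  have h3 : t ^ 2 = 2 / β ^ 2 * ((-β * t) ^ 2 / 2) := by field_simp
  have h4 : t ^ 2 ≤ 2 / β ^ 2 * Real.exp (-β * t) := by
    rw [h3]
    exact mul_le_mul_of_nonneg_left (by linarith) (by positivity)
  have h5 : 1 ≤ Real.exp (-β * t) := Real.one_le_exp h2
  linarith

theorem IsGoodPath.aestronglyMeasurable (h : IsGoodPath ℓ) :
    AEStronglyMeasurable ℓ (volume.restrict (Iic 0)) :=
  h.cadlag.stronglyMeasurable.aestronglyMeasurable

theorem pathIntegral_linFlow (A : Euc n →L[ℝ] Euc n) (h0 : ℓ 0 = 0) (a : ℝ) :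
    pathIntegral (fun s => linFlow A (-s)) ℓ a 0 =
      (∫ s in a..0, A (linFlow A (0 - s) (ℓ s))) - linFlow A (0 - a) (ℓ a) := by
  rw [pathIntegral, h0, map_zero]
  have : ∀ s, (deriv (fun s => linFlow A (-s)) s) (ℓ s) = -(A (linFlow A (0 - s) (ℓ s))) :=
    fun s => by rw [(hasDerivAt_linFlow_neg A s).deriv, zero_sub]; rfl
  simp_rw [this, intervalIntegral.integral_neg, zero_sub]
  abel

variable {A : Euc n →L[ℝ] Euc n} {κ : ℝ}

/-- After integration by parts the boundary term at `a` decays and an absolutely convergent integral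
of the path remains. The weight `-κ/2` is an arbitrary choice in `(0, -κ)`. -/
theorem IsGoodPath.tendsto_pathIntegral (h : IsGoodPath ℓ) (h0 : ℓ 0 = 0)
    (hA : DecaysAtRate A κ) (hκ : κ < 0) :
    Tendsto (fun a => pathIntegral (fun s => linFlow A (-s)) ℓ a 0) atBot
      (𝓝 (A (fastInt A ℓ 0))) := by
  obtain ⟨C, hC⟩ := h.expBounded (β := -κ / 2) (by linarith)
  have hβ : -κ / 2 + κ < 0 := by linarith
  have hint := hC.integrableOn_fast hA hβ h.aestronglyMeasurable le_rfl
  simp_rw [pathIntegral_linFlow A h0]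
  rw [fastInt, ← ContinuousLinearMap.integral_comp_comm A hint, ← sub_zero (∫ s in Iic 0, _)]
  refine (intervalIntegral_tendsto_integral_Iic 0 (A.integrable_comp hint) tendsto_id).sub ?_
  refine squeeze_zero_norm' ((eventually_le_atBot 0).mono fun a ha =>
    hC.norm_linFlow_le hA ha ha) ?_
  have := (Real.tendsto_exp_atBot.comp
    (tendsto_id.const_mul_atBot (r := -(-κ / 2 + κ)) (by linarith))).const_mul
      (C * Real.exp (κ * 0))
  rw [mul_zero (C * Real.exp (κ * 0))] at this
  exact this

theorem IsGoodPath.ouVariable_eq (h : IsGoodPath ℓ) (h0 : ℓ 0 = 0)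
    (hA : DecaysAtRate A κ) (hκ : κ < 0) : ouVariable A ℓ = A (fastInt A ℓ 0) :=
  (h.tendsto_pathIntegral h0 hA hκ).limUnder_eq

theorem pathShift_zero (t : ℝ) : pathShift t ℓ 0 = 0 := by simp [pathShift]

/-- The constant `v` is a bounded solution of `y' = A y - A v`, so it equals the convolution of `-A
v`. -/
theorem apply_fastInt_const (hA : DecaysAtRate A κ) (hκ : κ < 0) (v : Euc n) :
    A (fastInt A (fun _ => v) 0) = -v := by
  have hβ : -κ / 2 + κ < 0 := by linarith
  have hb : ∀ w : Euc n, ExpBounded (-κ / 2) ‖w‖ (fun _ => w) := fun w s hs => by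
    have h1 : 1 ≤ Real.exp (-(-κ / 2) * s) := Real.one_le_exp (by nlinarith)
    nlinarith [norm_nonneg w]
  have h1 := (hb (-(A v))).eq_fastInt (y := fun _ => v) (y₀ := v) hA hβ aestronglyMeasurable_const
    (fun t _ => continuousWithinAt_const) continuousOn_const (hb v) (fun t _ => by simp)
    (t := 0) le_rfl
  have h2 := (hb v).integrableOn_fast hA hβ aestronglyMeasurable_const (t := 0) le_rfl
  rw [fastInt, ← ContinuousLinearMap.integral_comp_comm A h2]
  simp only [fastInt, map_neg, integral_neg, linFlow_comm] at h1
  rw [eq_neg_iff_add_eq_zero, add_comm]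
  exact eq_neg_iff_add_eq_zero.1 h1

theorem fastInt_shift (φ : ℝ → Euc n) (t : ℝ) :
    fastInt A φ t = fastInt A (fun s => φ (t + s)) 0 := by
  have h1 := (measurePreserving_add_left volume t).setIntegral_preimage_emb
    (measurableEmbedding_addLeft t) (fun s => linFlow A (t - s) (φ s)) (Iic t)
  rw [fastInt, fastInt, ← h1]
  simp

/-- The shifted path is a translate minus the constant `ℓ t`, and that constant contributes `+ ℓ t`
by `apply_fastInt_const`. -/
theorem IsGoodPath.apply_fastInt_pathShift (h : IsGoodPath ℓ)
    (hA : DecaysAtRate A κ) (hκ : κ < 0) {t : ℝ} (ht : t ≤ 0) :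
    A (fastInt A (_root_.pathShift t ℓ) 0) = ℓ t + A (fastInt A ℓ t) := by
  have hβ : -κ / 2 + κ < 0 := by linarith
  obtain ⟨C, hC⟩ := h.expBounded (β := -κ / 2) (by linarith)
  have hb : ExpBounded (-κ / 2) ‖ℓ t‖ (fun _ => ℓ t) := fun s hs => by
    have h1 : 1 ≤ Real.exp (-(-κ / 2) * s) := Real.one_le_exp (by nlinarith)
    nlinarith [norm_nonneg (ℓ t)]
  have hs : ExpBounded (-κ / 2) (C * Real.exp (-(-κ / 2) * t)) (fun s => ℓ (t + s)) :=
    fun s hs => by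
      refine (hC (t + s) (by linarith)).trans_eq ?_
      rw [mul_add, Real.exp_add]; ring
  have hm : AEStronglyMeasurable (fun s => ℓ (t + s)) (volume.restrict (Iic 0)) :=
    (h.cadlag.stronglyMeasurable.comp_measurable (measurable_const_add t)).aestronglyMeasurable
  have e : fastInt A (_root_.pathShift t ℓ) 0 = fastInt A ℓ t - fastInt A (fun _ => ℓ t) 0 := by
    rw [fastInt_shift ℓ t, fastInt_sub hs hb hA hβ hm aestronglyMeasurable_const le_rfl]
    rfl
  rw [e, map_sub, apply_fastInt_const hA hκ]
  abel

theorem DecaysAtRate.inv_smul (hA : DecaysAtRate A κ) {ε : ℝ} (hε : 0 < ε) :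
    DecaysAtRate (ε⁻¹ • A) (ε⁻¹ * κ) := fun t ht y => by
  rw [linFlow_smul]
  refine (hA (t * ε⁻¹) (by positivity) y).trans_eq ?_
  rw [mul_comm t, ← mul_assoc, mul_comm κ]

theorem fastInt_inv_smul (φ : ℝ → Euc n) {ε : ℝ} (hε : 0 < ε) :
    fastInt (ε⁻¹ • A) φ 0 = ε • fastInt A (fun s => φ (ε * s)) 0 := by
  have h1 := Measure.integral_comp_mul_left
    ((Iic 0).indicator fun s => linFlow (ε⁻¹ • A) (0 - s) (φ s)) ε
  rw [integral_indicator measurableSet_Iic, abs_of_pos (by positivity)] at h1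
  have e : (fun s => (Iic 0).indicator (fun s => linFlow (ε⁻¹ • A) (0 - s) (φ s)) (ε * s)) =
      (Iic 0).indicator fun s => linFlow A (0 - s) (φ (ε * s)) := by
    ext1 s
    by_cases hs : s ≤ 0
    · have hs' : ε * s ∈ Iic (0 : ℝ) := mul_nonpos_of_nonneg_of_nonpos hε.le hs
      rw [indicator_of_mem hs', indicator_of_mem (show s ∈ Iic 0 from hs), linFlow_smul]
      congr 2
      field_simp
      ring
    · have hs' : ε * s ∉ Iic (0 : ℝ) := by
        rw [mem_Iic, not_le]
        rw [not_le] at hs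
        positivity
      rw [indicator_of_notMem hs', indicator_of_notMem (show s ∉ Iic 0 from hs)]
  rw [e, integral_indicator measurableSet_Iic] at h1
  rw [fastInt, fastInt, h1, smul_inv_smul₀ hε.ne']

end Paths

/-! ### The stationary Ornstein–Uhlenbeck path and its time change. -/

namespace SlowFastSystem

variable {n₁ n₂ : ℕ} {sys : SlowFastSystem n₁ n₂} {ℓ : ℝ → Euc n₂} {κ ε : ℝ}

theorem tendsto_xi (hℓ : IsGoodPath ℓ) (hF : DecaysAtRate sys.F κ) (hκ : κ < 0) (t : ℝ) :
    Tendsto (fun a => pathIntegral (fun s => linFlow sys.F (-s)) (pathShift t ℓ) a 0) atBot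
      (𝓝 (sys.xi ℓ t)) := by
  rw [xi, (hℓ.pathShift t).ouVariable_eq (pathShift_zero t) hF hκ]
  exact (hℓ.pathShift t).tendsto_pathIntegral (pathShift_zero t) hF hκ

theorem tendsto_eta (hℓ : IsGoodPath ℓ) (hF : DecaysAtRate sys.F κ) (hκ : κ < 0) (hε : 0 < ε)
    (t : ℝ) :
    Tendsto (fun a => ε ^ (-(1 / sys.α)) • pathIntegral (fun s => linFlow (ε⁻¹ • sys.F) (-s))
      (pathShift t ℓ) a 0) atBot (𝓝 (sys.eta ε ℓ t)) := by
  have hκ' : ε⁻¹ * κ < 0 := mul_neg_of_pos_of_neg (inv_pos.2 hε) hκ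
  rw [eta, (hℓ.pathShift t).ouVariable_eq (pathShift_zero t) (hF.inv_smul hε) hκ']
  exact ((hℓ.pathShift t).tendsto_pathIntegral (pathShift_zero t) (hF.inv_smul hε) hκ').const_smul _

theorem xi_eq (hℓ : IsGoodPath ℓ) (hF : DecaysAtRate sys.F κ) (hκ : κ < 0) {t : ℝ} (ht : t ≤ 0) :
    sys.xi ℓ t = ℓ t + sys.F (fastInt sys.F ℓ t) := by
  rw [xi, (hℓ.pathShift t).ouVariable_eq (pathShift_zero t) hF hκ,
    hℓ.apply_fastInt_pathShift hF hκ ht]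

/-- The path `s ↦ ε^{-1/α} ℓ(εs)`. -/
def scaledPath (α ε : ℝ) {n : ℕ} (ℓ : ℝ → Euc n) (s : ℝ) : Euc n := ε ^ (-(1 / α)) • ℓ (ε * s)

/-- Substituting `s ↦ ε s` in the convolution produces a factor `ε` that cancels the `ε⁻¹` of the
drift, and `ε^{-1/α}` is absorbed in the path. -/
theorem eta_mul (hℓ : IsGoodPath ℓ) (hF : DecaysAtRate sys.F κ) (hκ : κ < 0) (hε : 0 < ε)
    (t : ℝ) : sys.eta ε ℓ (ε * t) = sys.xi (scaledPath sys.α ε ℓ) t := by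
  have hκ' : ε⁻¹ * κ < 0 := mul_neg_of_pos_of_neg (inv_pos.2 hε) hκ
  have hs : IsGoodPath (scaledPath sys.α ε ℓ) := hℓ.scale hε _
  rw [eta, (hℓ.pathShift _).ouVariable_eq (pathShift_zero _) (hF.inv_smul hε) hκ', xi,
    (hs.pathShift t).ouVariable_eq (pathShift_zero t) hF hκ, fastInt_inv_smul _ hε]
  have e : pathShift t (scaledPath sys.α ε ℓ) =
      fun s => ε ^ (-(1 / sys.α)) • pathShift (ε * t) ℓ (ε * s) := by
    ext1 s
    simp only [pathShift, scaledPath, mul_add, smul_sub]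
  have e2 : fastInt sys.F (fun s => ε ^ (-(1 / sys.α)) • pathShift (ε * t) ℓ (ε * s)) 0 =
      ε ^ (-(1 / sys.α)) • fastInt sys.F (fun s => pathShift (ε * t) ℓ (ε * s)) 0 := by
    simp only [fastInt, map_smul, integral_smul]
  have e3 : ∀ w, (ε⁻¹ • sys.F) (ε • w) = sys.F w := fun w => by
    rw [map_smul]
    exact smul_inv_smul₀ hε.ne' _
  rw [e, e2, e3, map_smul]

/-- By `xi_eq` the noise is the path plus a continuous term, so right-continuity and growth are
those of the path. -/
theorem isGoodNoise (hℓ : IsGoodPath ℓ) (hF : DecaysAtRate sys.F κ) {β : ℝ} (hβ : 0 < β)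
    (hβκ : β + κ < 0) : IsGoodNoise β fun s => sys.σ • sys.xi ℓ s := by
  have hκ : κ < 0 := by linarith
  obtain ⟨C, hC⟩ := hℓ.expBounded hβ
  have hc := hC.continuousOn_fastInt hF hβκ hℓ.aestronglyMeasurable
  have hb := hC.fastInt_bounded hF hβκ
  have hFc : ContinuousOn (fun s => sys.F (fastInt sys.F ℓ s)) (Iic 0) :=
    sys.F.continuous.comp_continuousOn hc
  refine ⟨(continuous_const_smul sys.σ).comp_aestronglyMeasurable ?_, fun t ht =>
    (continuous_const_smul sys.σ).continuousAt.comp_continuousWithinAt ?_,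
    |sys.σ| * (C + ‖sys.F‖ * (C / (-(β + κ)))), fun s hs => ?_⟩
  · refine (hℓ.aestronglyMeasurable.add (hFc.aestronglyMeasurable measurableSet_Iic)).congr ?_
    filter_upwards [ae_restrict_mem measurableSet_Iic] with s hs using (xi_eq hℓ hF hκ hs).symm
  · refine ContinuousWithinAt.congr_of_eventuallyEq ((hℓ.cadlag t).1.add
      (hFc.continuousAt (Iic_mem_nhds ht)).continuousWithinAt) ?_ (xi_eq hℓ hF hκ ht.le)
    filter_upwards [mem_nhdsWithin_of_mem_nhds (Iic_mem_nhds ht)] with s hs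
    exact xi_eq hℓ hF hκ hs
  · rw [norm_smul, Real.norm_eq_abs, mul_assoc, xi_eq hℓ hF hκ hs, add_mul, mul_assoc]
    refine mul_le_mul_of_nonneg_left ((norm_add_le _ _).trans (add_le_add (hC s hs) ?_))
      (abs_nonneg _)
    exact (sys.F.le_opNorm _).trans (mul_le_mul_of_nonneg_left (hb s hs) (norm_nonneg _))

end SlowFastSystem

/-! ### Measurable dependence of the fixed point on parameters -/

section Measurability

variable {Q : Type*} [MeasurableSpace Q] {n₁ n₂ : ℕ}

/-- The moving domain is moved into an indicator on the product space, and measurability of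
parameter integrals applies. -/
theorem stronglyMeasurable_fastInt (F : Euc n₂ →L[ℝ] Euc n₂) {φ : Q → ℝ → Euc n₂}
    (hφ : StronglyMeasurable fun q : Q × ℝ => φ q.1 q.2) :
    StronglyMeasurable fun q : Q × ℝ => fastInt F (φ q.1) q.2 := by
  have h1 : StronglyMeasurable fun q : (Q × ℝ) × ℝ =>
      linFlow F (q.1.2 - q.2) (φ q.1.1 q.2) := by
    refine (isBoundedBilinearMap_apply (𝕜 := ℝ)).continuous.comp_stronglyMeasurable
      (StronglyMeasurable.prodMk (f := fun q : (Q × ℝ) × ℝ => linFlow F (q.1.2 - q.2)) ?_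
        (hφ.comp_measurable ((measurable_fst.comp measurable_fst).prodMk measurable_snd)))
    exact (continuous_linFlow F).comp_stronglyMeasurable
      ((measurable_snd.comp measurable_fst).sub measurable_snd).stronglyMeasurable
  have h2 : MeasurableSet {q : (Q × ℝ) × ℝ | q.2 ≤ q.1.2} :=
    measurableSet_le measurable_snd (measurable_snd.comp measurable_fst)
  have h3 := (h1.indicator h2).integral_prod_right' (ν := volume)
  convert! h3 using 2 with q
  rw [fastInt, ← integral_indicator measurableSet_Iic]
  rfl

theorem stronglyMeasurable_primitive {φ : Q → ℝ → Euc n₁}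
    (hφ : StronglyMeasurable fun q : Q × ℝ => φ q.1 q.2) :
    StronglyMeasurable fun q : Q × ℝ => ∫ s in (0 : ℝ)..q.2, φ q.1 s := by
  have h1 : StronglyMeasurable fun q : (Q × ℝ) × ℝ => φ q.1.1 q.2 :=
    hφ.comp_measurable ((measurable_fst.comp measurable_fst).prodMk measurable_snd)
  have m0 : Measurable fun _ : (Q × ℝ) × ℝ => (0 : ℝ) := measurable_const
  have m2 : Measurable fun q : (Q × ℝ) × ℝ => q.1.2 := measurable_snd.comp measurable_fst
  have h2 : MeasurableSet {q : (Q × ℝ) × ℝ | q.2 ∈ Ioc 0 q.1.2} :=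
    (measurableSet_lt m0 measurable_snd).inter (measurableSet_le measurable_snd m2)
  have h2' : MeasurableSet {q : (Q × ℝ) × ℝ | q.2 ∈ Ioc q.1.2 0} :=
    (measurableSet_lt m2 measurable_snd).inter (measurableSet_le measurable_snd m0)
  have h3 := ((h1.indicator h2).integral_prod_right' (ν := volume)).sub
    ((h1.indicator h2').integral_prod_right' (ν := volume))
  convert! h3 using 2 with q
  rw [intervalIntegral, ← integral_indicator measurableSet_Ioc,
    ← integral_indicator measurableSet_Ioc]
  rfl

theorem stronglyMeasurable_lpIterate (F : Euc n₂ →L[ℝ] Euc n₂)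
    {f₁ : Q → ℝ → Euc n₁ × Euc n₂ → Euc n₁} {f₂ : Q → ℝ → Euc n₁ × Euc n₂ → Euc n₂}
    (h₁ : Measurable fun q : Q × ℝ × (Euc n₁ × Euc n₂) => f₁ q.1 q.2.1 q.2.2)
    (h₂ : Measurable fun q : Q × ℝ × (Euc n₁ × Euc n₂) => f₂ q.1 q.2.1 q.2.2) (x₀ : Euc n₁)
    (k : ℕ) : StronglyMeasurable fun q : Q × ℝ => lpIterate F (f₁ q.1) (f₂ q.1) x₀ k q.2 := by
  induction k with
  | zero => exact stronglyMeasurable_const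
  | succ k ih =>
    have hu : Measurable fun q : Q × ℝ =>
        (q.1, q.2, lpIterate F (f₁ q.1) (f₂ q.1) x₀ k q.2) :=
      measurable_fst.prodMk (measurable_snd.prodMk ih.measurable)
    have m₁ := stronglyMeasurable_primitive
      (φ := fun q s => f₁ q s (lpIterate F (f₁ q) (f₂ q) x₀ k s)) (h₁.comp hu).stronglyMeasurable
    have m₂ := stronglyMeasurable_fastInt F
      (φ := fun q s => f₂ q s (lpIterate F (f₁ q) (f₂ q) x₀ k s)) (h₂.comp hu).stronglyMeasurable
    exact (stronglyMeasurable_const.add m₁).prodMk m₂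

theorem stronglyMeasurable_lpSolution (F : Euc n₂ →L[ℝ] Euc n₂)
    {f₁ : Q → ℝ → Euc n₁ × Euc n₂ → Euc n₁} {f₂ : Q → ℝ → Euc n₁ × Euc n₂ → Euc n₂}
    (h₁ : Measurable fun q : Q × ℝ × (Euc n₁ × Euc n₂) => f₁ q.1 q.2.1 q.2.2)
    (h₂ : Measurable fun q : Q × ℝ × (Euc n₁ × Euc n₂) => f₂ q.1 q.2.1 q.2.2) (x₀ : Euc n₁) :
    StronglyMeasurable fun q : Q × ℝ => lpSolution F (f₁ q.1) (f₂ q.1) x₀ q.2 :=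
  StronglyMeasurable.limUnder fun k => stronglyMeasurable_lpIterate F h₁ h₂ x₀ k

theorem lpSolution_congr (F : Euc n₂ →L[ℝ] Euc n₂) {f₁ g₁ : ℝ → Euc n₁ × Euc n₂ → Euc n₁}
    {f₂ g₂ : ℝ → Euc n₁ × Euc n₂ → Euc n₂} (h₁ : ∀ s ≤ 0, f₁ s = g₁ s)
    (h₂ : ∀ s ≤ 0, f₂ s = g₂ s) (x₀ : Euc n₁) {t : ℝ} (ht : t ≤ 0) :
    lpSolution F f₁ f₂ x₀ t = lpSolution F g₁ g₂ x₀ t := by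
  have key : ∀ k, ∀ t ≤ 0, lpIterate F f₁ f₂ x₀ k t = lpIterate F g₁ g₂ x₀ k t := by
    intro k
    induction k with
    | zero => exact fun _ _ => rfl
    | succ k ih =>
      intro t ht
      refine Prod.ext ?_ (fastInt_congr (fun s hs => ?_) ht)
      · simp only [lpIterate, lpOperator]
        congr 1
        refine intervalIntegral.integral_congr fun s hs => ?_
        rw [uIcc_of_ge ht] at hs
        rw [h₁ s hs.2, ih s hs.2]
      · rw [h₂ s hs, ih s hs]
  simp only [lpSolution, key _ t ht]

end Measurability

/-! ### The slow manifold as the graph of a measurable functional of the driving path. -/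

namespace SlowFastSystem

variable {n₁ n₂ : ℕ} {sys : SlowFastSystem n₁ n₂} {ℓ : ℝ → Euc n₂} {ε : ℝ}
  {γ γf K K' C₁ : ℝ}

/-- The noise `σ ξ(θ_t ω)` as a measurable functional of the driving path. -/
def noise (sys : SlowFastSystem n₁ n₂) (p : ℝ → Euc n₂) (t : ℝ) : Euc n₂ :=
  sys.σ • (regularize p t + sys.F (fastInt sys.F (regularize p) t))

theorem noise_eq (hℓ : IsGoodPath ℓ) (hF : DecaysAtRate sys.F γf) (hγf : γf < 0) {t : ℝ}
    (ht : t ≤ 0) : sys.noise ℓ t = sys.σ • sys.xi ℓ t := by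
  rw [noise, xi_eq hℓ hF hγf ht, hℓ.cadlag.regularize_eq]

theorem measurable_noise : Measurable fun q : (ℝ → Euc n₂) × ℝ => sys.noise q.1 q.2 := by
  have h1 : StronglyMeasurable fun q : (ℝ → Euc n₂) × ℝ => regularize q.1 q.2 :=
    stronglyMeasurable_regularize
  have h2 := sys.F.continuous.comp_stronglyMeasurable
    (stronglyMeasurable_fastInt sys.F (φ := fun p : ℝ → Euc n₂ => regularize p) h1)
  exact ((h1.add h2).const_smul sys.σ).measurable

/-- The height of the slow manifold over `x₀` as a functional of the driving path. -/
def graphMap (sys : SlowFastSystem n₁ n₂) (ε : ℝ) (p : ℝ → Euc n₂) (x₀ : Euc n₁) : Euc n₂ :=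
  (sys.orbit ε (sys.noise p) x₀ 0).2

/-- Random fields carry the product σ-algebra, so one `x₀` at a time suffices; there the value comes
from a limit of jointly measurable Picard iterates. -/
theorem measurable_graphMap (h : sys.IsRegular γ γf K K' C₁) (ε : ℝ) :
    Measurable (sys.graphMap ε) := by
  refine measurable_pi_lambda _ fun x₀ => ?_
  let Ξ := (ℝ → Euc n₂) × ℝ × (Euc n₁ × Euc n₂)
  have hx : Measurable fun q : Ξ => q.2.2.1 :=
    measurable_fst.comp (measurable_snd.comp measurable_snd)
  have hy : Measurable fun q : Ξ => q.2.2.2 :=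
    measurable_snd.comp (measurable_snd.comp measurable_snd)
  have hps : Measurable fun q : Ξ => (q.1, q.2.1) :=
    measurable_fst.prodMk (measurable_fst.comp measurable_snd)
  have hz : Measurable fun q : Ξ => sys.noise q.1 q.2.1 :=
    Measurable.comp (g := fun q : (ℝ → Euc n₂) × ℝ => sys.noise q.1 q.2)
      (f := fun q : Ξ => (q.1, q.2.1)) measurable_noise hps
  have hu : Measurable fun q : Ξ => (q.2.2.1, q.2.2.2 + sys.noise q.1 q.2.1) :=
    hx.prodMk (hy.add hz)
  have hS : Measurable fun q : (ℝ → Euc n₂) × ℝ × (Euc n₁ × Euc n₂) => sys.S q.2.2.1 :=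
    sys.S.measurable.comp hx
  have hg : Measurable fun q : (ℝ → Euc n₂) × ℝ × (Euc n₁ × Euc n₂) =>
      sys.g₁ (q.2.2.1, q.2.2.2 + sys.noise q.1 q.2.1) :=
    h.continuous₁.measurable.comp hu
  have h₁ : Measurable fun q : (ℝ → Euc n₂) × ℝ × (Euc n₁ × Euc n₂) =>
      sys.slowField ε (sys.noise q.1) q.2.1 q.2.2 := by
    unfold slowField
    exact (hS.add hg).const_smul ε
  have h₂ : Measurable fun q : (ℝ → Euc n₂) × ℝ × (Euc n₁ × Euc n₂) =>
      sys.fastField (sys.noise q.1) q.2.1 q.2.2 := by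
    unfold fastField
    exact h.diff₂.continuous.measurable.comp hu
  have hsol := (stronglyMeasurable_lpSolution sys.F
    (f₁ := fun p => sys.slowField ε (sys.noise p)) (f₂ := fun p => sys.fastField (sys.noise p))
    h₁ h₂ x₀).measurable
  have hp : Measurable fun p : ℝ → Euc n₂ => (p, (0 : ℝ)) := measurable_id.prodMk measurable_const
  exact (Measurable.comp (g := fun q : (ℝ → Euc n₂) × ℝ => lpSolution sys.F
    (sys.slowField ε (sys.noise q.1)) (sys.fastField (sys.noise q.1)) x₀ q.2)
    (f := fun p : ℝ → Euc n₂ => (p, (0 : ℝ))) hsol hp).snd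

theorem graphMap_eq (h : sys.IsRegular γ γf K K' C₁) (hγf : γf < 0) (hℓ : IsGoodPath ℓ)
    (x₀ : Euc n₁) :
    sys.graphMap ε ℓ x₀ = (sys.orbit ε (fun s => sys.σ • sys.xi ℓ s) x₀ 0).2 := by
  rw [graphMap, orbit, orbit]
  refine congrArg Prod.snd (lpSolution_congr _ (fun s hs => ?_) (fun s hs => ?_) x₀ le_rfl) <;>
  · ext1 u
    simp only [slowField, fastField, noise_eq hℓ h.decay hγf hs]

/-- The slow manifold is the graph of `graphMap` at the rescaled driving path. -/
theorem slowManifold_eq (h : sys.IsRegular γ γf K K' C₁) (hγf : γf < 0) (hε : 0 < ε)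
    (hc : ε * (‖sys.S‖ + K) / γ + K / (-(γ + γf)) < 1) (hℓ : IsGoodPath ℓ) :
    sys.slowManifold γ ε ℓ = {p | p.2 = sys.graphMap ε (scaledPath sys.α ε ℓ) p.1} := by
  have hs : IsGoodPath (scaledPath sys.α ε ℓ) := hℓ.scale hε _
  have hz := isGoodNoise (sys := sys) hs h.decay h.γ_pos h.gap'
  ext p
  rw [mem_ofPred_eq, graphMap_eq h hγf hs, ← h.exists_orbit_iff hε.le hc hz p]
  -- The time change `t ↦ ε t` carries the weight `-γ/ε` to `-γ`; `hW'` is the inverse passage.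
  have hW : ∀ {m : ℕ} {φ ψ : ℝ → Euc m}, (∀ t, ψ t = φ (ε * t)) →
      InWeighted (-γ / ε) φ → InWeighted (-γ) ψ := by
    intro m φ ψ hψ ⟨hc, C, hC⟩
    refine ⟨?_, C, fun t ht => ?_⟩
    · rw [show ψ = fun t => φ (ε * t) from funext hψ]
      exact hc.comp (continuous_const.mul continuous_id).continuousOn
        fun t ht => mul_nonpos_of_nonneg_of_nonpos hε.le ht
    · have := hC (ε * t) (mul_nonpos_of_nonneg_of_nonpos hε.le ht)
      rw [hψ]
      convert! this using 3
      field_simp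
  have hW' : ∀ {m : ℕ} {φ ψ : ℝ → Euc m}, (∀ t, ψ t = φ (ε⁻¹ * t)) →
      InWeighted (-γ) φ → InWeighted (-γ / ε) ψ := by
    intro m φ ψ hψ ⟨hc, C, hC⟩
    have hε' : 0 ≤ ε⁻¹ := (inv_pos.2 hε).le
    refine ⟨?_, C, fun t ht => ?_⟩
    · rw [show ψ = fun t => φ (ε⁻¹ * t) from funext hψ]
      exact hc.comp (continuous_const.mul continuous_id).continuousOn
        fun t ht => mul_nonpos_of_nonneg_of_nonpos hε' ht
    · have := hC (ε⁻¹ * t) (mul_nonpos_of_nonneg_of_nonpos hε' ht)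
      rw [hψ]
      convert! this using 3
      field_simp
  constructor
  · rintro ⟨x, y, hx, hy, hxy⟩
    refine ⟨fun t => x (ε * t), fun t => y (ε * t), hW (fun _ => rfl) hx, hW (fun _ => rfl) hy,
      fun t ht => ?_⟩
    obtain ⟨e1, e2⟩ := hxy (ε * t) (mul_nonpos_of_nonneg_of_nonpos hε.le ht)
    refine ⟨?_, ?_⟩
    · beta_reduce
      rw [e1, ← mul_zero ε, ← intervalIntegral.smul_integral_comp_mul_left,
        ← intervalIntegral.integral_smul, mul_zero]
      simp only [slowField, ← eta_mul hℓ h.decay hγf hε]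
    · beta_reduce
      rw [e2, ← mul_zero ε, ← intervalIntegral.smul_integral_comp_mul_left,
        ← intervalIntegral.integral_smul, mul_zero]
      simp only [fastField, ← eta_mul hℓ h.decay hγf hε, smul_inv_smul₀ hε.ne']
  · rintro ⟨x, y, hx, hy, hxy⟩
    refine ⟨fun t => x (ε⁻¹ * t), fun t => y (ε⁻¹ * t), hW' (fun _ => rfl) hx,
      hW' (fun _ => rfl) hy, fun t ht => ?_⟩
    obtain ⟨e1, e2⟩ := hxy (ε⁻¹ * t) (mul_nonpos_of_nonneg_of_nonpos (inv_pos.2 hε).le ht)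
    have het : ∀ s, sys.eta ε ℓ s = sys.xi (scaledPath sys.α ε ℓ) (ε⁻¹ * s) := fun s => by
      rw [← eta_mul hℓ h.decay hγf hε, mul_inv_cancel_left₀ hε.ne']
    have key : ∀ {m : ℕ} (f : ℝ → Euc m),
        ∫ s in (0 : ℝ)..t, f (ε⁻¹ * s) = ε • ∫ s in (0 : ℝ)..ε⁻¹ * t, f s := fun f => by
      rw [intervalIntegral.integral_comp_mul_left _ (inv_pos.2 hε).ne', inv_inv, mul_zero]
    refine ⟨?_, ?_⟩
    · simp only [het]
      rw [e1, key fun s => sys.S (x s) +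
        sys.g₁ (x s, y s + sys.σ • sys.xi (scaledPath sys.α ε ℓ) s),
        ← intervalIntegral.integral_smul]
      rfl
    · simp only [het]
      rw [e2, key fun s => ε⁻¹ • (sys.F (y s) +
        sys.g₂ (x s, y s + sys.σ • sys.xi (scaledPath sys.α ε ℓ) s)),
        ← intervalIntegral.integral_smul]
      simp only [fastField, smul_inv_smul₀ hε.ne']

end SlowFastSystem

/-! ### A maximal inequality for sums of independent random vectors -/

section Maximal

variable {Ω : Type*} [MeasurableSpace Ω] {P : Measure Ω} [IsProbabilityMeasure P] {n : ℕ}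

/-- **Ottaviani's inequality**. -/
theorem ottaviani_inequality {X : ℕ → Ω → Euc n} (hm : ∀ i, Measurable (X i))
    (hX : iIndepFun X P) {N : ℕ} {a : ℝ}
    (h : ∀ j ≤ N, P.real {ω | a < ‖∑ i ∈ Finset.Ico j N, X i ω‖} ≤ 1 / 4) :
    P.real {ω | ∃ j ≤ N, 2 * a < ‖∑ i ∈ Finset.range j, X i ω‖} ≤
      4 / 3 * P.real {ω | a < ‖∑ i ∈ Finset.range N, X i ω‖} := by
  set m : ℕ → MeasurableSpace Ω := fun i => MeasurableSpace.comap (X i) inferInstance with hmdef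
  have hmle : ∀ i, m i ≤ ‹MeasurableSpace Ω› := fun i => (hm i).comap_le
  have hmX : ∀ (T : Set ℕ) (s : Finset ℕ), (∀ i ∈ s, i ∈ T) →
      Measurable[⨆ i ∈ T, m i] fun ω => ∑ i ∈ s, X i ω := by
    intro T s hs
    refine Finset.measurable_fun_sum s fun i hi => ?_
    exact (comap_measurable (X i)).mono (le_iSup₂_of_le i (hs i hi) le_rfl) le_rfl
  -- `A j` is the event that the level `2a` is first exceeded at time `j`, and `B j` that the
  -- remaining sum is at most `a`. They depend on disjoint blocks of the `X i`, hence are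
  -- independent.
  let A : ℕ → Set Ω := fun j => {ω | 2 * a < ‖∑ i ∈ Finset.range j, X i ω‖} ∩
    ⋂ k < j, {ω | 2 * a < ‖∑ i ∈ Finset.range k, X i ω‖}ᶜ
  let B : ℕ → Set Ω := fun j => {ω | ‖∑ i ∈ Finset.Ico j N, X i ω‖ ≤ a}
  have hAm : ∀ j, MeasurableSet[⨆ i ∈ Iio j, m i] (A j) := by
    intro j
    have : ∀ k ≤ j, MeasurableSet[⨆ i ∈ Iio j, m i]
        {ω | 2 * a < ‖∑ i ∈ Finset.range k, X i ω‖} := fun k hk =>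
      measurable_norm.comp (hmX (Iio j) (Finset.range k) fun i hi =>
        (Finset.mem_range.1 hi).trans_le hk) measurableSet_Ioi
    exact (this j le_rfl).inter (MeasurableSet.biInter (to_countable _)
      fun k hk => (this k (le_of_lt hk)).compl)
  have hBm : ∀ j, MeasurableSet[⨆ i ∈ Ici j, m i] (B j) := fun j =>
    measurable_norm.comp (hmX (Ici j) (Finset.Ico j N) fun i hi => (Finset.mem_Ico.1 hi).1)
      measurableSet_Iic
  have hle : ∀ T : Set ℕ, ⨆ i ∈ T, m i ≤ ‹MeasurableSpace Ω› := fun T => iSup₂_le fun i _ => hmle i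
  have hAB : ∀ j, P.real (A j ∩ B j) = P.real (A j) * P.real (B j) := by
    intro j
    have hd : Disjoint (Iio j) (Ici j) := Set.disjoint_left.2 fun i hi hi' => not_lt.2 (mem_Ici.1 hi') (mem_Iio.1 hi)
    have := (Indep_iff _ _ P).1 (indep_iSup_of_disjoint hmle hX.iIndep hd) _ _ (hAm j) (hBm j)
    rw [measureReal_def, this, ENNReal.toReal_mul]; rfl
  have hB : ∀ j ≤ N, 3 / 4 ≤ P.real (B j) := by
    intro j hj
    have h1 := h j hj
    have h2 : {ω | a < ‖∑ i ∈ Finset.Ico j N, X i ω‖} = (B j)ᶜ := by ext; simp [B]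
    rw [h2, probReal_compl_eq_one_sub (hle _ _ (hBm j))] at h1
    linarith
  have hdisj : Pairwise (Function.onFun Disjoint A) := by
    have key : ∀ j k, j < k → Disjoint (A j) (A k) := fun j k hjk => by
      rw [Set.disjoint_left]
      intro ω hj hk
      exact (mem_iInter₂.1 hk.2 j hjk) hj.1
    intro j k hjk
    rcases lt_or_gt_of_ne hjk with h | h
    · exact key j k h
    · exact (key k j h).symm
  have hU : {ω | ∃ j ≤ N, 2 * a < ‖∑ i ∈ Finset.range j, X i ω‖} ⊆
      ⋃ j ∈ Finset.range (N + 1), A j := by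
    rintro ω ⟨j, hj, hω⟩
    classical
    have hex : ∃ j, 2 * a < ‖∑ i ∈ Finset.range j, X i ω‖ := ⟨j, hω⟩
    refine mem_iUnion₂.2 ⟨Nat.find hex, ?_, Nat.find_spec hex, mem_iInter₂.2 fun k hk =>
      Nat.find_min hex hk⟩
    exact Finset.mem_range.2 (Nat.lt_succ_of_le ((Nat.find_min' hex hω).trans hj))
  -- On `A j ∩ B j` the total sum exceeds `2a - a`.
  have hsub : (⋃ j ∈ Finset.range (N + 1), A j ∩ B j) ⊆
      {ω | a < ‖∑ i ∈ Finset.range N, X i ω‖} := by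
    refine iUnion₂_subset fun j hj ω hω => ?_
    have hjN : j ≤ N := Nat.lt_succ_iff.1 (Finset.mem_range.1 hj)
    have h1 : 2 * a < ‖∑ i ∈ Finset.range j, X i ω‖ := hω.1.1
    have h2 : ‖∑ i ∈ Finset.Ico j N, X i ω‖ ≤ a := hω.2
    have h3 := Finset.sum_range_add_sum_Ico (fun i => X i ω) hjN
    have h4 : ∑ i ∈ Finset.range j, X i ω =
      ∑ i ∈ Finset.range N, X i ω - ∑ i ∈ Finset.Ico j N, X i ω := by rw [← h3]; abel
    have h5 := norm_sub_le (∑ i ∈ Finset.range N, X i ω) (∑ i ∈ Finset.Ico j N, X i ω)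
    rw [← h4] at h5
    show a < _
    linarith
  calc P.real {ω | ∃ j ≤ N, 2 * a < ‖∑ i ∈ Finset.range j, X i ω‖}
      ≤ P.real (⋃ j ∈ Finset.range (N + 1), A j) := measureReal_mono hU (measure_ne_top _ _)
    _ ≤ ∑ j ∈ Finset.range (N + 1), P.real (A j) := measureReal_biUnion_finset_le _ _
    _ ≤ ∑ j ∈ Finset.range (N + 1), 4 / 3 * P.real (A j ∩ B j) := by
        refine Finset.sum_le_sum fun j hj => ?_
        have := hB j (Nat.lt_succ_iff.1 (Finset.mem_range.1 hj))
        rw [hAB]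
        nlinarith [measureReal_nonneg (μ := P) (s := A j)]
    _ = 4 / 3 * P.real (⋃ j ∈ Finset.range (N + 1), A j ∩ B j) := by
        rw [← Finset.mul_sum, measureReal_biUnion_finset]
        · intro j _ k _ hjk
          exact (hdisj hjk).mono inter_subset_left inter_subset_left
        · exact fun j _ => (hle _ _ (hAm j)).inter (hle _ _ (hBm j))
    _ ≤ _ := mul_le_mul_of_nonneg_left (measureReal_mono hsub) (by norm_num)

end Maximal

/-! ### Growth of the paths of a stable process -/

namespace IsTwoSidedStableLevy

variable {Ω : Type*} [MeasurableSpace Ω] {P : Measure Ω} {n : ℕ}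
  {α : ℝ} {L : ℝ → Ω → Euc n}

theorem map_increment (hL : IsTwoSidedStableLevy α L P) (hα : 0 < α) {s t : ℝ} (hst : s ≤ t) :
    P.map (fun ω => L t ω - L s ω) = P.map (fun ω => (t - s) ^ (1 / α) • L 1 ω) := by
  rcases hst.eq_or_lt with rfl | h
  · simp [Real.zero_rpow (inv_pos.2 hα).ne']
  · rw [hL.stationary_increments s t hst, hL.stable _ (sub_pos.2 h)]

theorem measurable_increment (hL : IsTwoSidedStableLevy α L P) (s t : ℝ) :
    Measurable fun ω => L t ω - L s ω := (hL.measurable t).sub (hL.measurable s)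

theorem measureReal_increment (hL : IsTwoSidedStableLevy α L P) (hα : 0 < α) {s t : ℝ}
    (hst : s ≤ t) (b : ℝ) :
    P.real {ω | b < ‖L t ω - L s ω‖} = P.real {ω | b < (t - s) ^ (1 / α) * ‖L 1 ω‖} := by
  have hb : MeasurableSet {x : Euc n | b < ‖x‖} := measurable_norm measurableSet_Ioi
  have h1 := map_measureReal_apply (μ := P) (hL.measurable_increment s t) hb
  have h2 := map_measureReal_apply (μ := P)
    ((hL.measurable 1).const_smul ((t - s) ^ (1 / α))) hb
  rw [hL.map_increment hα hst] at h1
  refine h1.symm.trans (h2.trans ?_)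
  congr 1
  ext ω
  simp [norm_smul, abs_of_nonneg (Real.rpow_nonneg (sub_nonneg.2 hst) _)]

theorem measureReal_increment_le [IsProbabilityMeasure P]
    (hL : IsTwoSidedStableLevy α L P) (hα : 0 < α) {s t T b : ℝ}
    (hst : s ≤ t) (hT : 0 < T) (htT : t - s ≤ T) :
    P.real {ω | b * T ^ (1 / α) < ‖L t ω - L s ω‖} ≤ P.real {ω | b < ‖L 1 ω‖} := by
  rw [hL.measureReal_increment hα hst]
  refine measureReal_mono fun ω hω => ?_
  have h0 : (t - s) ^ (1 / α) ≤ T ^ (1 / α) :=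
    Real.rpow_le_rpow (sub_nonneg.2 hst) htT (by positivity)
  have hT' : 0 < T ^ (1 / α) := Real.rpow_pos_of_pos hT _
  have h1 : b * T ^ (1 / α) < (t - s) ^ (1 / α) * ‖L 1 ω‖ := hω
  have h2 : (t - s) ^ (1 / α) * ‖L 1 ω‖ ≤ T ^ (1 / α) * ‖L 1 ω‖ := by gcongr
  have h3 := h1.trans_le h2
  rw [mul_comm] at h3
  exact lt_of_mul_lt_mul_left h3 hT'.le

theorem exists_tail_le [IsProbabilityMeasure P] (hL : IsTwoSidedStableLevy α L P) :
    ∃ b : ℝ, 0 < b ∧ P.real {ω | b < ‖L 1 ω‖} ≤ 1 / 4 := by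
  have hm : ∀ k : ℕ, MeasurableSet {ω | (k : ℝ) < ‖L 1 ω‖} := fun k =>
    (hL.measurable 1).norm measurableSet_Ioi
  have hanti : Antitone fun k : ℕ => {ω | (k : ℝ) < ‖L 1 ω‖} := fun i j hij ω hω =>
    (Nat.cast_le (α := ℝ).2 hij).trans_lt (show (j : ℝ) < ‖L 1 ω‖ from hω)
  have h := tendsto_measure_iInter_atTop (μ := P) (fun k => (hm k).nullMeasurableSet) hanti
    ⟨0, measure_ne_top _ _⟩
  have he : (⋂ k : ℕ, {ω | (k : ℝ) < ‖L 1 ω‖}) = ∅ := by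
    refine eq_empty_of_forall_notMem fun ω hω => ?_
    obtain ⟨k, hk⟩ := exists_nat_gt ‖L 1 ω‖
    exact lt_asymm hk (mem_iInter.1 hω k)
  rw [he, measure_empty] at h
  have h4 := ((ENNReal.tendsto_toReal ENNReal.zero_ne_top).comp h).eventually
    (ge_mem_nhds (show (0 : ENNReal).toReal < 1 / 4 by norm_num))
  obtain ⟨k, hk, hk0⟩ := (h4.and (eventually_gt_atTop 0)).exists
  exact ⟨k, by exact_mod_cast hk0, hk⟩

/-- Ottaviani's inequality for a process with stationary independent increments, on a grid. -/
theorem measureReal_exists_grid_le [IsProbabilityMeasure P]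
    (hL : IsTwoSidedStableLevy α L P) (hα : 0 < α) {t : ℕ → ℝ} (ht : Monotone t) {N : ℕ} {b T : ℝ}
    (hT : 0 < T) (htT : t N - t 0 ≤ T) (hb : P.real {ω | b < ‖L 1 ω‖} ≤ 1 / 4) :
    P.real {ω | ∃ j ≤ N, 2 * (b * T ^ (1 / α)) < ‖L (t j) ω - L (t 0) ω‖} ≤
      4 / 3 * P.real {ω | b < ‖L 1 ω‖} := by
  have h := ottaviani_inequality (P := P) (X := fun i ω => L (t (i + 1)) ω - L (t i) ω)
    (fun i => hL.measurable_increment _ _) (hL.indep_increments.nat ht) (N := N)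
    (a := b * T ^ (1 / α)) ?_
  · have hs : ∀ j ω, ∑ i ∈ Finset.range j, (L (t (i + 1)) ω - L (t i) ω) =
        L (t j) ω - L (t 0) ω := fun j ω => Finset.sum_range_sub (fun i => L (t i) ω) j
    simp only [hs] at h
    exact h.trans (mul_le_mul_of_nonneg_left
      (hL.measureReal_increment_le hα (ht (Nat.zero_le N)) hT htT) (by norm_num))
  · intro j hj
    have : ∀ ω, ∑ i ∈ Finset.Ico j N, (L (t (i + 1)) ω - L (t i) ω) = L (t N) ω - L (t j) ω :=
      fun ω => Finset.sum_Ico_sub (fun i => L (t i) ω) hj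
    simp only [this]
    refine (hL.measureReal_increment_le hα (ht hj) hT ?_).trans hb
    linarith [ht (Nat.zero_le j)]

/-- One large jump among `N` unit increments would make a partial sum large. Off the maximal event
`B`, of probability at most `4/3 · 1/4 = 1/3`, every increment is a difference of two sums bounded
by `2 b N^{1/α}`. Independence then gives `(1 - p)^N ≥ 2/3`. -/
theorem tail_le [IsProbabilityMeasure P] (hL : IsTwoSidedStableLevy α L P) (hα : 0 < α) {b : ℝ}
    (hb : P.real {ω | b < ‖L 1 ω‖} ≤ 1 / 4) {N : ℕ} (hN : 0 < N) :
    P.real {ω | 4 * b * (N : ℝ) ^ (1 / α) < ‖L 1 ω‖} ≤ 1 / (2 * N) := by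
  have hN' : (0 : ℝ) < N := Nat.cast_pos.2 hN
  set p := P.real {ω | 4 * b * (N : ℝ) ^ (1 / α) < ‖L 1 ω‖} with hp
  have hmono : Monotone fun i : ℕ => (i : ℝ) := Nat.mono_cast
  have h1 := hL.measureReal_exists_grid_le hα hmono (N := N) (T := N) hN' (by simp) hb
  set B : Set Ω := {ω | ∃ j ≤ N, 2 * (b * (N : ℝ) ^ (1 / α)) < ‖L j ω - L (0 : ℕ) ω‖} with hB
  let A : Set (Euc n) := {x | ‖x‖ ≤ 4 * b * (N : ℝ) ^ (1 / α)}
  have hA : MeasurableSet A := measurable_norm measurableSet_Iic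
  have h2 := (hL.indep_increments.nat hmono).measure_inter_preimage_eq_mul (Finset.range N)
    (sets := fun _ => A) fun _ _ => hA
  have h3 : ∀ i : ℕ, P.real ((fun ω => L ((i + 1 : ℕ) : ℝ) ω - L i ω) ⁻¹' A) = 1 - p := by
    intro i
    have e : ((fun ω => L ((i + 1 : ℕ) : ℝ) ω - L i ω) ⁻¹' A) =
        {ω | 4 * b * (N : ℝ) ^ (1 / α) < ‖L ((i + 1 : ℕ) : ℝ) ω - L i ω‖}ᶜ := by
      ext ω; simp [A]
    have hme : MeasurableSet
        {ω | 4 * b * (N : ℝ) ^ (1 / α) < ‖L ((i + 1 : ℕ) : ℝ) ω - L i ω‖} :=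
      (hL.measurable_increment i ((i + 1 : ℕ) : ℝ)).norm measurableSet_Ioi
    rw [e, probReal_compl_eq_one_sub hme,
      hL.measureReal_increment hα (by simp)]
    simp [hp]
  have h4 : P.real (⋂ i ∈ Finset.range N, (fun ω => L ((i + 1 : ℕ) : ℝ) ω - L i ω) ⁻¹' A) =
      (1 - p) ^ N := by
    rw [measureReal_def, h2, ENNReal.toReal_prod]
    exact (Finset.prod_congr rfl fun i _ => h3 i).trans (by simp)
  have h5 : Bᶜ ⊆ ⋂ i ∈ Finset.range N, (fun ω => L ((i + 1 : ℕ) : ℝ) ω - L i ω) ⁻¹' A := by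
    intro ω hω
    have hω' : ∀ j ≤ N, ‖L j ω - L (0 : ℕ) ω‖ ≤ 2 * (b * (N : ℝ) ^ (1 / α)) := by
      simpa [hB] using hω
    refine mem_iInter₂.2 fun i hi => ?_
    have hi' := Finset.mem_range.1 hi
    have a1 := hω' i hi'.le
    have a2 := hω' (i + 1) hi'
    show ‖L ((i + 1 : ℕ) : ℝ) ω - L i ω‖ ≤ _
    rw [← sub_sub_sub_cancel_right _ _ (L (0 : ℕ) ω)]
    exact (norm_sub_le _ _).trans ((add_le_add a2 a1).trans_eq (by ring))
  have hBm : MeasurableSet B := by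
    have : B = ⋃ j ∈ Iic N, {ω | 2 * (b * (N : ℝ) ^ (1 / α)) < ‖L j ω - L (0 : ℕ) ω‖} := by
      ext; simp [hB]
    rw [this]
    exact MeasurableSet.biUnion (to_countable _) fun j _ =>
      (hL.measurable_increment _ _).norm measurableSet_Ioi
  have h6 : 2 / 3 ≤ (1 - p) ^ N := by
    rw [← h4]
    refine le_trans ?_ (measureReal_mono h5)
    rw [probReal_compl_eq_one_sub hBm]
    linarith
  have hp0 : 0 ≤ p := measureReal_nonneg
  have hp1 : p ≤ 1 := measureReal_le_one
  -- Bernoulli together with `(1 - p²)^N ≤ 1` yields `2/3 (1 + N p) ≤ 1`, that is, `p ≤ 1/(2N)`.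
  have h7 : 1 + N * p ≤ (1 + p) ^ N := one_add_mul_le_pow (by linarith) N
  have h8 : (1 - p) ^ N * (1 + p) ^ N ≤ 1 := by
    rw [← mul_pow]
    exact pow_le_one₀ (by nlinarith) (by nlinarith)
  have h9 : 2 / 3 * (1 + N * p) ≤ 1 := by
    refine le_trans ?_ h8
    exact mul_le_mul h6 h7 (by positivity) (by linarith)
  rw [le_div_iff₀ (by positivity)]
  linarith

/-- Right-continuity passes the grid bound to all times. The grid controls increments from `-u`; as
`ℓ 0 = 0`, it controls `ℓ (-u)` too, whence the factor 2. -/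
theorem _root_.IsCadlagPath.norm_le_of_dyadic {ℓ : ℝ → Euc n} (h : IsCadlagPath ℓ) (h0 : ℓ 0 = 0)
    {u A : ℝ} (hu : 0 < u) (hA : ∀ m : ℕ, ∀ j ≤ 2 ^ m,
      ‖ℓ (u * ((j : ℕ) / 2 ^ m) - u) - ℓ (u * ((0 : ℕ) / 2 ^ m) - u)‖ ≤ A)
    {t : ℝ} (ht : t ∈ Icc (-u) 0) : ‖ℓ t‖ ≤ 2 * A := by
  have hA' : ∀ m : ℕ, ∀ j ≤ 2 ^ m, ‖ℓ (u * ((j : ℕ) / 2 ^ m) - u) - ℓ (-u)‖ ≤ A := by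
    simpa using hA
  have h1 : ‖ℓ (-u)‖ ≤ A := by simpa [h0] using hA' 0 1 (by simp)
  have hA0 : 0 ≤ A := (norm_nonneg _).trans h1
  rcases ht.2.eq_or_lt with rfl | ht0
  · rw [h0, norm_zero]; positivity
  set v : ℝ := (t + u) / u with hv
  have hv0 : 0 ≤ v := div_nonneg (by linarith [ht.1]) hu.le
  have hv1 : v < 1 := (div_lt_one hu).2 (by linarith)
  have htv : t = u * v - u := by rw [hv]; field_simp; ring
  -- The `+ 1` makes the grid points approach `t` from the right. They stay within the grid because
  -- `v < 1`, which is why `t = 0` was treated separately.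
  let s : ℕ → ℝ := fun m => u * (((⌊v * 2 ^ m⌋₊ + 1 : ℕ) : ℝ) / 2 ^ m) - u
  have hs1 : ∀ m, t ≤ s m := by
    intro m
    have : v ≤ ((⌊v * 2 ^ m⌋₊ + 1 : ℕ) : ℝ) / 2 ^ m := by
      rw [le_div_iff₀ (by positivity)]
      push_cast
      exact (Nat.lt_floor_add_one _).le
    rw [htv]
    simp only [s]
    gcongr
  have hs2 : ∀ m, s m ≤ t + u * (1 / 2) ^ m := by
    intro m
    have : ((⌊v * 2 ^ m⌋₊ + 1 : ℕ) : ℝ) / 2 ^ m ≤ v + (1 / 2) ^ m := by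
      rw [div_le_iff₀ (by positivity), add_mul, ← mul_pow]
      push_cast
      have := Nat.floor_le (show 0 ≤ v * 2 ^ m by positivity)
      norm_num
      exact this
    have := mul_le_mul_of_nonneg_left this hu.le
    rw [htv]
    simp only [s]
    linarith
  have hlim : Tendsto s atTop (𝓝 t) := by
    refine tendsto_of_tendsto_of_tendsto_of_le_of_le tendsto_const_nhds ?_ hs1 hs2
    simpa using ((tendsto_pow_atTop_nhds_zero_of_lt_one (r := (1 / 2 : ℝ)) (by norm_num)
      (by norm_num)).const_mul u).const_add t
  have hlim' : Tendsto s atTop (𝓝[≥] t) :=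
    tendsto_nhdsWithin_iff.2 ⟨hlim, Eventually.of_forall hs1⟩
  refine le_of_tendsto ((h t).1.tendsto.comp hlim').norm (Eventually.of_forall fun m => ?_)
  have hj : ⌊v * 2 ^ m⌋₊ + 1 ≤ 2 ^ m := by
    refine Nat.succ_le_of_lt ((Nat.floor_lt (by positivity)).2 ?_)
    push_cast
    exact mul_lt_of_lt_one_left (by positivity) hv1
  have h2 := hA' m _ hj
  have h3 := norm_add_le (ℓ (s m) - ℓ (-u)) (ℓ (-u))
  rw [sub_add_cancel] at h3
  show ‖ℓ (s m)‖ ≤ _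
  linarith

/-- On `[-2^k, 0]` the path exceeds a level of order `2^{2k/α}` with probability at most `4/3 ·
2^{-k}`, by Ottaviani's inequality and `tail_le`. Borel–Cantelli applies, and `α ≥ 1` makes the
level at most of order `(2^k)²`. -/
theorem ae_growth [IsProbabilityMeasure P] (hL : IsTwoSidedStableLevy α L P) (hα : 1 ≤ α) :
    ∀ᵐ ω ∂P, ∃ C, ∀ t ≤ 0, ‖L t ω‖ ≤ C * (1 + t ^ 2) := by
  have hα0 : 0 < α := by linarith
  obtain ⟨b, hb0, hb⟩ := hL.exists_tail_le
  let c : ℕ → ℝ := fun k => 4 * b * ((2 : ℝ) ^ k) ^ (1 / α)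
  let A : ℕ → ℝ := fun k => 2 * (c k * ((2 : ℝ) ^ k) ^ (1 / α))
  have hpow1 : ∀ k : ℕ, 1 ≤ ((2 : ℝ) ^ k) ^ (1 / α) := fun k =>
    Real.one_le_rpow (one_le_pow₀ (by norm_num)) (by positivity)
  have hpow2 : ∀ k : ℕ, ((2 : ℝ) ^ k) ^ (1 / α) ≤ 2 ^ k := fun k => by
    conv_rhs => rw [← Real.rpow_one ((2 : ℝ) ^ k)]
    exact Real.rpow_le_rpow_of_exponent_le (one_le_pow₀ (by norm_num))
      ((div_le_one hα0).2 hα)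
  have hA : ∀ k, A k ≤ 8 * b * (2 ^ k) ^ 2 := by
    intro k
    have := mul_le_mul (hpow2 k) (hpow2 k) (by linarith [hpow1 k]) (by positivity)
    simp only [A, c]
    nlinarith
  have hc : ∀ k, P.real {ω | c k < ‖L 1 ω‖} ≤ 1 / 4 := by
    intro k
    refine (measureReal_mono fun ω hω => ?_).trans hb
    have h1 : c k < ‖L 1 ω‖ := hω
    have h2 : b ≤ c k := by simp only [c]; nlinarith [hpow1 k]
    exact h2.trans_lt h1
  have hc' : ∀ k, P.real {ω | c k < ‖L 1 ω‖} ≤ (1 / 2) ^ k := by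
    intro k
    have := hL.tail_le hα0 hb (N := 2 ^ k) (by positivity)
    push_cast at this
    refine this.trans ?_
    rw [one_div_pow]
    apply one_div_le_one_div_of_le (by positivity)
    linarith [show (0 : ℝ) < 2 ^ k by positivity]
  let grid : ℕ → ℕ → ℕ → ℝ := fun k m j => 2 ^ k * ((j : ℝ) / 2 ^ m) - 2 ^ k
  let E : ℕ → ℕ → Set Ω := fun k m =>
    {ω | ∃ j ≤ 2 ^ m, A k < ‖L (grid k m j) ω - L (grid k m 0) ω‖}
  have hE : ∀ k m, P (E k m) ≤ ENNReal.ofReal (4 / 3 * (1 / 2) ^ k) := by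
    intro k m
    have hmono : Monotone (grid k m) := fun i j hij => by
      have : (i : ℝ) ≤ j := Nat.cast_le.2 hij
      simp only [grid]
      gcongr
    have := hL.measureReal_exists_grid_le hα0 hmono (N := 2 ^ m) (T := 2 ^ k) (by positivity)
      (by simp [grid]) (hc k)
    rw [← ofReal_measureReal]
    refine ENNReal.ofReal_le_ofReal (this.trans ?_)
    gcongr
    exact hc' k
  -- Dyadic grids are nested, so continuity from below carries the bound, uniform in `m`, to the
  -- union.
  have hEmono : ∀ k, Monotone (E k) := fun k => monotone_nat_of_le_succ fun m ω => by
    rintro ⟨j, hj, hω⟩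
    refine ⟨2 * j, by rw [pow_succ]; omega, ?_⟩
    have e1 : grid k (m + 1) (2 * j) = grid k m j := by
      simp only [grid, pow_succ]; push_cast; field_simp
    have e2 : grid k (m + 1) 0 = grid k m 0 := by simp [grid]
    rwa [e1, e2]
  have hU : ∀ k, P (⋃ m, E k m) ≤ ENNReal.ofReal (4 / 3 * (1 / 2) ^ k) := fun k => by
    rw [(hEmono k).measure_iUnion]
    exact iSup_le (hE k)
  have hsum : ∑' k, P (⋃ m, E k m) ≠ ⊤ := by
    refine ne_top_of_le_ne_top ?_ (ENNReal.tsum_le_tsum hU)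
    exact (((summable_geometric_of_lt_one (by norm_num) (by norm_num :
      (1 / 2 : ℝ) < 1)).mul_left (4 / 3)).tsum_ofReal_ne_top)
  filter_upwards [ae_eventually_notMem hsum] with ω hω
  obtain ⟨k₀, hk₀⟩ := eventually_atTop.1 hω
  have key : ∀ k ≥ k₀, ∀ t ∈ Icc (-2 ^ k : ℝ) 0, ‖L t ω‖ ≤ 16 * b * (2 ^ k) ^ 2 := by
    intro k hk t ht
    refine ((hL.cadlag ω).norm_le_of_dyadic (hL.zero ω) (A := A k) (by positivity)
      (fun m j hj => ?_) ht).trans (by linarith [hA k])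
    have := hk₀ k hk
    by_contra! hlt
    exact this (mem_iUnion.2 ⟨m, j, hj, hlt⟩)
  -- The constant is `16 b` times the 4 lost in rounding `|t|` up to `2^{k+1}`; the factor
  -- `(2^{k₀})²` covers the times before the Borel–Cantelli index.
  refine ⟨64 * b * (2 ^ k₀) ^ 2, fun t ht => ?_⟩
  have h2k : (1 : ℝ) ≤ (2 ^ k₀) ^ 2 := one_le_pow₀ (one_le_pow₀ (by norm_num))
  by_cases htk : -2 ^ k₀ ≤ t
  · refine (key k₀ le_rfl t ⟨htk, ht⟩).trans ?_
    have : 0 ≤ b * (2 ^ k₀) ^ 2 := by positivity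
    nlinarith [mul_nonneg this (sq_nonneg t)]
  · push Not at htk
    have h1 : (1 : ℝ) ≤ 2 ^ k₀ := one_le_pow₀ (by norm_num)
    obtain ⟨k, hk1, hk2⟩ := exists_nat_pow_near (x := -t) (y := 2) (by linarith) (by norm_num)
    have hkk : k₀ ≤ k + 1 := by
      refine ((pow_lt_pow_iff_right₀ (by norm_num : (1 : ℝ) < 2)).1 ?_).le
      linarith
    refine (key (k + 1) hkk t ⟨by linarith, ht⟩).trans ?_
    have h3 : ((2 : ℝ) ^ k) ^ 2 ≤ t ^ 2 := by
      rw [← neg_sq t]; gcongr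
    have h4 : ((2 : ℝ) ^ (k + 1)) ^ 2 = 4 * (2 ^ k) ^ 2 := by rw [pow_succ]; ring
    rw [h4]
    calc 16 * b * (4 * (2 ^ k) ^ 2) ≤ 64 * b * 1 * (1 + t ^ 2) := by nlinarith
      _ ≤ _ := by gcongr

theorem ae_isGoodPath [IsProbabilityMeasure P] (hL : IsTwoSidedStableLevy α L P) (hα : 1 ≤ α) :
    ∀ᵐ ω ∂P, IsGoodPath fun t => L t ω := by
  filter_upwards [hL.ae_growth hα] with ω hω using ⟨hL.cadlag ω, hω⟩

end IsTwoSidedStableLevy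

/-! ### Self-similarity of the law of a stable process -/

section Law

variable {Ω : Type*} [MeasurableSpace Ω] {P : Measure Ω} [IsProbabilityMeasure P] {n : ℕ}

theorem exists_monotone_range_superset (I : Finset ℝ) :
    ∃ t : ℕ → ℝ, Monotone t ∧ ∀ x ∈ I, ∃ m, t m = x := by
  classical
  set J := insert 0 I with hJ
  have hpos : 0 < J.card := Finset.card_pos.2 ⟨0, Finset.mem_insert_self _ _⟩
  let e := J.orderEmbOfFin rfl
  refine ⟨fun m => e ⟨min m (J.card - 1), by omega⟩, fun i j hij => ?_, fun x hx => ?_⟩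
  · exact e.monotone (Fin.mk_le_mk.2 (min_le_min_right _ hij))
  · have : x ∈ range e := by
      rw [Finset.range_orderEmbOfFin]
      exact Finset.mem_insert_of_mem hx
    obtain ⟨i, rfl⟩ := this
    refine ⟨i, congrArg e (Fin.ext ?_)⟩
    have := i.2
    show min (i : ℕ) (J.card - 1) = i
    omega

/-- A process with independent increments is determined in law by the laws of its increments. -/
theorem map_eq_of_indepIncrements {L M : ℝ → Ω → Euc n} (hLm : ∀ t, Measurable (L t))
    (hMm : ∀ t, Measurable (M t)) (hL0 : ∀ ω, L 0 ω = 0) (hM0 : ∀ ω, M 0 ω = 0)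
    (hL : HasIndepIncrements L P) (hM : HasIndepIncrements M P)
    (h : ∀ s t, s ≤ t → P.map (fun ω => L t ω - L s ω) = P.map (fun ω => M t ω - M s ω)) :
    P.map (fun ω t => L t ω) = P.map (fun ω t => M t ω) := by
  have hLp : Measurable fun ω t => L t ω := measurable_pi_lambda _ hLm
  have hMp : Measurable fun ω t => M t ω := measurable_pi_lambda _ hMm
  refine (map_eq_iff_forall_finset_map_restrict_eq hLp.aemeasurable hMp.aemeasurable).2 fun I => ?_
  -- Including time 0, where the process vanishes, expresses each value as a difference of partial
  -- sums of increments.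
  obtain ⟨t, ht, hI⟩ := exists_monotone_range_superset (insert 0 I)
  choose! m hm using hI
  have hm0 : t (m 0) = 0 := hm 0 (Finset.mem_insert_self _ _)
  let Φ : (ℕ → Euc n) → I → Euc n := fun d x =>
    ∑ i ∈ Finset.range (m x), d i - ∑ i ∈ Finset.range (m 0), d i
  have hΦ : Measurable Φ := measurable_pi_lambda _ fun x =>
    (Finset.measurable_fun_sum _ fun i _ => measurable_pi_apply i).sub
      (Finset.measurable_fun_sum _ fun i _ => measurable_pi_apply i)
  have key : ∀ {N : ℝ → Ω → Euc n}, (∀ t, Measurable (N t)) → (∀ ω, N 0 ω = 0) →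
      HasIndepIncrements N P → P.map (fun ω => I.restrict (fun s => N s ω)) =
        (Measure.infinitePi fun i => P.map fun ω => N (t (i + 1)) ω - N (t i) ω).map Φ := by
    intro N hNm hN0 hN
    have hd : ∀ i : ℕ, Measurable fun ω => N (t (i + 1)) ω - N (t i) ω := fun i =>
      (hNm _).sub (hNm _)
    rw [← (hN.nat ht).map_fun_eq_infinitePi_map hd,
      Measure.map_map hΦ (measurable_pi_lambda _ hd)]
    congr 1
    ext1 ω
    ext1 x
    have hs : ∀ j, ∑ i ∈ Finset.range j, (N (t (i + 1)) ω - N (t i) ω) =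
      N (t j) ω - N (t 0) ω := fun j => Finset.sum_range_sub (fun i => N (t i) ω) j
    simp only [Function.comp_apply, Φ, hs, hm0, hN0, Finset.restrict,
      hm x (Finset.mem_insert_of_mem x.2)]
    abel
  rw [key hLm hL0 hL, key hMm hM0 hM]
  congr 2
  ext1 i
  exact h _ _ (ht (Nat.le_succ i))

/-- Both processes have independent increments, and `ε^{-1/α} (ε (t - s))^{1/α} = (t - s)^{1/α}`
matches the laws of the increments. -/
theorem IsTwoSidedStableLevy.map_scaledPath {α : ℝ} {L : ℝ → Ω → Euc n}
    (hL : IsTwoSidedStableLevy α L P) (hα : 0 < α) {ε : ℝ} (hε : 0 < ε) :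
    P.map (fun ω => SlowFastSystem.scaledPath α ε fun t => L t ω) = P.map fun ω t => L t ω := by
  have hm : ∀ t, Measurable fun ω => ε ^ (-(1 / α)) • L (ε * t) ω := fun t =>
    (measurable_const_smul _).comp (hL.measurable (ε * t))
  refine map_eq_of_indepIncrements (L := fun t ω => ε ^ (-(1 / α)) • L (ε * t) ω) hm hL.measurable
    (fun ω => by simp [hL.zero ω]) hL.zero ?_ hL.indep_increments fun s t hst => ?_
  · refine HasIndepIncrements.smul (X := fun t => L (ε * t)) (fun N t ht => ?_) _
    exact hL.indep_increments N (fun i => ε * t i) fun i j hij =>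
      mul_le_mul_of_nonneg_left (ht hij) hε.le
  · have hst' : ε * s ≤ ε * t := mul_le_mul_of_nonneg_left hst hε.le
    have e1 : (fun ω => ε ^ (-(1 / α)) • L (ε * t) ω - ε ^ (-(1 / α)) • L (ε * s) ω) =
        (fun x : Euc n => ε ^ (-(1 / α)) • x) ∘ fun ω => L (ε * t) ω - L (ε * s) ω := by
      ext1 ω
      simp [smul_sub]
    have hm1 : Measurable fun ω => (ε * t - ε * s) ^ (1 / α) • L 1 ω :=
      (measurable_const_smul _).comp (hL.measurable 1)
    rw [e1, ← Measure.map_map (measurable_const_smul _) (hL.measurable_increment _ _),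
      hL.map_increment hα hst', hL.map_increment hα hst,
      Measure.map_map (measurable_const_smul _) hm1]
    congr 1
    ext1 ω
    simp only [Function.comp_apply, smul_smul]
    rw [← mul_sub, Real.mul_rpow hε.le (sub_nonneg.2 hst), ← mul_assoc, ← Real.rpow_add hε,
      neg_add_cancel, Real.rpow_zero, one_mul]

end Law

end

/-! ### The expansion of the slow manifold. -/

theorem theorem6 {n₁ n₂ : ℕ} {Ω : Type*} [MeasurableSpace Ω] (P : Measure Ω)
    [IsProbabilityMeasure P] (sys : SlowFastSystem n₁ n₂) (L : ℝ → Ω → Euc n₂)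
    (hα₁ : 1 < sys.α) (hα₂ : sys.α < 2) (hσ : 0 < sys.σ)
    (hL : IsTwoSidedStableLevy sys.α L P)
    (γs γf K : ℝ) (hγs : 0 < γs) (hγf : γf < 0) (hK : 0 < K)
    -- hypotheses on the linear parts
    (hS : ∀ t ≤ 0, ∀ x, ‖linFlow sys.S t x‖ ≤ Real.exp (γs * t) * ‖x‖)
    (hF : ∀ t ≥ 0, ∀ y, ‖linFlow sys.F t y‖ ≤ Real.exp (γf * t) * ‖y‖)
    -- hypotheses on the nonlinear parts
    (hg₁_zero : sys.g₁ (0, 0) = 0) (hg₂_zero : sys.g₂ (0, 0) = 0)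
    (hg₁ : ∀ x y x' y', ‖sys.g₁ (x, y) - sys.g₁ (x', y')‖ ≤ K * (‖x - x'‖ + ‖y - y'‖))
    (hg₂ : ∀ x y x' y', ‖sys.g₂ (x, y) - sys.g₂ (x', y')‖ ≤ K * (‖x - x'‖ + ‖y - y'‖))
    -- spectral gap
    (hgap : K < -γf)
    -- boundedness of the slow nonlinearity, regularity of the fast one
    (hg₁_bdd : ∃ C : ℝ, 0 < C ∧ ∀ p, ‖sys.g₁ p‖ ≤ C)
    (hg₂_diff : Differentiable ℝ sys.g₂)
    (hg₂_deriv : ∃ K' : NNReal, LipschitzWith K' (fderiv ℝ sys.g₂))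
    (γ : ℝ) (hγ : 0 < γ) (hγK : K < -(γ + γf)) :
    ∃ δ : ℝ, 0 < δ ∧
      -- the Ornstein-Uhlenbeck integrals converge
      (∀ᵐ ω ∂P, ∀ t, Tendsto (fun a => pathIntegral (fun s => linFlow sys.F (-s))
          (pathShift t (fun r => L r ω)) a 0) atBot (𝓝 (sys.xi (fun r => L r ω) t))) ∧
      (∀ᵐ ω ∂P, ∀ ε ∈ Ioo 0 δ, ∀ t, Tendsto
          (fun a => ε ^ (-(1 / sys.α)) • pathIntegral (fun s => linFlow (ε⁻¹ • sys.F) (-s))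
            (pathShift t (fun r => L r ω)) a 0) atBot (𝓝 (sys.eta ε (fun r => L r ω) t))) ∧
      -- `y⁰` and `y¹` are well defined, as unique solutions of their equations
      (∀ᵐ ω ∂P, ∀ x₀ : Euc n₁,
        let z : ℝ → Euc n₂ := fun s => sys.σ • sys.xi (fun r => L r ω) s
        (sys.IsCriticalFast γ z x₀ (sys.y0 γ z x₀) ∧
          ∀ y, sys.IsCriticalFast γ z x₀ y → EqOn y (sys.y0 γ z x₀) (Iic 0)) ∧
        (sys.IsFastCorrection γ z x₀ (sys.y1 γ z x₀) ∧
          ∀ y, sys.IsFastCorrection γ z x₀ y → EqOn y (sys.y1 γ z x₀) (Iic 0)) ∧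
        -- the explicit formula for `y¹` when the matrices in the linearized equation commute
        ((∀ y y', Commute (sys.g2y (x₀, y)) (sys.g2y (x₀, y'))) →
          (∀ y, Commute sys.F (sys.g2y (x₀, y))) →
          ∀ t ≤ 0, sys.y1 γ z x₀ t =
            NormedSpace.exp (t • sys.F +
                ∫ s in (0 : ℝ)..t, sys.g2y (sys.basePoint γ z x₀ s)) (sys.h1 γ z x₀) +
            ∫ s in (0 : ℝ)..t,
              NormedSpace.exp ((t - s) • sys.F +
                  ∫ u in s..t, sys.g2y (sys.basePoint γ z x₀ u))
                (sys.g2x (sys.basePoint γ z x₀ s) (sys.x1 γ z x₀ s)))) ∧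
      -- the expansion: the slow manifold is the graph of a random field `hhat ε`, which has the
      -- law of `h⁰ + ε h¹ + R ε`, where the remainder `R ε` is of order `ε²`
      ∃ hhat R : ℝ → Ω → Euc n₁ → Euc n₂,
        (∀ᵐ ω ∂P, ∀ ε ∈ Ioo 0 δ, sys.slowManifold γ ε (fun r => L r ω) =
          {p | p.2 = hhat ε ω p.1}) ∧
        (∀ ε ∈ Ioo 0 δ, IdentDistrib (fun ω x₀ => hhat ε ω x₀)
          (fun ω x₀ =>
            sys.h0 γ (fun s => sys.σ • sys.xi (fun r => L r ω) s) x₀ +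
            ε • sys.h1 γ (fun s => sys.σ • sys.xi (fun r => L r ω) s) x₀ +
            R ε ω x₀) P P) ∧
        (∀ r : ℝ, ∃ C : ℝ, ∀ᵐ ω ∂P, ∀ ε ∈ Ioo 0 δ, ∀ x₀ : Euc n₁, ‖x₀‖ ≤ r →
          ‖R ε ω x₀‖ ≤ C * ε ^ 2) := by
  obtain ⟨C₁, -, hC₁⟩ := hg₁_bdd
  obtain ⟨K', hK'⟩ := hg₂_deriv
  have h : sys.IsRegular γ γf K K' C₁ := ⟨hF, hK, K'.2, hγ, hγK, hg₂_zero, hg₁, hg₂, hC₁, hg₂_diff,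
    fun p q => by simpa [dist_eq_norm] using hK'.dist_le_mul p q⟩
  have hgood := hL.ae_isGoodPath hα₁.le
  set q₀ := K / (-(γ + γf)) with hq₀
  have hq₀1 : q₀ < 1 := (div_lt_one (hK.trans hγK)).2 hγK
  have hq : (1 + q₀) / 2 < 1 := by linarith
  set D := (‖sys.S‖ + K) / γ with hD
  have hD0 : 0 < D := by positivity
  -- This `δ` keeps every contraction ratio at most halfway between `q₀` and 1, which makes the
  -- remainder constant uniform in `ε`.
  have hcontr : ∀ ε ∈ Ioo 0 ((1 - q₀) / 2 / D),
      ε * (‖sys.S‖ + K) / γ + K / (-(γ + γf)) ≤ (1 + q₀) / 2 := by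
    intro ε hε
    have := (lt_div_iff₀ hD0).1 hε.2
    rw [mul_div_assoc]
    linarith
  -- The field `hhat` evaluates the functional at the rescaled path, while `R` is the error of the
  -- expansion for the functional at the original path.
  refine ⟨(1 - q₀) / 2 / D, div_pos (by linarith) hD0, ?_, ?_, ?_,
    fun ε ω => sys.graphMap ε (SlowFastSystem.scaledPath sys.α ε fun t => L t ω),
    fun ε ω x₀ => sys.graphMap ε (fun t => L t ω) x₀ -
      (sys.h0 γ (fun s => sys.σ • sys.xi (fun r => L r ω) s) x₀ +
        ε • sys.h1 γ (fun s => sys.σ • sys.xi (fun r => L r ω) s) x₀), ?_, ?_, ?_⟩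
  · filter_upwards [hgood] with ω hω t using SlowFastSystem.tendsto_xi hω hF hγf t
  · filter_upwards [hgood] with ω hω ε hε t using SlowFastSystem.tendsto_eta hω hF hγf hε.1 t
  · filter_upwards [hgood] with ω hω x₀
    have hz := SlowFastSystem.isGoodNoise (sys := sys) hω hF hγ h.gap'
    exact ⟨⟨h.isCriticalFast_y0 hz x₀, fun y hy => h.y0_unique hz hy⟩,
      ⟨h.isFastCorrection_y1 hz x₀, fun y hy => h.y1_unique hz hy⟩,
      fun hAA hFA t ht => h.y1_eq_of_commute hz x₀ hAA hFA ht⟩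
  · filter_upwards [hgood] with ω hω ε hε
    exact SlowFastSystem.slowManifold_eq h hγf hε.1 ((hcontr ε hε).trans_lt hq) hω
  · intro ε hε
    have hpath : Measurable fun ω t => L t ω := measurable_pi_lambda _ hL.measurable
    have hscaled : Measurable fun ω => SlowFastSystem.scaledPath sys.α ε fun t => L t ω :=
      measurable_pi_lambda _ fun t =>
        (measurable_const_smul (ε ^ (-(1 / sys.α)))).comp (hL.measurable (ε * t))
    have hid : IdentDistrib (fun ω => SlowFastSystem.scaledPath sys.α ε fun t => L t ω)
        (fun ω t => L t ω) P P := ⟨hscaled.aemeasurable, hpath.aemeasurable,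
      hL.map_scaledPath (by linarith) hε.1⟩
    have := hid.comp (SlowFastSystem.measurable_graphMap h ε)
    -- By the choice of `R` the second field collapses to the functional at `L`, so no measurability
    -- of `h⁰` or `h¹` in `ω` is required.
    simp only [add_sub_cancel]
    exact this
  · intro r
    obtain ⟨C, hC⟩ := h.exists_remainder_bound hq r
    refine ⟨C, ?_⟩
    filter_upwards [hgood] with ω hω ε hε x₀ hx
    have hz := SlowFastSystem.isGoodNoise (sys := sys) hω hF hγ h.gap'
    rw [SlowFastSystem.graphMap_eq h hγf hω]
    exact hC ε hε.1.le (hcontr ε hε) _ hz x₀ hx
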